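/- Let $\mathcal C$ be a modular tensor category: an abelian semisimple $\mathbb C$-linear ribbon category (braiding $c$, twist $\theta$, duality $\vee$) with finite-dimensional morphism spaces, simple tensor unit, finitely many isomorphism classes of simple objects with representatives $U_i$, and invertible matrix $s_{ij}=\mathrm{tr}(c_{U_j,U_i}\circ c_{U_i,U_j})$. Assume that every invertible object $X$ of $\mathcal C$ (i.e. $X\otimes X^\vee\cong\mathbf 1$) has dimension $\dim X=1$. Let $\mathrm{Pic}(\mathcal C)$ be the group of isomorphism classes of invertible objects. Choose representatives $L_g$ of the classes $g\in\mathrm{Pic}(\mathcal C)$ and isomorphisms $b_{g,h}:L_g\otimes L_h\to L_{gh}$. Write $\theta_g\in\mathbb C^\times$ for the scalar by which the twist acts on $L_g$, and define the three-cochain $\psi$ on $\mathrm{Pic}(\mathcal C)$ with values in $\mathbb C^\times$ by $$b_{gh,k}\circ(b_{g,h}\otimes\mathrm{id})=\psi(g,h,k)\; b_{g,hk}\circ(\mathrm{id}\otimes b_{h,k})\circ\alpha_{L_g,L_h,L_k},$$ where $\alpha$ is the associativity constraint. For a subgroup $H\le\mathrm{Pic}(\mathcal C)$ and $\omega:H\times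 H\to\mathbb C^\times$ put $(\mathrm d\omega)(g,h,k)=\omega(h,k)\,\omega(gh,k)^{-1}\,\omega(g,hk)\,\omega(g,h)^{-1}$. A *Schellekens algebra* in $\mathcal C$ is a Frobenius algebra $(A,m,\eta,\Delta,\varepsilon)$ that is special ($m\circ\Delta=\mathrm{id}_A$ and $\varepsilon\circ\eta=\dim(A)\,\mathrm{id}_{\mathbf 1}$), symmetric (the two canonical morphisms $A\to A^\vee$ built from $\varepsilon\circ m$ and the two coevaluations of $A$ coincide) and haploid (simple as a left module over itself), and all of whose simple subobjects are invertible. Its *support* is $H(A)=\{g\in\mathrm{Pic}(\mathcal C)\mid \dim_{\mathbb C}\mathrm{Hom}(L_g,A)>0\}$. Isomorphisms are isomorphisms of Frobenius algebras. We say that $A$ is *given by* $(H,\omega)$ if there are morphisms $e_h:L_h\to A$ $(h\in H)$ exhibiting $A$ as the direct sum $\bigoplus_{h\in H}L_h$ such that $m\circ(e_g\otimes e_h)=\omega(g,h)\,e_{gh}\circ b_{g,h}$ for all $g,h\in H$. A *Kreuzer–Schellekens bihomomorphism (KSB)* on a subgroup $H\le\mathrm{Pic}(\mathcal C)$ is a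 bihomomorphism $\Xi:H\times H\to\mathbb C^\times$ with $\Xi(g,h)\,\Xi(h,g)=\theta_g\theta_h/\theta_{gh}$ for all $g,h\in H$. For a Schellekens algebra $A$ whose support $H$ is a subgroup, let $\Xi_A:H\times H\to\mathbb C^\times$ be the function determined by $$m\circ(e_h\otimes e_g)\circ c_{L_h,L_g}^{-1}=\Xi_A(h,g)\; m\circ(e_g\otimes e_h)$$ for all $g,h\in H$ and all $e_g\in\mathrm{Hom}(L_g,A)$, $e_h\in\mathrm{Hom}(L_h,A)$. Then the following hold. 1. The support of every Schellekens algebra $A$ is a subgroup $H$ of $\mathrm{Pic}(\mathcal C)$, and $A$ is given by $(H,\omega)$ for some $\omega:H\times H\to\mathbb C^\times$ with $\mathrm d\omega=\psi|_H$. Conversely, for every subgroup $H$ and every $\omega:H\times H\to\mathbb C^\times$ with $\mathrm d\omega=\psi|_H$ there is a Schellekens algebra with support $H$ that is given by $(H,\omega)$, and any Schellekens algebra given by $(H,\omega)$ is isomorphic to it. 2. For every Schellekens algebra $A$ the function $\Xi_A$ exists and is unique; it is a KSB on $H(A)$, and $\Xi_A(h,h)=\theta_h^{-1}$ for all $h\in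 H(A)$. Two Schellekens algebras $A$, $B$ are isomorphic if and only if $H(A)=H(B)$ and $\Xi_A=\Xi_B$. Every pair $(H,\Xi)$ of a subgroup $H\le\mathrm{Pic}(\mathcal C)$ and a KSB $\Xi$ on $H$ with $\Xi(h,h)=\theta_h^{-1}$ for all $h\in H$ equals $(H(A),\Xi_A)$ for some Schellekens algebra $A$. 3. For every subgroup $H\le\mathrm{Pic}(\mathcal C)$ the following are equivalent: (i) there is a Schellekens algebra with support $H$; (ii) there is $\omega:H\times H\to\mathbb C^\times$ with $\mathrm d\omega=\psi|_H$; (iii) $\theta_h^{N_h}=1$ for every $h\in H$, where $N_h$ is the order of $h$. -/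

import Mathlib

open CategoryTheory MonoidalCategory
open scoped MonObj ComonObj

namespace Schellekens

universe v u

noncomputable section

/-! ### Ribbon and modular categories -/

/-- A twist on a braided category with duals: natural isomorphisms `θ_X : X ≅ X` that are balanced,
`θ_{X ⊗ Y} = c_{Y,X} ∘ (θ_Y ⊗ θ_X) ∘ c_{X,Y}`, and compatible with the duality,
`(θ_X ⊗ id) ∘ coev_X = (id ⊗ θ_{X^∨}) ∘ coev_X`. -/
class RibbonTwist (C : Type u) [Category.{v} C] [MonoidalCategory C] [BraidedCategory C]
    [RightRigidCategory C] where
  twist : ∀ X : C, X ≅ X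
  twist_naturality : ∀ {X Y : C} (f : X ⟶ Y), f ≫ (twist Y).hom = (twist X).hom ≫ f
  twist_tensor : ∀ X Y : C, (twist (X ⊗ Y)).hom =
    (β_ X Y).hom ≫ ((twist Y).hom ⊗ₘ (twist X).hom) ≫ (β_ Y X).hom
  twist_dual : ∀ X : C, η_ X Xᘁ ≫ (twist X).hom ▷ Xᘁ = η_ X Xᘁ ≫ X ◁ (twist Xᘁ).hom

section Ribbon

variable {C : Type u} [Category.{v} C] [MonoidalCategory C] [BraidedCategory C]
  [RightRigidCategory C]

/-- The twist `θ_X` as an endomorphism. -/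
abbrev twistHom [RibbonTwist C] (X : C) : X ⟶ X := (RibbonTwist.twist X).hom

/-- The second coevaluation `𝟙 ⟶ X^∨ ⊗ X` of a ribbon category,
`(id ⊗ θ_X) ∘ c_{X,X^∨} ∘ coev_X`. -/
def coevTilde [RibbonTwist C] (X : C) : 𝟙_ C ⟶ Xᘁ ⊗ X :=
  η_ X Xᘁ ≫ (β_ X Xᘁ).hom ≫ Xᘁ ◁ twistHom X

/-- The second evaluation `X ⊗ X^∨ ⟶ 𝟙` of a ribbon category,
`ev_X ∘ c_{X,X^∨} ∘ (θ_X ⊗ id)`. -/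
def evTilde [RibbonTwist C] (X : C) : X ⊗ Xᘁ ⟶ 𝟙_ C :=
  twistHom X ▷ Xᘁ ≫ (β_ X Xᘁ).hom ≫ ε_ X Xᘁ

/-- The (quantum) trace of an endomorphism, as an endomorphism of the tensor unit. -/
def ctrace [RibbonTwist C] {X : C} (f : X ⟶ X) : 𝟙_ C ⟶ 𝟙_ C :=
  η_ X Xᘁ ≫ f ▷ Xᘁ ≫ evTilde X

/-- The (quantum) dimension `dim X = tr (id_X)`, as an endomorphism of the tensor unit. -/
def qdim [RibbonTwist C] (X : C) : 𝟙_ C ⟶ 𝟙_ C := ctrace (𝟙 X)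

/-- An object `X` is invertible if `X ⊗ X^∨ ≅ 𝟙`. -/
def IsInvertible (X : C) : Prop := Nonempty (X ⊗ Xᘁ ≅ 𝟙_ C)

end Ribbon

/-- A `ℂ`-linear abelian ribbon category is modular if it has finite-dimensional morphism spaces,
is semisimple (every object is a finite direct sum of simple objects) with simple tensor unit, has finitely many isomorphism classes of simple objects,
and the matrix `s i j = tr (c_{U_j,U_i} ∘ c_{U_i,U_j})`, indexed by a set of representatives `U` of
these classes, is invertible. -/
class IsModular (C : Type u) [Category.{v} C] [Abelian C] [Linear ℂ C] [MonoidalCategory C]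
    [MonoidalPreadditive C] [MonoidalLinear ℂ C] [BraidedCategory C] [RightRigidCategory C]
    [RibbonTwist C] : Prop where
  finite_hom : ∀ X Y : C, Module.Finite ℂ (X ⟶ Y)
  simple_unit : Simple (𝟙_ C)
  semisimple : ∀ X : C, ∃ (n : ℕ) (S : Fin n → C) (j : ∀ i, S i ⟶ X),
    (∀ i, Simple (S i)) ∧ Nonempty (Limits.IsColimit (Limits.Cofan.mk X j))
  nondegenerate : ∃ (n : ℕ) (U : Fin n → C) (s : Matrix (Fin n) (Fin n) ℂ),
    (∀ i, Simple (U i)) ∧ (∀ X : C, Simple X → ∃! i, Nonempty (X ≅ U i)) ∧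
    (∀ i j, s i j • 𝟙 (𝟙_ C) = ctrace ((β_ (U i) (U j)).hom ≫ (β_ (U j) (U i)).hom)) ∧
    IsUnit s.det

/-! ### The Picard group -/

/-- The Picard group: isomorphism classes of invertible objects, with the tensor product. -/
abbrev Pic (C : Type u) [Category.{v} C] [MonoidalCategory C] : Type u := (Skeleton C)ˣ

section PicMonoidal

variable {C : Type u} [Category.{v} C] [MonoidalCategory C]

/-- The object `X` belongs to the isomorphism class `g`. -/
abbrev InClass (X : C) (g : Pic C) : Prop := toSkeleton X = (g : Skeleton C)

/-- An object in the isomorphism class `g`. -/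
def rep (g : Pic C) : C := (fromSkeleton C).obj (g : Skeleton C)

theorem inClass_rep (g : Pic C) : InClass (rep g) g := toSkeleton_fromSkeleton_obj _

theorem InClass.iso {X Y : C} {g : Pic C} (hX : InClass X g) (hY : InClass Y g) :
    Nonempty (X ≅ Y) := toSkeleton_eq_toSkeleton_iff.1 (hX.trans hY.symm)

theorem InClass.tensor {X Y : C} {g h : Pic C} (hX : InClass X g) (hY : InClass Y h) :
    InClass (X ⊗ Y) (g * h) := by
  unfold InClass at *
  rw [Skeleton.toSkeleton_tensorObj, hX, hY, Units.val_mul]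

theorem InClass.exists_inv {X : C} {g : Pic C} (hX : InClass X g) :
    ∃ Y : C, Nonempty (X ⊗ Y ≅ 𝟙_ C) ∧ Nonempty (Y ⊗ X ≅ 𝟙_ C) := by
  refine ⟨rep g⁻¹, ?_, ?_⟩ <;> rw [← toSkeleton_eq_toSkeleton_iff, ← Skeleton.one_eq]
  · rw [show toSkeleton (X ⊗ rep g⁻¹) = _ from hX.tensor (inClass_rep g⁻¹)]; simp
  · rw [show toSkeleton (rep g⁻¹ ⊗ X) = _ from (inClass_rep g⁻¹).tensor hX]; simp

/-- The classes that form the Picard group are exactly those of the invertible objects. -/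
theorem isInvertible_iff [BraidedCategory C] [RightRigidCategory C] {X : C} :
    IsInvertible X ↔ ∃ g : Pic C, InClass X g := by
  constructor
  · rintro ⟨e⟩
    have h : toSkeleton X * toSkeleton Xᘁ = 1 := by
      rw [← Skeleton.toSkeleton_tensorObj, Skeleton.one_eq, toSkeleton_eq_toSkeleton_iff]
      exact ⟨e⟩
    have h' : toSkeleton Xᘁ * toSkeleton X = 1 := by
      rw [← Skeleton.toSkeleton_tensorObj, Skeleton.one_eq, toSkeleton_eq_toSkeleton_iff]
      exact ⟨β_ _ _ ≪≫ e⟩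
    exact ⟨⟨toSkeleton X, toSkeleton Xᘁ, h, h'⟩, rfl⟩
  · rintro ⟨g, hg⟩
    obtain ⟨Y, ⟨e⟩, ⟨e'⟩⟩ := hg.exists_inv
    let E : C ≌ C := CategoryTheory.Equivalence.mk (tensorLeft X) (tensorLeft Y)
      (NatIso.ofComponents (fun Z => (λ_ Z).symm ≪≫ whiskerRightIso e'.symm Z ≪≫ α_ Y X Z)
        (by
          intro Z W f
          have h := whisker_exchange e'.inv f
          change f ≫ (λ_ W).inv ≫ e'.inv ▷ W ≫ (α_ Y X W).hom =
            ((λ_ Z).inv ≫ e'.inv ▷ Z ≫ (α_ Y X Z).hom) ≫ Y ◁ X ◁ f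
          rw [leftUnitor_inv_naturality_assoc, reassoc_of% h]
          simp))
      (NatIso.ofComponents (fun Z => (α_ X Y Z).symm ≪≫ whiskerRightIso e Z ≪≫ λ_ Z)
        (by
          intro Z W f
          have h := whisker_exchange e.hom f
          change X ◁ Y ◁ f ≫ (α_ X Y W).inv ≫ e.hom ▷ W ≫ (λ_ W).hom =
            ((α_ X Y Z).inv ≫ e.hom ▷ Z ≫ (λ_ Z).hom) ≫ f
          rw [associator_inv_naturality_right_assoc, reassoc_of% h, leftUnitor_naturality]
          simp))
    let a : tensorLeft Xᘁ ⊣ tensorLeft X := tensorLeftAdjunction X Xᘁ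
    let i : tensorLeft Xᘁ ≅ tensorLeft Y := a.leftAdjointUniq E.symm.toAdjunction
    exact ⟨whiskerLeftIso X ((ρ_ _).symm ≪≫ i.app (𝟙_ C) ≪≫ ρ_ _) ≪≫ e⟩

end PicMonoidal

section Pic

variable {C : Type u} [Category.{v} C] [Abelian C] [Linear ℂ C] [MonoidalCategory C]
  [MonoidalPreadditive C] [MonoidalLinear ℂ C] [BraidedCategory C] [RightRigidCategory C]
  [RibbonTwist C] [IsModular C]

theorem end_unit_scalar (f : 𝟙_ C ⟶ 𝟙_ C) : ∃ z : ℂ, z • 𝟙 (𝟙_ C) = f := by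
  have := IsModular.simple_unit (C := C)
  have := IsModular.finite_hom (𝟙_ C) (𝟙_ C)
  exact endomorphism_simple_eq_smul_id ℂ f

/-- Every endomorphism of an invertible object is a multiple of the identity. -/
theorem InClass.end_scalar {X : C} {g : Pic C} (hX : InClass X g) (f : X ⟶ X) :
    ∃ z : ℂ, f = z • 𝟙 X := by
  obtain ⟨Y, ⟨e⟩, ⟨e'⟩⟩ := hX.exists_inv
  obtain ⟨z, hz⟩ := end_unit_scalar (e.inv ≫ f ▷ Y ≫ e.hom)
  refine ⟨z, ?_⟩
  have h1 : f ▷ Y = (z • 𝟙 X) ▷ Y := by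
    have h := congrArg (fun t => e.hom ≫ t ≫ e.inv) hz
    simp only [Linear.smul_comp, Linear.comp_smul, Category.id_comp, Iso.hom_inv_id,
      Category.assoc, Iso.hom_inv_id_assoc, Category.comp_id] at h
    rw [← h, MonoidalLinear.smul_whiskerRight, id_whiskerRight]
  have h2 : ∀ t : X ⟶ X, t = (ρ_ X).inv ≫ X ◁ e'.inv ≫ (α_ X Y X).inv ≫ (t ▷ Y) ▷ X ≫
      (α_ X Y X).hom ≫ X ◁ e'.hom ≫ (ρ_ X).hom := by
    intro t
    simp only [whiskerRight_tensor_symm_assoc, Iso.inv_hom_id_assoc]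
    rw [← whisker_exchange_assoc]
    simp
  rw [h2 f, h1, ← h2]

/-- Two isomorphisms between invertible objects differ by a non-zero complex number. -/
theorem InClass.exists_unit_smul {X Y : C} {g : Pic C} (hX : InClass X g) (f f' : X ⟶ Y)
    [IsIso f] [IsIso f'] : ∃ z : ℂˣ, f = (z : ℂ) • f' := by
  obtain ⟨z, hz⟩ := hX.end_scalar (f ≫ inv f')
  obtain ⟨w, hw⟩ := hX.end_scalar (f' ≫ inv f)
  have h1 : f = z • f' := by
    have := congrArg (fun t => t ≫ f') hz
    simpa using this
  by_cases h0 : z = 0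
  · have hf : f = 0 := by rw [h1, h0, zero_smul]
    have hid : 𝟙 X = 0 := by
      calc 𝟙 X = f ≫ inv f := (IsIso.hom_inv_id f).symm
        _ = 0 ≫ inv f := congrArg (fun t => t ≫ inv f) hf
        _ = 0 := Limits.zero_comp
    refine ⟨1, ?_⟩
    rw [← Category.id_comp f, ← Category.id_comp f', hid]
    simp
  · exact ⟨Units.mk0 z h0, h1⟩

theorem exists_theta (g : Pic C) : ∃ z : ℂˣ, twistHom (rep g) = (z : ℂ) • 𝟙 (rep g) :=
  (inClass_rep g).exists_unit_smul _ _

/-- The number `θ_g`, i.e. the twist of the objects in the class `g`. -/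
def theta (g : Pic C) : ℂˣ := (exists_theta g).choose

theorem twistHom_eq {X : C} {g : Pic C} (hX : InClass X g) :
    twistHom X = (theta g : ℂ) • 𝟙 X := by
  obtain ⟨e⟩ := hX.iso (inClass_rep g)
  have h := RibbonTwist.twist_naturality e.hom
  rw [show (RibbonTwist.twist (rep g)).hom = (theta g : ℂ) • 𝟙 (rep g) from
    (exists_theta g).choose_spec] at h
  rw [← cancel_mono e.hom]
  simpa using h.symm

end Pic

/-- A choice of representatives `L g` of the isomorphism classes of invertible objects, and of
isomorphisms `L g ⊗ L h ≅ L (g h)`. -/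
structure PicFrame (C : Type u) [Category.{v} C] [MonoidalCategory C] where
  L : Pic C → C
  inClass : ∀ g, InClass (L g) g
  b : ∀ g h, L g ⊗ L h ≅ L (g * h)

instance {C : Type u} [Category.{v} C] [MonoidalCategory C] : Nonempty (PicFrame C) :=
  ⟨⟨rep, inClass_rep, fun g h =>
    (((inClass_rep g).tensor (inClass_rep h)).iso (inClass_rep (g * h))).some⟩⟩

namespace PicFrame

variable {C : Type u} [Category.{v} C] [Abelian C] [Linear ℂ C] [MonoidalCategory C]
  [MonoidalPreadditive C] [MonoidalLinear ℂ C] [BraidedCategory C] [RightRigidCategory C]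
  [RibbonTwist C] [IsModular C] (F : PicFrame C)

theorem exists_psi (g h k : Pic C) : ∃ z : ℂˣ,
    (F.b g h).hom ▷ F.L k ≫ (F.b (g * h) k).hom =
      (z : ℂ) • ((α_ (F.L g) (F.L h) (F.L k)).hom ≫ F.L g ◁ (F.b h k).hom ≫
        (F.b g (h * k)).hom ≫ eqToHom (congrArg F.L (mul_assoc g h k).symm)) :=
  (((F.inClass g).tensor (F.inClass h)).tensor (F.inClass k)).exists_unit_smul _ _

/-- The three-cochain given by the associativity constraint:
`b_{gh,k} ∘ (b_{g,h} ⊗ id) = ψ(g,h,k) b_{g,hk} ∘ (id ⊗ b_{h,k}) ∘ α`. -/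
def psi (g h k : Pic C) : ℂˣ := (F.exists_psi g h k).choose

theorem psi_spec (g h k : Pic C) :
    (F.b g h).hom ▷ F.L k ≫ (F.b (g * h) k).hom =
      (F.psi g h k : ℂ) • ((α_ (F.L g) (F.L h) (F.L k)).hom ≫ F.L g ◁ (F.b h k).hom ≫
        (F.b g (h * k)).hom ≫ eqToHom (congrArg F.L (mul_assoc g h k).symm)) :=
  (F.exists_psi g h k).choose_spec

/-- The two-cochain `ω` on the subgroup `H` satisfies `dω = ψ|_H`, where
`dω(g,h,k) = ω(h,k) ω(gh,k)⁻¹ ω(g,hk) ω(g,h)⁻¹`. -/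
def Trivializes (H : Subgroup (Pic C)) (ω : H → H → ℂˣ) : Prop :=
  ∀ g h k : H, ω h k * (ω (g * h) k)⁻¹ * ω g (h * k) * (ω g h)⁻¹ = F.psi g h k

end PicFrame

/-- `Ξ` is a Kreuzer–Schellekens bihomomorphism on the subgroup `H` of the Picard group. -/
structure IsKSB {C : Type u} [Category.{v} C] [Abelian C] [Linear ℂ C] [MonoidalCategory C]
    [MonoidalPreadditive C] [MonoidalLinear ℂ C] [BraidedCategory C] [RightRigidCategory C]
    [RibbonTwist C] [IsModular C] (H : Subgroup (Pic C)) (Ξ : H → H → ℂˣ) : Prop where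
  mul_left : ∀ g g' h, Ξ (g * g') h = Ξ g h * Ξ g' h
  mul_right : ∀ g h h', Ξ g (h * h') = Ξ g h * Ξ g h'
  symm : ∀ g h : H, Ξ g h * Ξ h g = theta (g : Pic C) * theta (h : Pic C) / theta (g * h : Pic C)

/-! ### Schellekens algebras -/

section Algebra

variable {C : Type u} [Category.{v} C] [MonoidalCategory C]

/-- An algebra and coalgebra is a Frobenius algebra if the coproduct is a morphism of
bimodules. -/
structure IsFrobenius (A : C) [MonObj A] [ComonObj A] : Prop where
  left : μ[A] ≫ Δ[A] = A ◁ Δ[A] ≫ (α_ A A A).inv ≫ μ[A] ▷ A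
  right : μ[A] ≫ Δ[A] = Δ[A] ▷ A ≫ (α_ A A A).hom ≫ A ◁ μ[A]

/-- The two morphisms `((ε ∘ m) ⊗ id) ∘ (id ⊗ coev_A)` and `(id ⊗ (ε ∘ m)) ∘ (coevTilde_A ⊗ id)`
from `A` to `A^∨` coincide. -/
def IsSymmetric [BraidedCategory C] [RightRigidCategory C] [RibbonTwist C]
    (A : C) [MonObj A] [ComonObj A] : Prop :=
  (ρ_ A).inv ≫ A ◁ η_ A Aᘁ ≫ (α_ A A Aᘁ).inv ≫ (μ[A] ≫ ε[A]) ▷ Aᘁ ≫ (λ_ Aᘁ).hom =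
    (λ_ A).inv ≫ coevTilde A ▷ A ≫ (α_ Aᘁ A A).hom ≫ Aᘁ ◁ (μ[A] ≫ ε[A]) ≫ (ρ_ Aᘁ).hom

/-- The coproduct is a right inverse of the product, and `ε ∘ η = dim A`. -/
structure IsSpecial [BraidedCategory C] [RightRigidCategory C] [RibbonTwist C]
    (A : C) [MonObj A] [ComonObj A] : Prop where
  comul_mul : Δ[A] ≫ μ[A] = 𝟙 A
  one_counit : η[A] ≫ ε[A] = qdim A

/-- `A` is simple as a left module over itself: a monomorphism of left `A`-modules with target `A`
is an isomorphism if and only if it is non-zero. -/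
def IsHaploid [Limits.HasZeroMorphisms C] (A : C) [MonObj A] : Prop :=
  ∀ (M : C) [ModObj A M] (f : M ⟶ A) [Mono f],
    (ModObj.smul (M := A) (X := M) : A ⊗ M ⟶ M) ≫ f = A ◁ f ≫ μ[A] → (IsIso f ↔ f ≠ 0)

end Algebra

/-- A Schellekens algebra: a haploid symmetric special Frobenius algebra all of whose simple
subobjects are invertible. -/
structure SchellekensAlgebra (C : Type u) [Category.{v} C] [Abelian C] [MonoidalCategory C]
    [BraidedCategory C] [RightRigidCategory C] [RibbonTwist C] where
  X : C
  [mon : MonObj X]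
  [comon : ComonObj X]
  frobenius : IsFrobenius X
  symmetric : IsSymmetric X
  special : IsSpecial X
  haploid : IsHaploid X
  invertible_of_simple : ∀ (U : C) (f : U ⟶ X) [Mono f], Simple U → IsInvertible U

attribute [instance] SchellekensAlgebra.mon SchellekensAlgebra.comon

namespace SchellekensAlgebra

variable {C : Type u} [Category.{v} C] [Abelian C] [Linear ℂ C] [MonoidalCategory C]
  [BraidedCategory C] [RightRigidCategory C] [RibbonTwist C]

/-- Isomorphism of Frobenius algebras. -/
def Isomorphic (A B : SchellekensAlgebra C) : Prop :=
  ∃ f : A.X ≅ B.X, IsMonHom f.hom ∧ IsComonHom f.hom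

/-- The support: the classes `g` with `dim Hom(L_g, A) > 0`. -/
def support (A : SchellekensAlgebra C) : Set (Pic C) :=
  {g | 0 < Module.finrank ℂ (rep g ⟶ A.X)}

/-- The algebra `A` is given by the subgroup `H` and the two-cochain `ω`: as an object it is the
direct sum of the `L h` with `h ∈ H`, with inclusions `e h`, and the product of `A` restricts on
`L g ⊗ L h` to `ω(g,h)` times the chosen isomorphism to `L (g h)`. -/
def IsGivenBy (A : SchellekensAlgebra C) (F : PicFrame C) (H : Subgroup (Pic C))
    (ω : H → H → ℂˣ) : Prop :=
  ∃ e : ∀ h : H, F.L (h : Pic C) ⟶ A.X,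
    Nonempty (Limits.IsColimit (Limits.Cofan.mk A.X e)) ∧
    ∀ g h : H, (e g ⊗ₘ e h) ≫ μ[A.X] = (ω g h : ℂ) • ((F.b g h).hom ≫ e (g * h))

/-- `H` is the support of `A` and `Ξ = Ξ_A`, where `Ξ_A(h,g)` is the factor of proportionality
between the two morphisms `L_g ⊗ L_h ⟶ A` obtained from the product of `A` with and without a
preceding (inverse) braiding:
`m ∘ (e_h ⊗ e_g) ∘ (c_{h,g})⁻¹ = Ξ_A(h,g) m ∘ (e_g ⊗ e_h)`, for all `e_g : L_g ⟶ A`,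
`e_h : L_h ⟶ A`. -/
def HasSupportAndKSB (A : SchellekensAlgebra C) (H : Subgroup (Pic C)) (Ξ : H → H → ℂˣ) : Prop :=
  A.support = (H : Set (Pic C)) ∧
  ∀ (g h : H) (X Y : C), InClass X (g : Pic C) → InClass Y (h : Pic C) →
    ∀ (e : X ⟶ A.X) (e' : Y ⟶ A.X),
      (β_ Y X).inv ≫ (e' ⊗ₘ e) ≫ μ[A.X] = (Ξ h g : ℂ) • ((e ⊗ₘ e') ≫ μ[A.X])

end SchellekensAlgebra

end

end Schellekens

open Schellekens

/-!
An invertible object is simple, and any two isomorphisms between invertible objects differ by a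
non-zero number. Once representatives `L g` and isomorphisms `b g h` are fixed, everything about
invertible objects is therefore encoded in numbers: the associator in `psi`, the braiding in `omega`
and the twist in `theta`. The pentagon and the hexagon become identities between these numbers
(`psi_pentagon`, `omega_hexagon`). The hypothesis on dimensions enters through
`InClass.selfBraiding`: the self-braiding of an invertible object of dimension one is its twist.

*From cochains to algebras.* If `dω = ψ` on `H`, the morphisms `ω(g,h) b g h` are associative
(`TwistedGroup`) and `⨁ L h` is an algebra, a twisted group algebra. It is Frobenius and special by
inspection, haploid because a non-zero submodule contains one, and hence every, summand, and
symmetric because its form is invariant under the braiding and the twist.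

*From algebras to cochains.* In a haploid algebra `A`, multiplication `A ⊗ X ⟶ A` by a non-zero
morphism `e : X ⟶ A` from an invertible object is an isomorphism: its image is a left ideal, and its
kernel, tensored with the inverse of `X`, is one too (`IsHaploid.isIso_mul_right`). Hence products
of non-zero morphisms from invertible objects do not vanish, so that the support is a subgroup. As
`Hom(𝟙, A)` is one-dimensional, by an eigenvalue argument, so is `Hom(L g, A)` for `g` in the
support. The structure constants of the product trivialize `ψ` (`trivializes_of_product`). They
determine `A` as a Frobenius algebra, since the counit vanishes outside the unit component and the
coproduct is determined by the product and the counit (`IsFrobenius.isComonHom`).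

*The bihomomorphism.* It is multiplicative by the hexagons, has the required symmetrization by the
balancing of the twist, and has diagonal `θ⁻¹` by `InClass.selfBraiding`. In terms of the structure
constants it is `Ξ(h,g) = Ω(h,g)⁻¹ ω(h,g) ω(g,h)⁻¹` (`IsGivenBy.hasSupportAndKSB`). If two algebras
have the same `Ξ`, then the quotient of their structure constants is a symmetric two-cocycle, which
is a coboundary because `ℂˣ` is divisible (`exists_coboundary_of_symmetric`). If `Ξ` and `Ξ'` have
the same symmetrization and the same diagonal, then `Ξ / Ξ'` is alternating, hence the
antisymmetrization of a bihomomorphism (`exists_bihom_of_alternating`), by which `ω`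
can be modified.

*The existence criterion.* A bihomomorphism with diagonal `θ⁻¹` gives
`θ_h ^ N = Ξ(h,h) ^ (-N) = Ξ(h ^ N, h)⁻¹ = 1` for the order `N` of `h`. Conversely, on the cyclic
group generated by `g` the obstruction to trivializing `ψ` is the product
`∏ ψ(g, g ^ j, g)` over `j < N`, which the hexagon identifies with `θ_g ^ (-N)`
(`exists_trivializes_zpowers`). A finite abelian group is a product of cyclic groups, and for
independent subgroups the tensor product of the algebras of the factors provides a trivialization
on their product (`Trivializes.exists_sup`).
-/

namespace Schellekens

universe v u w

noncomputable section

section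

/-! ### Duality and twist in a ribbon category -/

section Ribbon

variable {C : Type u} [Category.{v} C] [MonoidalCategory C] [BraidedCategory C]

/-- Sliding a strand `X` over a cup `coev` and then cancelling it against the cap `ev` leaves the
self-braiding of `X` next to the closed loop `ev ∘ c_{X,Y} ∘ coev`. -/
theorem selfBraiding_loop {X Y : C} (coev : 𝟙_ C ⟶ X ⊗ Y) (ev : Y ⊗ X ⟶ 𝟙_ C)
    (zig : coev ▷ X ≫ (α_ X Y X).hom ≫ X ◁ ev = (λ_ X).hom ≫ (ρ_ X).inv) :
    X ◁ coev ≫ (α_ X X Y).inv ≫ (β_ X X).hom ▷ Y ≫ (α_ X X Y).hom ≫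
      X ◁ ((β_ X Y).hom ≫ ev) = 𝟙 (X ⊗ 𝟙_ C) := by
  have h := BraidedCategory.hexagon_forward X X Y
  rw [whiskerLeft_comp, ← reassoc_of% h, Iso.inv_hom_id_assoc,
    BraidedCategory.braiding_naturality_right_assoc, zig]
  simp

variable [RightRigidCategory C] [RibbonTwist C]

/-- Naturality and balancing give `θ ∘ θ = θ` on the unit object. -/
theorem twistHom_unit : twistHom (𝟙_ C) = 𝟙 (𝟙_ C) := by
  have h1 : (λ_ (𝟙_ C)).hom ≫ twistHom (𝟙_ C) = twistHom (𝟙_ C ⊗ 𝟙_ C) ≫ (λ_ (𝟙_ C)).hom :=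
    RibbonTwist.twist_naturality (λ_ (𝟙_ C)).hom
  have h2 : twistHom (𝟙_ C ⊗ 𝟙_ C) =
      (β_ (𝟙_ C) (𝟙_ C)).hom ≫ (twistHom (𝟙_ C) ⊗ₘ twistHom (𝟙_ C)) ≫ (β_ (𝟙_ C) (𝟙_ C)).hom :=
    RibbonTwist.twist_tensor _ _
  rw [h2] at h1
  simp only [braiding_tensorUnit_left, MonoidalCategory.tensorHom_def, Category.assoc,
    unitors_equal, Category.comp_id, Category.id_comp, Iso.hom_inv_id] at h1
  have h3 : 𝟙_ C ◁ twistHom (𝟙_ C) ≫ (ρ_ (𝟙_ C)).hom = (ρ_ (𝟙_ C)).hom ≫ twistHom (𝟙_ C) := by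
    rw [← unitors_equal, leftUnitor_naturality]
  rw [h3, rightUnitor_naturality_assoc, cancel_epi] at h1
  have h4 : twistHom (𝟙_ C) ≫ 𝟙 _ = twistHom (𝟙_ C) ≫ twistHom (𝟙_ C) := by
    rw [Category.comp_id]; exact h1
  exact ((cancel_epi _).1 h4).symm

/-- By balancing, a further twist turns the second coevaluation into the coevaluation followed by
the inverse braiding. -/
theorem coevTilde_twist (X : C) :
    coevTilde X ≫ Xᘁ ◁ twistHom X = η_ X Xᘁ ≫ (β_ Xᘁ X).inv := by
  have h1 : η_ X Xᘁ ≫ twistHom (X ⊗ Xᘁ) = twistHom (𝟙_ C) ≫ η_ X Xᘁ :=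
    RibbonTwist.twist_naturality (η_ X Xᘁ)
  have h2 : twistHom (X ⊗ Xᘁ) =
      (β_ X Xᘁ).hom ≫ (twistHom Xᘁ ⊗ₘ twistHom X) ≫ (β_ Xᘁ X).hom :=
    RibbonTwist.twist_tensor _ _
  have h3 : η_ X Xᘁ ≫ twistHom X ▷ Xᘁ = η_ X Xᘁ ≫ X ◁ twistHom Xᘁ := RibbonTwist.twist_dual X
  rw [twistHom_unit, Category.id_comp, h2] at h1
  rw [Iso.eq_comp_inv, ← h1, coevTilde, MonoidalCategory.tensorHom_def]
  simp only [Category.assoc]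
  rw [← BraidedCategory.braiding_naturality_right_assoc, ← reassoc_of% h3,
    BraidedCategory.braiding_naturality_left_assoc]

/-- One of the zigzag identities between the second coevaluation and the second evaluation. -/
theorem coevTilde_evTilde (X : C) :
    coevTilde X ▷ Xᘁ ≫ (α_ Xᘁ X Xᘁ).hom ≫ Xᘁ ◁ evTilde X = (λ_ Xᘁ).hom ≫ (ρ_ Xᘁ).inv := by
  have h := (BraidedCategory.exactPairing_swap X Xᘁ).evaluation_coevaluation'
  change (η_ X Xᘁ ≫ (β_ Xᘁ X).inv) ▷ Xᘁ ≫ (α_ Xᘁ X Xᘁ).hom ≫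
    Xᘁ ◁ ((β_ X Xᘁ).hom ≫ ε_ X Xᘁ) = _ at h
  rw [← h, ← coevTilde_twist, evTilde, comp_whiskerRight_assoc, whisker_assoc_assoc,
    Iso.inv_hom_id_assoc, ← whiskerLeft_comp, BraidedCategory.braiding_naturality_left_assoc]

/-- The second evaluation is dinatural. -/
theorem evTilde_dinatural {X Y : C} (f : X ⟶ Y) :
    X ◁ fᘁ ≫ evTilde X = f ▷ Yᘁ ≫ evTilde Y := by
  have h1 : f ≫ twistHom Y = twistHom X ≫ f := RibbonTwist.twist_naturality f
  have h2 := rightAdjointMate_comp_evaluation f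
  unfold evTilde
  rw [whisker_exchange_assoc, BraidedCategory.braiding_naturality_right_assoc, h2,
    ← comp_whiskerRight_assoc f, h1, comp_whiskerRight_assoc]
  simp only [BraidedCategory.braiding_naturality_left_assoc]

theorem ctrace_comm {X Y : C} (f : X ⟶ Y) (g : Y ⟶ X) : ctrace (f ≫ g) = ctrace (g ≫ f) := by
  have h := coevaluation_comp_rightAdjointMate f
  unfold ctrace
  rw [comp_whiskerRight_assoc, comp_whiskerRight_assoc, ← reassoc_of% h, whisker_exchange_assoc,
    evTilde_dinatural]

/-- An algebra and coalgebra is symmetric as soon as the form `κ = ε ∘ m` satisfies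
`κ = κ ∘ c ∘ (θ ⊗ id)`. -/
theorem isSymmetric_of_form {A : C} [MonObj A] [ComonObj A]
    (h : twistHom A ▷ A ≫ (β_ A A).hom ≫ μ[A] ≫ ε[A] = μ[A] ≫ ε[A]) : IsSymmetric A := by
  unfold IsSymmetric
  generalize μ[A] ≫ ε[A] = κ at h ⊢
  set Φ : A ⟶ Aᘁ := (ρ_ A).inv ≫ A ◁ η_ A Aᘁ ≫ (α_ A A Aᘁ).inv ≫ κ ▷ Aᘁ ≫ (λ_ Aᘁ).hom with hΦ
  have h1 : Φ ▷ A ≫ ε_ A Aᘁ = κ := by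
    have z : η_ A Aᘁ ▷ A ≫ (α_ A Aᘁ A).hom ≫ A ◁ ε_ A Aᘁ = (λ_ A).hom ≫ (ρ_ A).inv :=
      ExactPairing.evaluation_coevaluation' (X := A) (Y := Aᘁ)
    calc Φ ▷ A ≫ ε_ A Aᘁ = 𝟙 _ ⊗≫ A ◁ (η_ A Aᘁ ▷ A) ⊗≫
          (κ ▷ (Aᘁ ⊗ A) ≫ 𝟙_ C ◁ ε_ A Aᘁ) ⊗≫ 𝟙 _ := by rw [hΦ]; monoidal
      _ = 𝟙 _ ⊗≫ A ◁ (η_ A Aᘁ ▷ A ≫ (α_ A Aᘁ A).hom ≫ A ◁ ε_ A Aᘁ) ⊗≫ κ ⊗≫ 𝟙 _ := by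
        rw [← whisker_exchange]; monoidal
      _ = κ := by rw [z]; monoidal
  have h2 : A ◁ Φ ≫ evTilde A = κ := by
    rw [evTilde, whisker_exchange_assoc, BraidedCategory.braiding_naturality_right_assoc, h1, h]
  rw [← h2]
  have h3 := coevTilde_evTilde A
  calc Φ = (λ_ A).inv ≫ 𝟙_ C ◁ Φ ≫ (λ_ Aᘁ).hom := by simp
    _ = (λ_ A).inv ≫ 𝟙_ C ◁ Φ ≫ (coevTilde A ▷ Aᘁ ≫ (α_ Aᘁ A Aᘁ).hom ≫ Aᘁ ◁ evTilde A) ≫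
        (ρ_ Aᘁ).hom := by rw [h3]; simp
    _ = _ := by
      simp only [Category.assoc]
      rw [whisker_exchange_assoc]
      simp

end Ribbon

end

section

/-! ### Invertible objects -/

section Invertible

variable {C : Type u} [Category.{v} C] [MonoidalCategory C]

theorem InClass.of_iso {X Y : C} {g : Pic C} (hX : InClass X g) (e : X ≅ Y) : InClass Y g :=
  (toSkeleton_eq_toSkeleton_iff.2 ⟨e.symm⟩).trans hX

theorem InClass.eq_of_iso {X Y : C} {g h : Pic C} (hX : InClass X g) (hY : InClass Y h)
    (e : X ≅ Y) : g = h :=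
  Units.ext (hX.symm.trans ((toSkeleton_eq_toSkeleton_iff.2 ⟨e⟩).trans hY))

theorem InClass.unit : InClass (𝟙_ C) (1 : Pic C) := rfl

theorem InClass.isInvertible [BraidedCategory C] [RightRigidCategory C] {X : C} {g : Pic C}
    (hX : InClass X g) : IsInvertible X :=
  isInvertible_iff.2 ⟨g, hX⟩

theorem InClass.isEquivalence_tensorRight {X : C} {g : Pic C} (hX : InClass X g) :
    (tensorRight X).IsEquivalence := by
  obtain ⟨Y, ⟨e⟩, ⟨e'⟩⟩ := hX.exists_inv
  refine (CategoryTheory.Equivalence.mk (tensorRight X) (tensorRight Y)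
    (NatIso.ofComponents (fun Z => (ρ_ Z).symm ≪≫ whiskerLeftIso Z e.symm ≪≫ (α_ Z X Y).symm) ?_)
    (NatIso.ofComponents (fun Z => α_ Z Y X ≪≫ whiskerLeftIso Z e' ≪≫ ρ_ Z)
      ?_)).isEquivalence_functor
  · intro Z W f
    have h := whisker_exchange f e.inv
    change f ≫ (ρ_ W).inv ≫ W ◁ e.inv ≫ (α_ W X Y).inv =
      ((ρ_ Z).inv ≫ Z ◁ e.inv ≫ (α_ Z X Y).inv) ≫ (f ▷ X) ▷ Y
    rw [rightUnitor_inv_naturality_assoc, ← reassoc_of% h]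
    simp
  · intro Z W f
    have h := whisker_exchange f e'.hom
    change (f ▷ Y) ▷ X ≫ (α_ W Y X).hom ≫ W ◁ e'.hom ≫ (ρ_ W).hom =
      ((α_ Z Y X).hom ≫ Z ◁ e'.hom ≫ (ρ_ Z).hom) ≫ f
    rw [associator_naturality_left_assoc, ← reassoc_of% h, rightUnitor_naturality]
    simp

theorem pic_mul_comm [BraidedCategory C] (g h : Pic C) : g * h = h * g :=
  ((inClass_rep g).tensor (inClass_rep h)).eq_of_iso ((inClass_rep h).tensor (inClass_rep g))
    (β_ _ _)

end Invertible

theorem smul_hom_injective {C : Type u} [Category.{v} C] [Preadditive C] [Linear ℂ C] {X Y : C}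
    {f : X ⟶ Y} (hf : f ≠ 0) {z w : ℂ} (h : z • f = w • f) : z = w :=
  smul_left_injective ℂ hf h

section Linear

variable {C : Type u} [Category.{v} C] [Preadditive C] [Linear ℂ C] [MonoidalCategory C]
  [MonoidalPreadditive C] [MonoidalLinear ℂ C]

theorem tensorHom_smul {W X Y Z : C} (f : W ⟶ X) (z : ℂ) (g : Y ⟶ Z) :
    f ⊗ₘ (z • g) = z • (f ⊗ₘ g) := by
  simp [MonoidalCategory.tensorHom_def]

theorem smul_tensorHom {W X Y Z : C} (z : ℂ) (f : W ⟶ X) (g : Y ⟶ Z) :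
    (z • f) ⊗ₘ g = z • (f ⊗ₘ g) := by
  simp [MonoidalCategory.tensorHom_def]

end Linear

section InvertibleModular

variable {C : Type u} [Category.{v} C] [Abelian C] [Linear ℂ C] [MonoidalCategory C]
  [MonoidalPreadditive C] [MonoidalLinear ℂ C] [BraidedCategory C] [RightRigidCategory C]
  [RibbonTwist C] [IsModular C]

instance : Simple (𝟙_ C) := IsModular.simple_unit

instance (X Y : C) : Module.Finite ℂ (X ⟶ Y) := IsModular.finite_hom X Y

theorem smul_id_unit_injective {z w : ℂ} (h : z • 𝟙 (𝟙_ C) = w • 𝟙 (𝟙_ C)) : z = w :=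
  smul_left_injective ℂ (id_nonzero (𝟙_ C)) h

/-- Tensoring with an inverse of `X` is an equivalence which maps `X` to the simple object `𝟙`. -/
theorem InClass.simple {X : C} {g : Pic C} (hX : InClass X g) : Simple X := by
  obtain ⟨e⟩ := (hX.tensor (inClass_rep g⁻¹)).iso
    (show InClass (𝟙_ C) (g * g⁻¹) by rw [mul_inv_cancel]; exact InClass.unit)
  have := (inClass_rep g⁻¹).isEquivalence_tensorRight
  refine ⟨fun {Y} f _ => ?_⟩
  have hm : Mono ((tensorRight (rep g⁻¹)).map f) := inferInstance
  have hm' : Mono (f ▷ rep g⁻¹) := hm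
  have h := Simple.mono_isIso_iff_nonzero (f ▷ rep g⁻¹ ≫ e.hom)
  rw [isIso_comp_right_iff] at h
  have h1 : IsIso f ↔ IsIso (f ▷ rep g⁻¹) :=
    ⟨fun _ => inferInstance, fun h => by
      have : IsIso ((tensorRight (rep g⁻¹)).map f) := h
      exact isIso_of_reflects_iso f (tensorRight (rep g⁻¹))⟩
  have h2 : f = 0 ↔ f ▷ rep g⁻¹ ≫ e.hom = 0 := by
    constructor
    · rintro rfl; simp
    · intro h0
      rw [Preadditive.IsIso.comp_right_eq_zero] at h0
      exact (tensorRight (rep g⁻¹)).map_injective (by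
        rw [Functor.map_zero]; exact h0)
  rw [h1, h, ne_eq, ne_eq, h2]

theorem InClass.id_ne_zero {X : C} {g : Pic C} (hX : InClass X g) : 𝟙 X ≠ 0 :=
  have := hX.simple
  id_nonzero X

theorem InClass.isIso_ne_zero {X Y : C} {g : Pic C} (hX : InClass X g) (f : X ⟶ Y) [IsIso f] :
    f ≠ 0 := by
  intro h
  apply hX.id_ne_zero
  rw [← IsIso.hom_inv_id f]
  generalize inv f = f'
  rw [h, Limits.zero_comp]

theorem InClass.eq_of_ne_zero {X Y : C} {g h : Pic C} (hX : InClass X g) (hY : InClass Y h)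
    {f : X ⟶ Y} (hf : f ≠ 0) : g = h := by
  have := hX.simple
  have := hY.simple
  have := isIso_of_hom_simple hf
  exact hX.eq_of_iso hY (asIso f)

instance : Finite (Pic C) := by
  obtain ⟨n, U, -, -, hU, -, -⟩ := IsModular.nondegenerate (C := C)
  choose i hi using fun g : Pic C => (hU (rep g) (inClass_rep g).simple).exists
  refine Finite.of_injective i fun g h hgh => ?_
  obtain ⟨a⟩ := hi g
  obtain ⟨b⟩ := hi h
  rw [← hgh] at b
  exact (inClass_rep g).eq_of_iso (inClass_rep h) (a ≪≫ b.symm)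

/-- For an invertible object, a closed loop with one self-crossing evaluates to the inverse of the
self-braiding. Here `Y` need not be the chosen dual of `X`. -/
theorem InClass.loop {X Y : C} {g : Pic C} (hX : InClass X g) (coev : 𝟙_ C ⟶ X ⊗ Y)
    (ev : Y ⊗ X ⟶ 𝟙_ C)
    (zig : coev ▷ X ≫ (α_ X Y X).hom ≫ X ◁ ev = (λ_ X).hom ≫ (ρ_ X).inv)
    {t : ℂ} (ht : (β_ X X).hom = t • 𝟙 (X ⊗ X)) :
    t • (coev ≫ (β_ X Y).hom ≫ ev) = 𝟙 (𝟙_ C) := by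
  obtain ⟨z, hz⟩ := end_unit_scalar (coev ≫ (β_ X Y).hom ≫ ev)
  have h := selfBraiding_loop coev ev zig
  rw [ht] at h
  simp only [MonoidalLinear.smul_whiskerRight, id_whiskerRight, Linear.smul_comp,
    Linear.comp_smul, Category.id_comp, Iso.inv_hom_id_assoc] at h
  rw [← whiskerLeft_comp, ← hz, MonoidalLinear.whiskerLeft_smul, smul_smul, whiskerLeft_id] at h
  have h1 : t * z = 1 :=
    smul_hom_injective (hX.tensor InClass.unit).id_ne_zero (h.trans (one_smul ℂ _).symm)
  rw [← hz, smul_smul, h1, one_smul]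

/-- An invertible object of dimension one braids with itself by its twist. -/
theorem InClass.selfBraiding (hdim : ∀ X : C, IsInvertible X → qdim X = 𝟙 (𝟙_ C)) {X : C}
    {g : Pic C} (hX : InClass X g) : (β_ X X).hom = (theta g : ℂ) • 𝟙 (X ⊗ X) := by
  obtain ⟨t, ht⟩ := (hX.tensor hX).end_scalar (β_ X X).hom
  have h := hX.loop (η_ X Xᘁ) (ε_ X Xᘁ)
    (ExactPairing.evaluation_coevaluation' (X := X) (Y := Xᘁ)) ht
  have h1 := hdim X hX.isInvertible
  rw [qdim, ctrace, evTilde, twistHom_eq hX] at h1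
  simp only [MonoidalLinear.smul_whiskerRight, id_whiskerRight, Linear.smul_comp,
    Linear.comp_smul, Category.id_comp] at h1
  obtain ⟨z, hz⟩ := end_unit_scalar (η_ X Xᘁ ≫ (β_ X Xᘁ).hom ≫ ε_ X Xᘁ)
  rw [← hz, smul_smul] at h h1
  have h2 : t * z = 1 := smul_id_unit_injective (h.trans (one_smul ℂ _).symm)
  have h3 : (theta g : ℂ) * z = 1 := smul_id_unit_injective (h1.trans (one_smul ℂ _).symm)
  have hz0 : z ≠ 0 := by rintro rfl; simp at h2
  rw [ht, mul_right_cancel₀ hz0 (h2.trans h3.symm)]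

end InvertibleModular

end

section

/-! ### The cochains of the associativity constraint and of the braiding -/

namespace PicFrame

variable {C : Type u} [Category.{v} C] [MonoidalCategory C] (F : PicFrame C)

theorem eqToHom_whiskerRight_b {g g' : Pic C} (e : g = g') (k : Pic C) :
    eqToHom (congrArg F.L e) ▷ F.L k ≫ (F.b g' k).hom =
      (F.b g k).hom ≫ eqToHom (congrArg (fun x => F.L (x * k)) e) := by
  subst e; simp

theorem whiskerLeft_eqToHom_b {g g' : Pic C} (e : g = g') (k : Pic C) :
    F.L k ◁ eqToHom (congrArg F.L e) ≫ (F.b k g').hom =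
      (F.b k g).hom ≫ eqToHom (congrArg (fun x => F.L (k * x)) e) := by
  subst e; simp

variable [Abelian C] [Linear ℂ C]
  [MonoidalPreadditive C] [MonoidalLinear ℂ C] [BraidedCategory C] [RightRigidCategory C]
  [RibbonTwist C] [IsModular C]

/-- The pentagon axiom says that `ψ` is a three-cocycle. -/
theorem psi_pentagon (g h k l : Pic C) :
    F.psi h k l * F.psi g (h * k) l * F.psi g h k = F.psi (g * h) k l * F.psi g h (k * l) := by
  -- both sides are the factor between the products with bracketings `((g h) k) l` and
  -- `g (h (k l))`, passing through `g ((h k) l)` for `hA` and through `(g h) (k l)` for `hB`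
  have hA : (F.b g h).hom ▷ F.L k ▷ F.L l ≫ (F.b (g * h) k).hom ▷ F.L l ≫ (F.b (g * h * k) l).hom =
      ((F.psi h k l * F.psi g (h * k) l * F.psi g h k : ℂˣ) : ℂ) •
        ((α_ (F.L g) (F.L h) (F.L k)).hom ▷ F.L l ≫ (α_ (F.L g) (F.L h ⊗ F.L k) (F.L l)).hom ≫
          F.L g ◁ (α_ (F.L h) (F.L k) (F.L l)).hom ≫ F.L g ◁ F.L h ◁ (F.b k l).hom ≫
          F.L g ◁ (F.b h (k * l)).hom ≫ (F.b g (h * (k * l))).hom ≫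
          eqToHom (congrArg F.L (by simp only [mul_assoc]))) := by
    rw [← comp_whiskerRight_assoc, F.psi_spec g h k]
    simp only [MonoidalLinear.smul_whiskerRight, comp_whiskerRight, Linear.smul_comp,
      Category.assoc]
    rw [F.eqToHom_whiskerRight_b (mul_assoc g h k).symm l, reassoc_of% F.psi_spec g (h * k) l]
    simp only [Linear.smul_comp, Linear.comp_smul, Category.assoc]
    rw [associator_naturality_middle_assoc, ← whiskerLeft_comp_assoc, F.psi_spec h k l]
    simp only [MonoidalLinear.whiskerLeft_smul, whiskerLeft_comp, Linear.smul_comp,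
      Linear.comp_smul, Category.assoc]
    rw [reassoc_of% F.whiskerLeft_eqToHom_b (mul_assoc h k l).symm g]
    simp only [eqToHom_trans, smul_smul, Units.val_mul]
    congr 1
    ring
  have hB : (F.b g h).hom ▷ F.L k ▷ F.L l ≫ (F.b (g * h) k).hom ▷ F.L l ≫ (F.b (g * h * k) l).hom =
      ((F.psi (g * h) k l * F.psi g h (k * l) : ℂˣ) : ℂ) •
        ((α_ (F.L g) (F.L h) (F.L k)).hom ▷ F.L l ≫ (α_ (F.L g) (F.L h ⊗ F.L k) (F.L l)).hom ≫
          F.L g ◁ (α_ (F.L h) (F.L k) (F.L l)).hom ≫ F.L g ◁ F.L h ◁ (F.b k l).hom ≫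
          F.L g ◁ (F.b h (k * l)).hom ≫ (F.b g (h * (k * l))).hom ≫
          eqToHom (congrArg F.L (by simp only [mul_assoc]))) := by
    rw [F.psi_spec (g * h) k l]
    simp only [Linear.comp_smul]
    rw [associator_naturality_left_assoc, ← whisker_exchange_assoc,
      reassoc_of% F.psi_spec g h (k * l)]
    simp only [Linear.smul_comp, Linear.comp_smul, Category.assoc, eqToHom_trans, smul_smul,
      Units.val_mul, pentagon_assoc, associator_naturality_right_assoc]
  have hne := ((((F.inClass g).tensor (F.inClass h)).tensor (F.inClass k)).tensor
    (F.inClass l)).isIso_ne_zero ((α_ (F.L g) (F.L h) (F.L k)).hom ▷ F.L l ≫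
      (α_ (F.L g) (F.L h ⊗ F.L k) (F.L l)).hom ≫
          F.L g ◁ (α_ (F.L h) (F.L k) (F.L l)).hom ≫ F.L g ◁ F.L h ◁ (F.b k l).hom ≫
          F.L g ◁ (F.b h (k * l)).hom ≫ (F.b g (h * (k * l))).hom ≫
          eqToHom (congrArg F.L (show g * (h * (k * l)) = g * h * k * l by simp only [mul_assoc])))
  exact Units.ext (smul_hom_injective hne (hA.symm.trans hB))

theorem exists_omega (g h : Pic C) : ∃ z : ℂˣ,
    (β_ (F.L g) (F.L h)).hom ≫ (F.b h g).hom ≫ eqToHom (congrArg F.L (pic_mul_comm h g)) =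
      (z : ℂ) • (F.b g h).hom :=
  ((F.inClass g).tensor (F.inClass h)).exists_unit_smul _ _

/-- The two-cochain given by the braiding: `b_{h,g} ∘ c_{g,h} = Ω(g,h) b_{g,h}`. -/
def omega (g h : Pic C) : ℂˣ := (F.exists_omega g h).choose

theorem omega_spec (g h : Pic C) :
    (β_ (F.L g) (F.L h)).hom ≫ (F.b h g).hom =
      (F.omega g h : ℂ) • ((F.b g h).hom ≫ eqToHom (congrArg F.L (pic_mul_comm g h))) := by
  have := (F.exists_omega g h).choose_spec
  rw [← Linear.smul_comp]
  erw [← this]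
  simp

theorem omega_self (hdim : ∀ X : C, IsInvertible X → qdim X = 𝟙 (𝟙_ C)) (g : Pic C) :
    F.omega g g = theta g := by
  have h := F.omega_spec g g
  rw [(F.inClass g).selfBraiding hdim] at h
  simp only [eqToHom_refl, Category.comp_id, Category.id_comp, Linear.smul_comp] at h
  exact Units.ext (smul_hom_injective
    (((F.inClass g).tensor (F.inClass g)).isIso_ne_zero _) h.symm)

/-- The hexagon axiom in terms of `ψ` and `Ω`. -/
theorem omega_hexagon (g h k : Pic C) :
    F.omega g (h * k) * F.psi h g k = F.omega g k * F.omega g h * F.psi h k g * F.psi g h k := by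
  -- the braiding past `L h ⊗ L k`, taken in one step in `hA` and in two steps in `hB` and `hC`
  have hA : (α_ (F.L g) (F.L h) (F.L k)).hom ≫ (β_ (F.L g) (F.L h ⊗ F.L k)).hom ≫
      (F.b h k).hom ▷ F.L g ≫ (F.b (h * k) g).hom = (F.omega g (h * k) : ℂ) •
        ((α_ (F.L g) (F.L h) (F.L k)).hom ≫ F.L g ◁ (F.b h k).hom ≫ (F.b g (h * k)).hom ≫
          eqToHom (congrArg F.L (pic_mul_comm g (h * k)))) := by
    rw [← BraidedCategory.braiding_naturality_right_assoc, F.omega_spec]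
    simp
  have hB : (α_ (F.L g) (F.L h) (F.L k)).hom ≫ (β_ (F.L g) (F.L h ⊗ F.L k)).hom ≫
      (F.b h k).hom ▷ F.L g ≫ (F.b (h * k) g).hom = (F.psi h k g * F.omega g k : ℂ) •
        ((β_ (F.L g) (F.L h)).hom ▷ F.L k ≫ (α_ (F.L h) (F.L g) (F.L k)).hom ≫
          F.L h ◁ (F.b g k).hom ≫ (F.b h (g * k)).hom ≫
          eqToHom (congrArg F.L (show h * (g * k) = h * k * g by
            rw [mul_assoc, pic_mul_comm g k]))) := by
    rw [F.psi_spec h k g]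
    simp only [Linear.comp_smul]
    rw [BraidedCategory.hexagon_forward_assoc, ← whiskerLeft_comp_assoc, F.omega_spec g k]
    simp only [MonoidalLinear.whiskerLeft_smul, whiskerLeft_comp, Linear.smul_comp,
      Linear.comp_smul, Category.assoc]
    rw [reassoc_of% F.whiskerLeft_eqToHom_b (pic_mul_comm g k) h]
    simp only [eqToHom_trans, smul_smul]
  have hC : (F.psi h g k : ℂ) • ((β_ (F.L g) (F.L h)).hom ▷ F.L k ≫
      (α_ (F.L h) (F.L g) (F.L k)).hom ≫ F.L h ◁ (F.b g k).hom ≫ (F.b h (g * k)).hom ≫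
          eqToHom (congrArg F.L (show h * (g * k) = h * k * g by
            rw [mul_assoc, pic_mul_comm g k]))) =
      (F.omega g h * F.psi g h k : ℂ) • ((α_ (F.L g) (F.L h) (F.L k)).hom ≫
        F.L g ◁ (F.b h k).hom ≫ (F.b g (h * k)).hom ≫
          eqToHom (congrArg F.L (pic_mul_comm g (h * k)))) := by
    have h1 := F.psi_spec h g k =≫ eqToHom (congrArg F.L
      (show h * g * k = h * k * g by rw [mul_assoc, pic_mul_comm g k, mul_assoc]))
    have h2 := F.psi_spec g h k =≫ eqToHom (congrArg F.L
      (show g * h * k = h * k * g by rw [mul_assoc, pic_mul_comm g]))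
    simp only [Linear.smul_comp, Category.assoc, eqToHom_trans] at h1 h2
    rw [← Linear.comp_smul, ← h1, ← comp_whiskerRight_assoc, F.omega_spec, mul_smul, ← h2]
    simp only [MonoidalLinear.smul_whiskerRight, comp_whiskerRight, Linear.smul_comp,
      Category.assoc]
    rw [reassoc_of% F.eqToHom_whiskerRight_b (pic_mul_comm g h) k]
    simp
  have hne := (((F.inClass g).tensor (F.inClass h)).tensor (F.inClass k)).isIso_ne_zero
    ((α_ (F.L g) (F.L h) (F.L k)).hom ≫
        F.L g ◁ (F.b h k).hom ≫ (F.b g (h * k)).hom ≫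
          eqToHom (congrArg F.L (pic_mul_comm g (h * k))))
  have hD := congrArg (fun t => (F.psi h g k : ℂ) • t) (hA.symm.trans hB)
  beta_reduce at hD
  rw [smul_comm (F.psi h g k : ℂ) (F.psi h k g * F.omega g k : ℂ), hC, smul_smul, smul_smul] at hD
  have := smul_hom_injective hne hD
  refine Units.ext ?_
  simp only [Units.val_mul]
  linear_combination this

/-- The hexagon for `(g, h, g)`, where two of the three values of `ψ` cancel. -/
theorem psi_self (g h : Pic C) : F.psi g h g * F.omega g h * F.omega g g = F.omega g (h * g) := by
  have := F.omega_hexagon g h g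
  have h2 : F.omega g (h * g) = F.omega g g * F.omega g h * F.psi g h g :=
    mul_right_cancel (b := F.psi h g g) (by rw [this]; ac_rfl)
  rw [h2]; ac_rfl

theorem psi_one_left (g h : Pic C) : F.psi 1 g h * F.psi 1 1 g = F.psi 1 1 (g * h) := by
  have h := F.psi_pentagon 1 1 g h
  rw [one_mul, one_mul, mul_assoc] at h
  exact mul_left_cancel h

/-- Cyclic products of `ψ` are multiplicative in the last variable. -/
theorem prod_psi_mul {g : Pic C} {n : ℕ} (hn : g ^ n = 1) (i : ℕ) (k : Pic C) :
    ∏ j ∈ Finset.range n, F.psi g (g ^ j) (g ^ i * k) =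
      (∏ j ∈ Finset.range n, F.psi g (g ^ j) (g ^ i)) *
        ∏ j ∈ Finset.range n, F.psi g (g ^ j) k := by
  -- multiply the pentagon for `(g, g ^ j, g ^ i, k)` over a period of `j`
  have shift : ∀ f : Pic C → ℂˣ, ∀ m : ℕ,
      ∏ j ∈ Finset.range n, f (g ^ (j + m)) = ∏ j ∈ Finset.range n, f (g ^ j) := by
    intro f m
    induction m with
    | zero => rfl
    | succ m ih =>
      have h1 := Finset.prod_range_succ' (fun j => f (g ^ (j + m))) n
      rw [Finset.prod_range_succ] at h1
      rw [← ih]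
      simp only [zero_add] at h1
      rw [show n + m = m + n from add_comm _ _, pow_add, hn, mul_one] at h1
      rw [mul_right_cancel h1]
      exact Finset.prod_congr rfl fun j _ => by rw [add_right_comm, add_assoc]
  have h := Finset.prod_congr (rfl : Finset.range n = Finset.range n)
    fun j _ => F.psi_pentagon g (g ^ j) (g ^ i) k
  simp only [Finset.prod_mul_distrib] at h
  have h1 : ∏ j ∈ Finset.range n, F.psi (g * g ^ j) (g ^ i) k =
      ∏ j ∈ Finset.range n, F.psi (g ^ j) (g ^ i) k := by
    simp only [← pow_succ']
    exact shift (fun x => F.psi x (g ^ i) k) 1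
  have h2 : ∏ j ∈ Finset.range n, F.psi g (g ^ j * g ^ i) k =
      ∏ j ∈ Finset.range n, F.psi g (g ^ j) k := by
    simp only [← pow_add]
    exact shift (fun x => F.psi g x k) i
  rw [h1, h2, mul_assoc] at h
  rw [← mul_left_cancel h, mul_comm]

/-- The cyclic product of `ψ` at the generator is `Ω(g,g) ^ (-n)`, because the hexagon makes it
telescope. -/
theorem prod_psi_self {g : Pic C} {n : ℕ} (hn : g ^ n = 1) :
    (∏ j ∈ Finset.range n, F.psi g (g ^ j) g) * F.omega g g ^ n = 1 := by
  have key : ∀ m : ℕ, (∏ j ∈ Finset.range m, F.psi g (g ^ j) g) * F.omega g g ^ m * F.omega g 1 =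
      F.omega g (g ^ m) := by
    intro m
    induction m with
    | zero => simp
    | succ m ih =>
      rw [Finset.prod_range_succ, pow_succ g, ← F.psi_self, ← ih, pow_succ]
      ac_rfl
  have := key n
  rw [hn] at this
  exact mul_right_cancel (this.trans (one_mul _).symm)

theorem prod_psi_eq_one (hdim : ∀ X : C, IsInvertible X → qdim X = 𝟙 (𝟙_ C)) {g : Pic C} {n : ℕ}
    (hn : g ^ n = 1) (hθ : theta g ^ n = 1) (i : ℕ) :
    ∏ j ∈ Finset.range n, F.psi g (g ^ j) (g ^ i) = 1 := by
  have h1 : ∏ j ∈ Finset.range n, F.psi g (g ^ j) g = 1 := by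
    have := F.prod_psi_self hn
    rwa [F.omega_self hdim, hθ, mul_one] at this
  induction i with
  | zero =>
    have := F.prod_psi_mul hn 0 1
    rw [mul_one] at this
    simpa using this
  | succ i ih =>
    rw [pow_succ, F.prod_psi_mul hn, ih, h1, one_mul]

/-- The cochain `(i, k) ↦ ω(gⁱ, k)` on `ℕ × Pic` obtained by integrating `ψ(g, -, -)` along the
powers of `g`. The factor `ψ(1, 1, k)` is the value required at `i = 0`, as `ψ` need not be
normalized. -/
def cyclicCochain (g : Pic C) (i : ℕ) (k : Pic C) : ℂˣ :=
  F.psi 1 1 k * (∏ j ∈ Finset.range i, F.psi g (g ^ j) k)⁻¹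

theorem cyclicCochain_succ (g : Pic C) (i : ℕ) (k : Pic C) :
    F.cyclicCochain g (i + 1) k = F.cyclicCochain g i k * (F.psi g (g ^ i) k)⁻¹ := by
  rw [cyclicCochain, cyclicCochain, Finset.prod_range_succ, mul_inv, mul_assoc]

theorem cyclicCochain_coboundary (g : Pic C) (i j : ℕ) (l : Pic C) :
    F.cyclicCochain g j l * (F.cyclicCochain g (i + j) l)⁻¹ * F.cyclicCochain g i (g ^ j * l) *
      (F.cyclicCochain g i (g ^ j))⁻¹ = F.psi (g ^ i) (g ^ j) l := by
  induction i with
  | zero =>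
    have h := F.psi_one_left (g ^ j) l
    simp only [cyclicCochain, zero_add, Finset.range_zero, Finset.prod_empty, inv_one, mul_one,
      pow_zero, mul_inv_cancel, one_mul, ← h]
    rw [mul_inv_cancel_right]
  | succ i ih =>
    have h := F.psi_pentagon g (g ^ i) (g ^ j) l
    rw [← ih, ← pow_succ', ← pow_add] at h
    rw [add_right_comm, cyclicCochain_succ, cyclicCochain_succ, cyclicCochain_succ]
    rw [mul_comm (F.psi (g ^ (i + 1)) _ _), ← inv_mul_eq_iff_eq_mul] at h
    rw [← h]
    ext
    simp only [mul_inv, inv_inv, Units.val_mul]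
    ring

/-- If the cyclic products of `ψ` are trivial, the cochain depends on `i` only modulo the order. -/
theorem cyclicCochain_mod (hdim : ∀ X : C, IsInvertible X → qdim X = 𝟙 (𝟙_ C)) {g : Pic C} {n : ℕ}
    (hn : g ^ n = 1) (hθ : theta g ^ n = 1) (i m k : ℕ) :
    F.cyclicCochain g (i + n * m) (g ^ k) = F.cyclicCochain g i (g ^ k) := by
  induction m with
  | zero => rfl
  | succ m ih =>
    rw [← ih, mul_add, mul_one, ← add_assoc, add_comm _ n]
    simp only [cyclicCochain, Finset.prod_range_add, F.prod_psi_eq_one hdim hn hθ, one_mul,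
      pow_add, hn]

/-- A class `g` with `θ_g ^ N_g = 1` generates a subgroup on which `ψ` is a coboundary. -/
theorem exists_trivializes_zpowers (hdim : ∀ X : C, IsInvertible X → qdim X = 𝟙 (𝟙_ C))
    (g : Pic C) (hθ : theta g ^ orderOf g = 1) :
    ∃ ω : Subgroup.zpowers g → Subgroup.zpowers g → ℂˣ, F.Trivializes (Subgroup.zpowers g) ω := by
  have hex : ∀ x : Subgroup.zpowers g, ∃ i : ℕ, g ^ i = x := fun x =>
    (isOfFinOrder_of_finite g).mem_powers_iff_mem_zpowers.2 x.2
  choose i hi using hex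
  have hω : ∀ a b k : ℕ, g ^ a = g ^ b →
      F.cyclicCochain g a (g ^ k) = F.cyclicCochain g b (g ^ k) := by
    have red : ∀ a k : ℕ, F.cyclicCochain g a (g ^ k) =
        F.cyclicCochain g (a % orderOf g) (g ^ k) := fun a k => by
      conv_lhs => rw [← Nat.mod_add_div a (orderOf g)]
      exact F.cyclicCochain_mod hdim (pow_orderOf_eq_one g) hθ _ _ _
    intro a b k hab
    rw [red a, red b, pow_inj_mod.1 hab]
  refine ⟨fun x y => F.cyclicCochain g (i x) y, fun x y z => ?_⟩
  have h := F.cyclicCochain_coboundary g (i x) (i y) (g ^ i z)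
  have h1 := hω (i (x * y)) (i x + i y) (i z) (by
    rw [hi, pow_add, hi, hi]; rfl)
  rw [← h1] at h
  simpa only [hi, Subgroup.coe_mul] using h

end PicFrame

end

section

/-! ### Tensor products of biproducts -/

section Biproduct

open Limits

theorem biproduct_total {C : Type u} [Category.{v} C] [Preadditive C] {J : Type w} [Fintype J]
    (L : J → C) [HasBiproduct L] : ∑ j, biproduct.π L j ≫ biproduct.ι L j = 𝟙 (⨁ L) :=
  IsBilimit.total (biproduct.isBilimit L)

variable {C : Type u} [Category.{v} C] [Preadditive C] [HasFiniteBiproducts C]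
  [MonoidalCategory C] [MonoidalPreadditive C] {J : Type w} [Finite J] {L : J → C}

theorem whiskerRight_biproduct_hom_ext {X Z : C} {f f' : (⨁ L) ⊗ X ⟶ Z}
    (h : ∀ j, biproduct.ι L j ▷ X ≫ f = biproduct.ι L j ▷ X ≫ f') : f = f' := by
  have := Fintype.ofFinite J
  rw [← Category.id_comp f, ← Category.id_comp f', ← id_whiskerRight, ← biproduct_total L]
  simp only [sum_whiskerRight, Preadditive.sum_comp, comp_whiskerRight, Category.assoc, h]

theorem whiskerLeft_biproduct_hom_ext {X Z : C} {f f' : X ⊗ (⨁ L) ⟶ Z}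
    (h : ∀ j, X ◁ biproduct.ι L j ≫ f = X ◁ biproduct.ι L j ≫ f') : f = f' := by
  have := Fintype.ofFinite J
  rw [← Category.id_comp f, ← Category.id_comp f', ← whiskerLeft_id, ← biproduct_total L]
  simp only [whiskerLeft_sum, Preadditive.sum_comp, whiskerLeft_comp, Category.assoc, h]

theorem whiskerRight_biproduct_hom_ext' {X Z : C} {f f' : Z ⟶ (⨁ L) ⊗ X}
    (h : ∀ j, f ≫ biproduct.π L j ▷ X = f' ≫ biproduct.π L j ▷ X) : f = f' := by
  have := Fintype.ofFinite J
  rw [← Category.comp_id f, ← Category.comp_id f', ← id_whiskerRight, ← biproduct_total L]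
  simp only [sum_whiskerRight, Preadditive.comp_sum, comp_whiskerRight, reassoc_of% h]

theorem whiskerLeft_biproduct_hom_ext' {X Z : C} {f f' : Z ⟶ X ⊗ (⨁ L)}
    (h : ∀ j, f ≫ X ◁ biproduct.π L j = f' ≫ X ◁ biproduct.π L j) : f = f' := by
  have := Fintype.ofFinite J
  rw [← Category.comp_id f, ← Category.comp_id f', ← whiskerLeft_id, ← biproduct_total L]
  simp only [whiskerLeft_sum, Preadditive.comp_sum, whiskerLeft_comp, reassoc_of% h]

theorem tensor_biproduct_hom_ext {Z : C} {f f' : (⨁ L) ⊗ (⨁ L) ⟶ Z}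
    (h : ∀ i j, (biproduct.ι L i ⊗ₘ biproduct.ι L j) ≫ f =
      (biproduct.ι L i ⊗ₘ biproduct.ι L j) ≫ f') : f = f' := by
  refine whiskerRight_biproduct_hom_ext fun i => whiskerLeft_biproduct_hom_ext fun j => ?_
  simpa only [MonoidalCategory.tensorHom_def', Category.assoc] using h i j

theorem tensor_biproduct_hom_ext' {Z : C} {f f' : Z ⟶ (⨁ L) ⊗ (⨁ L)}
    (h : ∀ i j, f ≫ (biproduct.π L i ⊗ₘ biproduct.π L j) =
      f' ≫ (biproduct.π L i ⊗ₘ biproduct.π L j)) : f = f' := by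
  refine whiskerRight_biproduct_hom_ext' fun i => whiskerLeft_biproduct_hom_ext' fun j => ?_
  simpa only [MonoidalCategory.tensorHom_def, Category.assoc] using h i j

theorem tensor_biproduct_total [Fintype J] (L : J → C) : ∑ i, ∑ j,
    (biproduct.π L i ⊗ₘ biproduct.π L j) ≫ (biproduct.ι L i ⊗ₘ biproduct.ι L j) =
      𝟙 ((⨁ L) ⊗ (⨁ L)) := by
  simp only [tensorHom_comp_tensorHom, ← tensor_sum, ← sum_tensor, biproduct_total]
  simp

theorem tensor_biproduct_hom_ext₃ {Z : C} {f f' : ((⨁ L) ⊗ (⨁ L)) ⊗ (⨁ L) ⟶ Z}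
    (h : ∀ i j k, ((biproduct.ι L i ⊗ₘ biproduct.ι L j) ⊗ₘ biproduct.ι L k) ≫ f =
      ((biproduct.ι L i ⊗ₘ biproduct.ι L j) ⊗ₘ biproduct.ι L k) ≫ f') : f = f' := by
  have := Fintype.ofFinite J
  refine whiskerLeft_biproduct_hom_ext fun k => ?_
  rw [← Category.id_comp (_ ≫ f), ← Category.id_comp (_ ≫ f'), ← id_whiskerRight,
    ← tensor_biproduct_total L]
  simp only [sum_whiskerRight, Preadditive.sum_comp, comp_whiskerRight, Category.assoc]
  refine Finset.sum_congr rfl fun i _ => Finset.sum_congr rfl fun j _ => ?_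
  rw [← MonoidalCategory.tensorHom_def_assoc, h, MonoidalCategory.tensorHom_def_assoc]

theorem tensor_biproduct_hom_ext₃' {Z : C} {f f' : Z ⟶ (⨁ L) ⊗ ((⨁ L) ⊗ (⨁ L))}
    (h : ∀ i j k, f ≫ (biproduct.π L i ⊗ₘ (biproduct.π L j ⊗ₘ biproduct.π L k)) =
      f' ≫ (biproduct.π L i ⊗ₘ (biproduct.π L j ⊗ₘ biproduct.π L k))) : f = f' := by
  have := Fintype.ofFinite J
  refine whiskerRight_biproduct_hom_ext' fun k => ?_
  rw [← Category.comp_id (f ≫ _), ← Category.comp_id (f' ≫ _), ← whiskerLeft_id,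
    ← tensor_biproduct_total L]
  simp only [whiskerLeft_sum, Preadditive.comp_sum, whiskerLeft_comp, Category.assoc]
  refine Finset.sum_congr rfl fun i _ => Finset.sum_congr rfl fun j _ => ?_
  rw [← MonoidalCategory.tensorHom_def_assoc, reassoc_of% h]

end Biproduct

/-! ### Twisted group algebras -/

/-- A family of objects indexed by a group, together with isomorphisms `L g ⊗ L h ≅ L k` whenever
`g * h = k`, which are associative and have an idempotent `u : 𝟙 ≅ L 1`. Carrying the proof of
`g * h = k` as an argument avoids transporting along equalities of group elements. -/
structure TwistedGroup {C : Type u} [Category.{v} C] [MonoidalCategory C] {G : Type w} [Group G]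
    (L : G → C) where
  m : ∀ {g h k : G}, g * h = k → (L g ⊗ L h ≅ L k)
  assoc : ∀ {g h k a b c : G} (e₁ : g * h = a) (e₂ : a * k = c) (e₃ : h * k = b) (e₄ : g * b = c),
    (m e₁).hom ▷ L k ≫ (m e₂).hom = (α_ (L g) (L h) (L k)).hom ≫ L g ◁ (m e₃).hom ≫ (m e₄).hom
  u : 𝟙_ C ≅ L 1
  unit : (u.hom ⊗ₘ u.hom) ≫ (m (one_mul 1)).hom = (λ_ (𝟙_ C)).hom ≫ u.hom

namespace TwistedGroup

section Monoidal

variable {C : Type u} [Category.{v} C] [MonoidalCategory C] {G : Type w} [Group G]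
  {L : G → C} (T : TwistedGroup L)

theorem assoc_inv {g h k a b c : G} (e₁ : g * h = a) (e₂ : a * k = c) (e₃ : h * k = b)
    (e₄ : g * b = c) : (T.m e₂).inv ≫ (T.m e₁).inv ▷ L k ≫ (α_ (L g) (L h) (L k)).hom =
      (T.m e₄).inv ≫ L g ◁ (T.m e₃).inv := by
  rw [Iso.inv_comp_eq, ← cancel_epi ((T.m e₁).hom ▷ L k), hom_inv_whiskerRight_assoc,
    reassoc_of% T.assoc e₁ e₂ e₃ e₄]
  simp

/-- The unit axiom: the endomorphism of `L g` it concerns is invertible and idempotent. -/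
theorem one_m (g : G) : T.u.hom ▷ L g ≫ (T.m (one_mul g)).hom = (λ_ (L g)).hom := by
  set x : L g ⟶ L g := (λ_ (L g)).inv ≫ T.u.hom ▷ L g ≫ (T.m (one_mul g)).hom with hx
  have h1 : x ≫ x = x := by
    have h := T.assoc (one_mul 1) (one_mul g) (one_mul g) (one_mul g)
    calc x ≫ x = (λ_ (L g)).inv ≫ (λ_ (𝟙_ C ⊗ L g)).inv ≫ (α_ _ _ _).inv ≫
          ((T.u.hom ⊗ₘ T.u.hom) ≫ (T.m (one_mul 1)).hom) ▷ L g ≫ (T.m (one_mul g)).hom := by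
          simp only [hx, comp_whiskerRight, Category.assoc]
          rw [h]
          simp only [Category.assoc, MonoidalCategory.tensorHom_def, comp_whiskerRight,
            whisker_assoc, Iso.inv_hom_id_assoc]
          rw [leftUnitor_inv_naturality_assoc, leftUnitor_inv_naturality_assoc,
            whisker_exchange_assoc, whisker_exchange_assoc, whiskerRight_tensor]
          simp only [Category.assoc]
      _ = x := by
          rw [T.unit, hx]
          simp
  have h2 : x = 𝟙 _ := by
    have : IsIso x := by rw [hx]; infer_instance
    rw [← cancel_epi x, h1, Category.comp_id]
  rw [hx, Iso.inv_comp_eq, Category.comp_id] at h2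
  exact h2

theorem m_one (g : G) : L g ◁ T.u.hom ≫ (T.m (mul_one g)).hom = (ρ_ (L g)).hom := by
  set x : L g ⟶ L g := (ρ_ (L g)).inv ≫ L g ◁ T.u.hom ≫ (T.m (mul_one g)).hom with hx
  have h1 : x ≫ x = x := by
    have h := T.assoc (mul_one g) (mul_one g) (one_mul 1) (mul_one g)
    calc x ≫ x = (ρ_ (L g)).inv ≫ (ρ_ (L g ⊗ 𝟙_ C)).inv ≫ (L g ◁ T.u.hom) ▷ 𝟙_ C ≫
          (L g ⊗ L 1) ◁ T.u.hom ≫ (T.m (mul_one g)).hom ▷ L 1 ≫ (T.m (mul_one g)).hom := by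
          simp only [hx, Category.assoc]
          rw [rightUnitor_inv_naturality_assoc, rightUnitor_inv_naturality_assoc,
            whisker_exchange_assoc]
      _ = (ρ_ (L g)).inv ≫ (ρ_ (L g ⊗ 𝟙_ C)).inv ≫ (α_ _ _ _).hom ≫
          L g ◁ ((T.u.hom ⊗ₘ T.u.hom) ≫ (T.m (one_mul 1)).hom) ≫ (T.m (mul_one g)).hom := by
          rw [h]
          simp [MonoidalCategory.tensorHom_def]
      _ = x := by
          rw [T.unit, hx]
          simp
  have h2 : x = 𝟙 _ := by
    have : IsIso x := by rw [hx]; infer_instance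
    rw [← cancel_epi x, h1, Category.comp_id]
  rw [hx, Iso.inv_comp_eq, Category.comp_id] at h2
  exact h2

theorem u_inv_whiskerRight (g : G) :
    T.u.inv ▷ L g = (T.m (one_mul g)).hom ≫ (λ_ (L g)).inv := by
  rw [← cancel_epi (T.u.hom ▷ L g), hom_inv_whiskerRight, reassoc_of% T.one_m g, Iso.hom_inv_id]

theorem whiskerLeft_u_inv (g : G) :
    L g ◁ T.u.inv = (T.m (mul_one g)).hom ≫ (ρ_ (L g)).inv := by
  rw [← cancel_epi (L g ◁ T.u.hom), whiskerLeft_hom_inv, reassoc_of% T.m_one g, Iso.hom_inv_id]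

end Monoidal

end TwistedGroup

end

section

namespace TwistedGroup

section Algebra

open Limits

variable {C : Type u} [Category.{v} C] [Preadditive C] [HasFiniteBiproducts C] [Linear ℂ C]
  [MonoidalCategory C] [MonoidalPreadditive C] [MonoidalLinear ℂ C] {G : Type w} [Group G]
  [Finite G] {L : G → C} (T : TwistedGroup L)

/-- The product of the twisted group algebra `⨁ L`. -/
def mul : (⨁ L) ⊗ (⨁ L) ⟶ ⨁ L :=
  letI := Fintype.ofFinite G
  ∑ g, ∑ h, (biproduct.π L g ⊗ₘ biproduct.π L h) ≫ (T.m rfl).hom ≫ biproduct.ι L (g * h)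

/-- The coproduct of the twisted group algebra `⨁ L`. -/
def comul : (⨁ L) ⟶ (⨁ L) ⊗ (⨁ L) :=
  letI := Fintype.ofFinite G
  (Nat.card G : ℂ)⁻¹ • ∑ g, ∑ h, biproduct.π L (g * h) ≫ (T.m rfl).inv ≫
    (biproduct.ι L g ⊗ₘ biproduct.ι L h)

omit [Linear ℂ C] [MonoidalLinear ℂ C] in
theorem ι_mul {g h k : G} (e : g * h = k) :
    (biproduct.ι L g ⊗ₘ biproduct.ι L h) ≫ T.mul = (T.m e).hom ≫ biproduct.ι L k := by
  subst e
  let _ := Fintype.ofFinite G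
  rw [mul]
  simp only [Preadditive.comp_sum, tensorHom_comp_tensorHom_assoc]
  rw [Finset.sum_eq_single g, Finset.sum_eq_single h]
  · simp
  · intro h' _ hh
    rw [biproduct.ι_π_ne L hh.symm]; simp
  · simp
  · intro g' _ hg
    rw [biproduct.ι_π_ne L hg.symm]; simp
  · simp

omit [MonoidalLinear ℂ C] in
theorem comul_π {g h k : G} (e : g * h = k) :
    T.comul ≫ (biproduct.π L g ⊗ₘ biproduct.π L h) =
      (Nat.card G : ℂ)⁻¹ • (biproduct.π L k ≫ (T.m e).inv) := by
  subst e
  let _ := Fintype.ofFinite G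
  rw [comul]
  simp only [Preadditive.sum_comp, Linear.smul_comp, Category.assoc, tensorHom_comp_tensorHom]
  rw [Finset.sum_eq_single g, Finset.sum_eq_single h]
  · simp
  · intro h' _ hh
    rw [biproduct.ι_π_ne L hh]; simp
  · simp
  · intro g' _ hg
    rw [biproduct.ι_π_ne L hg]; simp
  · simp

/-- The twisted group algebra `⨁ L`. -/
abbrev monObj : MonObj (⨁ L) where
  one := T.u.hom ≫ biproduct.ι L 1
  mul := T.mul
  one_mul := by
    refine whiskerLeft_biproduct_hom_ext fun g => ?_
    rw [whisker_exchange_assoc, comp_whiskerRight_assoc, ← MonoidalCategory.tensorHom_def_assoc,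
      T.ι_mul (one_mul g), reassoc_of% T.one_m g]
    simp
  mul_one := by
    refine whiskerRight_biproduct_hom_ext fun g => ?_
    rw [← whisker_exchange_assoc, whiskerLeft_comp_assoc, ← MonoidalCategory.tensorHom_def'_assoc,
      T.ι_mul (mul_one g), reassoc_of% T.m_one g]
    simp
  mul_assoc := by
    refine tensor_biproduct_hom_ext₃ fun g h k => ?_
    have h1 : ((biproduct.ι L g ⊗ₘ biproduct.ι L h) ⊗ₘ biproduct.ι L k) ≫ T.mul ▷ (⨁ L) ≫ T.mul =
        (T.m rfl).hom ▷ L k ≫ (T.m (rfl : g * h * k = _)).hom ≫ biproduct.ι L _ := by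
      rw [← T.ι_mul, ← MonoidalCategory.tensorHom_id, tensorHom_comp_tensorHom_assoc, T.ι_mul rfl,
        ← MonoidalCategory.tensorHom_id, tensorHom_comp_tensorHom_assoc]
      simp
    have h2 : (biproduct.ι L g ⊗ₘ (biproduct.ι L h ⊗ₘ biproduct.ι L k)) ≫
        (⨁ L) ◁ T.mul ≫ T.mul = L g ◁ (T.m rfl).hom ≫ (T.m (mul_assoc g h k).symm).hom ≫
          biproduct.ι L _ := by
      rw [← T.ι_mul, ← MonoidalCategory.id_tensorHom, tensorHom_comp_tensorHom_assoc, T.ι_mul rfl,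
        ← MonoidalCategory.id_tensorHom, tensorHom_comp_tensorHom_assoc]
      simp
    rw [h1, associator_naturality_assoc, h2,
      reassoc_of% T.assoc rfl rfl rfl (mul_assoc g h k).symm]

/-- The coalgebra structure of the twisted group algebra `⨁ L`, dual to the product and normalized
so that the coproduct is a section of the product. -/
abbrev comonObj : ComonObj (⨁ L) where
  counit := (Nat.card G : ℂ) • (biproduct.π L 1 ≫ T.u.inv)
  comul := T.comul
  counit_comul := by
    refine whiskerLeft_biproduct_hom_ext' fun g => ?_
    have hn : (Nat.card G : ℂ) ≠ 0 := Nat.cast_ne_zero.2 Nat.card_pos.ne'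
    rw [Category.assoc, MonoidalLinear.smul_whiskerRight, comp_whiskerRight]
    simp only [Linear.comp_smul, Linear.smul_comp, Category.assoc]
    rw [← whisker_exchange, ← MonoidalCategory.tensorHom_def_assoc,
      reassoc_of% T.comul_π (one_mul g), T.u_inv_whiskerRight]
    simp [smul_smul, hn]
  comul_counit := by
    refine whiskerRight_biproduct_hom_ext' fun g => ?_
    have hn : (Nat.card G : ℂ) ≠ 0 := Nat.cast_ne_zero.2 Nat.card_pos.ne'
    rw [Category.assoc, MonoidalLinear.whiskerLeft_smul, whiskerLeft_comp]
    simp only [Linear.comp_smul, Linear.smul_comp, Category.assoc]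
    rw [whisker_exchange, ← MonoidalCategory.tensorHom_def'_assoc,
      reassoc_of% T.comul_π (mul_one g), T.whiskerLeft_u_inv]
    simp [smul_smul, hn]
  comul_assoc := by
    refine tensor_biproduct_hom_ext₃' fun g h k => ?_
    have h1 : T.comul ≫ (⨁ L) ◁ T.comul ≫
        (biproduct.π L g ⊗ₘ (biproduct.π L h ⊗ₘ biproduct.π L k)) =
        ((Nat.card G : ℂ)⁻¹ * (Nat.card G : ℂ)⁻¹) • (biproduct.π L _ ≫
          (T.m (mul_assoc g h k).symm).inv ≫ L g ◁ (T.m rfl).inv) := by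
      rw [← MonoidalCategory.id_tensorHom, tensorHom_comp_tensorHom, T.comul_π rfl,
        Category.id_comp, ← Category.comp_id (biproduct.π L g), tensorHom_smul,
        ← tensorHom_comp_tensorHom, Linear.comp_smul,
        reassoc_of% T.comul_π (mul_assoc g h k).symm, MonoidalCategory.id_tensorHom]
      simp [smul_smul]
    have h2 : T.comul ≫ T.comul ▷ (⨁ L) ≫
        ((biproduct.π L g ⊗ₘ biproduct.π L h) ⊗ₘ biproduct.π L k) =
        ((Nat.card G : ℂ)⁻¹ * (Nat.card G : ℂ)⁻¹) • (biproduct.π L _ ≫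
          (T.m rfl).inv ≫ (T.m rfl).inv ▷ L k) := by
      rw [← MonoidalCategory.tensorHom_id, tensorHom_comp_tensorHom, T.comul_π rfl,
        Category.id_comp, ← Category.comp_id (biproduct.π L k), smul_tensorHom,
        ← tensorHom_comp_tensorHom, Linear.comp_smul,
        reassoc_of% T.comul_π (rfl : g * h * k = _), MonoidalCategory.tensorHom_id]
      simp [smul_smul]
    simp only [Category.assoc]
    rw [h1, ← associator_naturality, reassoc_of% h2, Linear.smul_comp, Category.assoc,
      Category.assoc, T.assoc_inv rfl rfl rfl (mul_assoc g h k).symm]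

end Algebra

end TwistedGroup

end

section

namespace TwistedGroup

open Limits

section Algebra

variable {C : Type u} [Category.{v} C] [Preadditive C] [HasFiniteBiproducts C] [Linear ℂ C]
  [MonoidalCategory C] [MonoidalPreadditive C] [MonoidalLinear ℂ C] {G : Type w} [Group G]
  [Finite G] {L : G → C} (T : TwistedGroup L)

omit [MonoidalLinear ℂ C] in
theorem ι_comul_whiskerLeft_π {c b h : G} (e : c * b = h) :
    biproduct.ι L h ≫ T.comul ≫ (⨁ L) ◁ biproduct.π L b =
      (Nat.card G : ℂ)⁻¹ • ((T.m e).inv ≫ biproduct.ι L c ▷ L b) := by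
  refine whiskerRight_biproduct_hom_ext' fun c' => ?_
  simp only [Category.assoc, Linear.smul_comp]
  rw [← MonoidalCategory.tensorHom_def', T.comul_π rfl, ← comp_whiskerRight, Linear.comp_smul]
  by_cases hc : c' = c
  · subst hc; subst e; simp
  · rw [biproduct.ι_π_ne L (Ne.symm hc), biproduct.ι_π_ne_assoc L]
    · simp
    · rw [← e]; exact fun h => hc (mul_right_cancel h).symm

omit [MonoidalLinear ℂ C] in
theorem ι_comul_whiskerRight_π {c b h : G} (e : c * b = h) :
    biproduct.ι L h ≫ T.comul ≫ biproduct.π L c ▷ (⨁ L) =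
      (Nat.card G : ℂ)⁻¹ • ((T.m e).inv ≫ L c ◁ biproduct.ι L b) := by
  refine whiskerLeft_biproduct_hom_ext' fun b' => ?_
  simp only [Category.assoc, Linear.smul_comp]
  rw [← MonoidalCategory.tensorHom_def, T.comul_π rfl, ← whiskerLeft_comp, Linear.comp_smul]
  by_cases hc : b' = b
  · subst hc; subst e; simp
  · rw [biproduct.ι_π_ne L (Ne.symm hc), biproduct.ι_π_ne_assoc L]
    · simp
    · rw [← e]; exact fun h => hc (mul_left_cancel h).symm

omit [MonoidalLinear ℂ C] in
theorem mul_comul_components {g h a b k : G} (e₁ : g * h = k) (e₂ : a * b = k) :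
    (biproduct.ι L g ⊗ₘ biproduct.ι L h) ≫ T.mul ≫ T.comul ≫
      (biproduct.π L a ⊗ₘ biproduct.π L b) =
      (Nat.card G : ℂ)⁻¹ • ((T.m e₁).hom ≫ (T.m e₂).inv) := by
  rw [T.comul_π e₂, Linear.comp_smul, Linear.comp_smul, reassoc_of% T.ι_mul e₁]
  simp

omit [MonoidalLinear ℂ C] in
theorem mul_comul_components_eq_zero {g h a b : G} (e : g * h ≠ a * b) :
    (biproduct.ι L g ⊗ₘ biproduct.ι L h) ≫ T.mul ≫ T.comul ≫
      (biproduct.π L a ⊗ₘ biproduct.π L b) = 0 := by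
  rw [T.comul_π rfl, Linear.comp_smul, Linear.comp_smul, reassoc_of% T.ι_mul rfl,
    biproduct.ι_π_ne_assoc L e]
  simp

theorem frobenius_left :
    T.mul ≫ T.comul = (⨁ L) ◁ T.comul ≫ (α_ (⨁ L) (⨁ L) (⨁ L)).inv ≫ T.mul ▷ (⨁ L) := by
  refine tensor_biproduct_hom_ext fun g h => tensor_biproduct_hom_ext' fun a b => ?_
  simp only [Category.assoc]
  obtain ⟨c, hc⟩ : ∃ c, c * b = h := ⟨h * b⁻¹, by simp⟩
  have key : (biproduct.ι L g ⊗ₘ biproduct.ι L h) ≫ (⨁ L) ◁ T.comul ≫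
      (α_ (⨁ L) (⨁ L) (⨁ L)).inv ≫ T.mul ▷ (⨁ L) ≫ (biproduct.π L a ⊗ₘ biproduct.π L b) =
      (Nat.card G : ℂ)⁻¹ • (L g ◁ (T.m hc).inv ≫ (α_ (L g) (L c) (L b)).inv ≫
        ((T.m rfl).hom ≫ biproduct.ι L (g * c) ≫ biproduct.π L a) ▷ L b) := by
    have h1 := T.ι_comul_whiskerLeft_π hc
    rw [← reassoc_of% T.ι_mul (rfl : g * c = _), MonoidalCategory.tensorHom_def' (biproduct.π L a),
      ← whisker_exchange_assoc, ← associator_inv_naturality_right_assoc, ← whiskerLeft_comp_assoc,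
      MonoidalCategory.tensorHom_def_assoc, ← whiskerLeft_comp_assoc, h1,
      MonoidalLinear.whiskerLeft_smul, Linear.smul_comp, Linear.comp_smul, whiskerLeft_comp_assoc,
      ← whisker_exchange_assoc, associator_inv_naturality_middle_assoc,
      associator_inv_naturality_left_assoc, MonoidalCategory.tensorHom_def]
    simp only [comp_whiskerRight, Category.assoc]
  rw [key]
  by_cases e : g * c = a
  · rw [T.mul_comul_components (rfl : g * h = _) (by rw [← e, mul_assoc, hc])]
    congr 1
    rw [Iso.comp_inv_eq]
    subst e
    have := T.assoc (rfl : g * c = _) (by rw [mul_assoc, hc]) hc rfl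
    simp [this]
  · rw [T.mul_comul_components_eq_zero, biproduct.ι_π_ne L e]
    · simp
    · rw [← hc, ← mul_assoc]
      exact fun h => e (mul_right_cancel h)

theorem frobenius_right :
    T.mul ≫ T.comul = T.comul ▷ (⨁ L) ≫ (α_ (⨁ L) (⨁ L) (⨁ L)).hom ≫ (⨁ L) ◁ T.mul := by
  refine tensor_biproduct_hom_ext fun g h => tensor_biproduct_hom_ext' fun a b => ?_
  simp only [Category.assoc]
  obtain ⟨c, hc⟩ : ∃ c, a * c = g := ⟨a⁻¹ * g, by simp⟩
  have key : (biproduct.ι L g ⊗ₘ biproduct.ι L h) ≫ T.comul ▷ (⨁ L) ≫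
      (α_ (⨁ L) (⨁ L) (⨁ L)).hom ≫ (⨁ L) ◁ T.mul ≫ (biproduct.π L a ⊗ₘ biproduct.π L b) =
      (Nat.card G : ℂ)⁻¹ • ((T.m hc).inv ▷ L h ≫ (α_ (L a) (L c) (L h)).hom ≫
        L a ◁ ((T.m rfl).hom ≫ biproduct.ι L (c * h) ≫ biproduct.π L b)) := by
    have h1 := T.ι_comul_whiskerRight_π hc
    rw [← reassoc_of% T.ι_mul (rfl : c * h = _), MonoidalCategory.tensorHom_def (biproduct.π L a),
      whisker_exchange_assoc, ← associator_naturality_left_assoc, ← comp_whiskerRight_assoc,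
      MonoidalCategory.tensorHom_def'_assoc, ← comp_whiskerRight_assoc, h1,
      MonoidalLinear.smul_whiskerRight, Linear.smul_comp, Linear.comp_smul, comp_whiskerRight_assoc,
      whisker_exchange_assoc, associator_naturality_middle_assoc,
      associator_naturality_right_assoc, MonoidalCategory.tensorHom_def']
    simp only [whiskerLeft_comp, Category.assoc]
  rw [key]
  by_cases e : c * h = b
  · rw [T.mul_comul_components (rfl : g * h = _) (by rw [← e, ← mul_assoc, hc])]
    congr 1
    rw [Iso.comp_inv_eq]
    subst e
    have := T.assoc hc (rfl : g * h = _) rfl (by rw [← mul_assoc, hc])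
    simp [← this]
  · rw [T.mul_comul_components_eq_zero, biproduct.ι_π_ne L e]
    · simp
    · rw [← hc, mul_assoc]
      exact fun h => e (mul_left_cancel h)

omit [MonoidalLinear ℂ C] in
theorem comul_mul : T.comul ≫ T.mul = 𝟙 (⨁ L) := by
  let _ := Fintype.ofFinite G
  have hn : (Nat.card G : ℂ) ≠ 0 := Nat.cast_ne_zero.2 Nat.card_pos.ne'
  have h1 : ∀ g : G, ∑ h, biproduct.π L (g * h) ≫ biproduct.ι L (g * h) = 𝟙 (⨁ L) := fun g => by
    rw [← biproduct_total L]
    exact Equiv.sum_comp (Equiv.mulLeft g) fun h => biproduct.π L h ≫ biproduct.ι L h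
  rw [comul]
  simp only [Linear.smul_comp, Preadditive.sum_comp, Category.assoc, T.ι_mul rfl,
    Iso.inv_hom_id_assoc, h1]
  rw [Finset.sum_const, Finset.card_univ, ← Nat.card_eq_fintype_card, ← Nat.cast_smul_eq_nsmul ℂ,
    smul_smul, inv_mul_cancel₀ hn, one_smul]

end Algebra

section Ribbon

variable {C : Type u} [Category.{v} C] [Preadditive C] [HasFiniteBiproducts C] [Linear ℂ C]
  [MonoidalCategory C] [MonoidalPreadditive C] [MonoidalLinear ℂ C] [BraidedCategory C]
  [RightRigidCategory C] [RibbonTwist C]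

omit [Linear ℂ C] [MonoidalLinear ℂ C] in
theorem qdim_biproduct {J : Type w} [Fintype J] (L : J → C) : qdim (⨁ L) = ∑ j, qdim (L j) := by
  have h1 : qdim (⨁ L) = ∑ j, ctrace (biproduct.π L j ≫ biproduct.ι L j) := by
    rw [qdim, ← biproduct_total L]
    simp only [ctrace, sum_whiskerRight, Preadditive.sum_comp, Preadditive.comp_sum]
  rw [h1]
  refine Finset.sum_congr rfl fun j _ => ?_
  rw [ctrace_comm, biproduct.ι_π_self, qdim]

end Ribbon

end TwistedGroup

end

section

open Limits

/-! ### Finite direct sums as colimits of cofans -/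

section DirectSum

variable {C : Type u} [Category.{v} C] [Preadditive C] {J : Type w} {L : J → C} {X : C}
  {e : ∀ j, L j ⟶ X}

/-- The projections of a finite direct sum that is given by its inclusions only. -/
theorem exists_projections [Fintype J] (he : IsColimit (Cofan.mk X e)) :
    ∃ p : ∀ j, X ⟶ L j, (∀ j, e j ≫ p j = 𝟙 (L j)) ∧ (∀ i j, i ≠ j → e i ≫ p j = 0) ∧
      ∑ j, p j ≫ e j = 𝟙 X := by
  classical
  let p : ∀ j, X ⟶ L j := fun j => Cofan.IsColimit.desc he fun i =>
    if h : i = j then eqToHom (congrArg L h) else 0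
  have hp : ∀ i j, e i ≫ p j = if h : i = j then eqToHom (congrArg L h) else 0 := fun i j =>
    Cofan.IsColimit.fac he _ i
  have h1 : ∀ j, e j ≫ p j = 𝟙 (L j) := fun j => by rw [hp]; simp
  have h2 : ∀ i j, i ≠ j → e i ≫ p j = 0 := fun i j h => by rw [hp, dif_neg h]
  refine ⟨p, h1, h2, Cofan.IsColimit.hom_ext he _ _ fun i => ?_⟩
  change e i ≫ ∑ j, p j ≫ e j = e i ≫ 𝟙 X
  rw [Preadditive.comp_sum, Finset.sum_eq_single i]
  · rw [reassoc_of% h1 i, Category.comp_id]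
  · intro j _ hj
    rw [reassoc_of% h2 i j hj.symm, zero_comp]
  · simp

theorem nonempty_isColimit_of_projections [Fintype J] (p : ∀ j, X ⟶ L j)
    (h1 : ∀ j, e j ≫ p j = 𝟙 (L j)) (h2 : ∀ i j, i ≠ j → e i ≫ p j = 0)
    (h3 : ∑ j, p j ≫ e j = 𝟙 X) : Nonempty (IsColimit (Cofan.mk X e)) := by
  refine ⟨Cofan.IsColimit.mk _ (fun s => ∑ j, p j ≫ s.inj j) (fun s i => ?_) fun s m hm => ?_⟩
  · change e i ≫ ∑ j, p j ≫ s.inj j = s.inj i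
    rw [Preadditive.comp_sum, Finset.sum_eq_single i]
    · rw [reassoc_of% h1 i]
    · intro j _ hj
      rw [reassoc_of% h2 i j hj.symm, zero_comp]
    · simp
  · change X ⟶ s.pt at m
    have hm' : ∀ j, e j ≫ m = s.inj j := hm
    change m = ∑ j, p j ≫ s.inj j
    rw [← Category.id_comp m, ← h3, Preadditive.sum_comp]
    simp only [Category.assoc, hm']

theorem exists_comp_projection_ne_zero [Fintype J] {p : ∀ j, X ⟶ L j}
    (h3 : ∑ j, p j ≫ e j = 𝟙 X) {Y : C} {f : Y ⟶ X} (hf : f ≠ 0) : ∃ j, f ≫ p j ≠ 0 := by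
  by_contra! h
  refine hf ?_
  rw [← Category.comp_id f, ← h3, Preadditive.comp_sum]
  exact Finset.sum_eq_zero fun j _ => by rw [reassoc_of% h j, zero_comp]

theorem exists_inj_comp_ne_zero (he : IsColimit (Cofan.mk X e)) {Y : C} {f : X ⟶ Y} (hf : f ≠ 0) :
    ∃ j, e j ≫ f ≠ 0 := by
  by_contra! h
  exact hf (Cofan.IsColimit.hom_ext he _ _ fun i => (h i).trans comp_zero.symm)

end DirectSum

section Modular

variable {C : Type u} [Category.{v} C] [Abelian C] [Linear ℂ C] [MonoidalCategory C]
  [MonoidalPreadditive C] [MonoidalLinear ℂ C] [BraidedCategory C] [RightRigidCategory C]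
  [RibbonTwist C] [IsModular C]

/-- A non-zero morphism is detected on a simple summand of its source. -/
theorem exists_simple_comp_ne_zero {X Y : C} {f : X ⟶ Y} (hf : f ≠ 0) :
    ∃ (S : C) (j : S ⟶ X), Simple S ∧ j ≫ f ≠ 0 := by
  obtain ⟨n, S, j, hS, ⟨hj⟩⟩ := IsModular.semisimple X
  obtain ⟨i, hi⟩ := exists_inj_comp_ne_zero hj hf
  exact ⟨S i, j i, hS i, hi⟩

section Sum

variable {J : Type w} [Fintype J] {L : J → C} {φ : J → Pic C} (hL : ∀ j, InClass (L j) (φ j))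
  (hφ : Function.Injective φ) {X : C} {e : ∀ j, L j ⟶ X} {p : ∀ j, X ⟶ L j}
  (h3 : ∑ j, p j ≫ e j = 𝟙 X)

include hL hφ h3

/-- A non-zero morphism from a simple object to a direct sum of pairwise non-isomorphic invertible
objects is one of the inclusions, up to an isomorphism. -/
theorem exists_iso_of_simple_of_sum {S : C} [Simple S] {f : S ⟶ X} (hf : f ≠ 0) :
    ∃ (j : J) (r : S ≅ L j), f = r.hom ≫ e j := by
  classical
  obtain ⟨j, hj⟩ := exists_comp_projection_ne_zero h3 hf
  have := (hL j).simple
  have hiso := isIso_of_hom_simple hj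
  refine ⟨j, asIso (f ≫ p j), ?_⟩
  conv_lhs => rw [← Category.comp_id f, ← h3, Preadditive.comp_sum]
  rw [Finset.sum_eq_single j]
  · simp
  · intro i _ hi
    by_contra h
    have h0 : f ≫ p i ≠ 0 := fun h' => h (by rw [reassoc_of% h', zero_comp])
    have := (hL i).simple
    have hiso' := isIso_of_hom_simple h0
    exact hi (hφ ((hL i).eq_of_iso (hL j) ((asIso (f ≫ p i)).symm ≪≫ asIso (f ≫ p j))))
  · simp

theorem isInvertible_of_simple_of_sum {S : C} [Simple S] {f : S ⟶ X} (hf : f ≠ 0) :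
    IsInvertible S := by
  obtain ⟨j, r, -⟩ := exists_iso_of_simple_of_sum hL hφ h3 hf
  exact ((hL j).of_iso r.symm).isInvertible

end Sum

/-! ### Twisted group algebras of invertible objects -/

namespace TwistedGroup

attribute [local instance] Abelian.hasFiniteBiproducts

variable {G : Type w} [Group G] [Finite G] {L : G → C} (T : TwistedGroup L)

variable {φ : G → Pic C} (hL : ∀ j, InClass (L j) (φ j)) (hφ : Function.Injective φ)

omit [Finite G] in
include hL in
/-- The pairings `L g ⊗ L h ≅ 𝟙` and `L h ⊗ L g ≅ 𝟙` for `h = g⁻¹` differ by the braiding and the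
twist, because the dimension of `L g` is one. -/
theorem twist_braiding_m (hdim : ∀ X : C, IsInvertible X → qdim X = 𝟙 (𝟙_ C)) {g h : G}
    (e : g * h = 1) (e' : h * g = 1) :
    (theta (φ g) : ℂ) • ((β_ (L g) (L h)).hom ≫ (T.m e').hom ≫ T.u.inv) =
      (T.m e).hom ≫ T.u.inv := by
  have zig : (T.u.hom ≫ (T.m e).inv) ▷ L g ≫ (α_ (L g) (L h) (L g)).hom ≫
      L g ◁ ((T.m e').hom ≫ T.u.inv) = (λ_ (L g)).hom ≫ (ρ_ (L g)).inv := by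
    have h1 := T.assoc e (one_mul g) e' (mul_one g)
    have h2 : (α_ (L g) (L h) (L g)).hom ≫ L g ◁ (T.m e').hom =
        (T.m e).hom ▷ L g ≫ (T.m (one_mul g)).hom ≫ (T.m (mul_one g)).inv := by
      rw [reassoc_of% h1]; simp
    rw [whiskerLeft_comp, reassoc_of% h2, T.whiskerLeft_u_inv, comp_whiskerRight_assoc,
      inv_hom_whiskerRight_assoc, Iso.inv_hom_id_assoc, reassoc_of% T.one_m g]
  have h1 := (hL g).loop _ _ zig ((hL g).selfBraiding hdim)
  have h2 := congrArg (fun t => (T.m e).hom ≫ T.u.inv ≫ t) h1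
  simpa using h2

omit [BraidedCategory C] [RightRigidCategory C] [RibbonTwist C] [IsModular C] in
theorem frobenius : letI := T.monObj; letI := T.comonObj; IsFrobenius (⨁ L) :=
  letI := T.monObj
  letI := T.comonObj
  ⟨T.frobenius_left, T.frobenius_right⟩

include hL in
theorem symmetric (hdim : ∀ X : C, IsInvertible X → qdim X = 𝟙 (𝟙_ C)) :
    letI := T.monObj; letI := T.comonObj; IsSymmetric (⨁ L) := by
  let _ := T.monObj
  let _ := T.comonObj
  refine isSymmetric_of_form (tensor_biproduct_hom_ext fun g h => ?_)
  change (biproduct.ι L g ⊗ₘ biproduct.ι L h) ≫ twistHom (⨁ L) ▷ (⨁ L) ≫ (β_ _ _).hom ≫ T.mul ≫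
    ((Nat.card G : ℂ) • (biproduct.π L 1 ≫ T.u.inv)) = (biproduct.ι L g ⊗ₘ biproduct.ι L h) ≫
      T.mul ≫ ((Nat.card G : ℂ) • (biproduct.π L 1 ≫ T.u.inv))
  have h1 : biproduct.ι L g ≫ twistHom (⨁ L) = (theta (φ g) : ℂ) • biproduct.ι L g := by
    have : biproduct.ι L g ≫ twistHom (⨁ L) = twistHom (L g) ≫ biproduct.ι L g :=
      RibbonTwist.twist_naturality _
    rw [this, twistHom_eq (hL g), Linear.smul_comp, Category.id_comp]
  rw [← MonoidalCategory.tensorHom_id, tensorHom_comp_tensorHom_assoc, h1, Category.comp_id,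
    smul_tensorHom, Linear.smul_comp, BraidedCategory.braiding_naturality_assoc]
  by_cases e : g * h = 1
  · have e' : h * g = 1 := mul_eq_one_iff_eq_inv.2 (eq_inv_of_mul_eq_one_right e)
    have h2 := T.twist_braiding_m hL hdim e e'
    rw [reassoc_of% T.ι_mul e, reassoc_of% T.ι_mul e']
    simp only [Linear.comp_smul, biproduct.ι_π_self_assoc]
    rw [smul_comm, h2]
  · have e' : h * g ≠ 1 := fun e' => e (mul_eq_one_iff_eq_inv.2 (eq_inv_of_mul_eq_one_right e'))
    rw [reassoc_of% T.ι_mul rfl, reassoc_of% T.ι_mul rfl]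
    simp only [Linear.comp_smul]
    rw [biproduct.ι_π_ne_assoc L e, biproduct.ι_π_ne_assoc L e']
    simp

omit [IsModular C] in
include hL in
theorem special (hdim : ∀ X : C, IsInvertible X → qdim X = 𝟙 (𝟙_ C)) :
    letI := T.monObj; letI := T.comonObj; IsSpecial (⨁ L) := by
  let _ := T.monObj
  let _ := T.comonObj
  refine ⟨T.comul_mul, ?_⟩
  let _ := Fintype.ofFinite G
  rw [qdim_biproduct, Finset.sum_congr rfl fun g _ => hdim (L g) (hL g).isInvertible,
    Finset.sum_const, Finset.card_univ, ← Nat.card_eq_fintype_card, ← Nat.cast_smul_eq_nsmul ℂ]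
  change (T.u.hom ≫ biproduct.ι L 1) ≫ ((Nat.card G : ℂ) • (biproduct.π L 1 ≫ T.u.inv)) = _
  simp

include hL hφ in
/-- A non-zero submodule contains a simple summand `L k`, and hence all the summands
`L (g * k⁻¹) * L k`. -/
theorem haploid : letI := T.monObj; IsHaploid (⨁ L) := by
  let _ := T.monObj
  let _ := Fintype.ofFinite G
  intro M _ f _ hf
  constructor
  · rintro h h0
    have h1 : biproduct.ι L 1 ≫ inv f ≫ f ≫ biproduct.π L 1 = 0 := by
      simp only [h0, zero_comp, comp_zero]
    rw [IsIso.inv_hom_id_assoc, biproduct.ι_π_self] at h1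
    exact (hL 1).id_ne_zero h1
  · intro h0
    obtain ⟨S, j, hS, hj⟩ := exists_simple_comp_ne_zero h0
    obtain ⟨k, r, hr⟩ := exists_iso_of_simple_of_sum hL hφ (biproduct_total L) hj
    have ht : (r.inv ≫ j) ≫ f = biproduct.ι L k := by rw [Category.assoc, hr, r.inv_hom_id_assoc]
    set t : L k ⟶ M := r.inv ≫ j
    have e : ∀ g : G, g * k⁻¹ * k = g := fun g => by simp
    let σ : (⨁ L) ⟶ M := biproduct.desc fun g => (T.m (e g)).inv ≫
      (biproduct.ι L (g * k⁻¹) ⊗ₘ t) ≫ (ModObj.smul (M := ⨁ L) (X := M) : (⨁ L) ⊗ M ⟶ M)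
    have hσ : σ ≫ f = 𝟙 (⨁ L) := by
      refine biproduct.hom_ext' _ _ fun g => ?_
      rw [biproduct.ι_desc_assoc]
      simp only [Category.assoc]
      rw [hf, ← MonoidalCategory.id_tensorHom, tensorHom_comp_tensorHom_assoc, ht, Category.comp_id]
      change (T.m (e g)).inv ≫ (biproduct.ι L (g * k⁻¹) ⊗ₘ biproduct.ι L k) ≫ T.mul = _
      rw [T.ι_mul (e g)]
      simp
    have : IsSplitEpi f := ⟨⟨⟨σ, hσ⟩⟩⟩
    exact isIso_of_mono_of_isSplitEpi f

/-- The twisted group algebra of a family of pairwise non-isomorphic invertible objects. -/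
def algebra (hL : ∀ j, InClass (L j) (φ j)) (hφ : Function.Injective φ)
    (hdim : ∀ X : C, IsInvertible X → qdim X = 𝟙 (𝟙_ C)) : SchellekensAlgebra C :=
  letI := T.monObj
  letI := T.comonObj
  { X := ⨁ L
    frobenius := T.frobenius
    symmetric := T.symmetric hL hdim
    special := T.special hL hdim
    haploid := T.haploid hL hφ
    invertible_of_simple := fun U f _ _ =>
      let _ := Fintype.ofFinite G
      isInvertible_of_simple_of_sum hL hφ (biproduct_total L) (f := f) fun h : f = 0 =>
        id_nonzero U ((cancel_mono f).1 (by simp only [h, comp_zero])) }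

end TwistedGroup

/-- Rescaling an isomorphism by a non-zero number. -/
@[simps]
def smulIso (z : ℂˣ) {X Y : C} (f : X ≅ Y) : X ≅ Y where
  hom := (z : ℂ) • f.hom
  inv := ((z⁻¹ : ℂˣ) : ℂ) • f.inv
  hom_inv_id := by simp [smul_smul]
  inv_hom_id := by simp [smul_smul]

/-- A cochain `ω` with `dω = ψ` turns the chosen isomorphisms `L g ⊗ L h ≅ L (g h)` into
associative ones. -/
theorem PicFrame.Trivializes.exists_twistedGroup {F : PicFrame C} {H : Subgroup (Pic C)}
    {ω : H → H → ℂˣ} (hω : F.Trivializes H ω) :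
    ∃ T : TwistedGroup fun h : H => F.L h, ∀ g h : H,
      (T.m (rfl : g * h = g * h)).hom = (ω g h : ℂ) • (F.b g h).hom := by
  let m : ∀ {g h k : H}, g * h = k → (F.L g ⊗ F.L h ≅ F.L k) := fun {g h k} e =>
    smulIso (ω g h) (F.b g h ≪≫ eqToIso (congrArg (fun x : H => F.L x) e))
  have assoc : ∀ {g h k a b c : H} (e₁ : g * h = a) (e₂ : a * k = c) (e₃ : h * k = b)
      (e₄ : g * b = c), (m e₁).hom ▷ F.L k ≫ (m e₂).hom =
        (α_ (F.L g) (F.L h) (F.L k)).hom ≫ F.L g ◁ (m e₃).hom ≫ (m e₄).hom := by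
    intro g h k a b c e₁ e₂ e₃ e₄
    subst e₁ e₃ e₂
    have h1 : (F.psi g h k * ω g h * ω (g * h) k : ℂ) = ω h k * ω g (h * k) := by
      have := congrArg (Units.val) (hω g h k)
      simp only [Units.val_mul] at this
      rw [← this]
      have h1 := (ω (g * h) k).inv_mul
      have h2 := (ω g h).inv_mul
      linear_combination (ω h k * ω g (h * k) * (ω (g * h) k)⁻¹.val * (ω (g * h) k).val : ℂ) * h2 +
        (ω h k * ω g (h * k) : ℂ) * h1
    have h2 : (F.b g h).hom ▷ F.L k ≫ (F.b (g * h : H) k).hom =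
        (F.psi g h k : ℂ) • ((α_ (F.L g) (F.L h) (F.L k)).hom ≫ F.L g ◁ (F.b h k).hom ≫
          (F.b g (h * k : H)).hom ≫ eqToHom (congrArg (fun x : H => F.L x) e₄)) :=
      F.psi_spec g h k
    simp only [m, smulIso_hom, Iso.trans_hom, eqToIso.hom, eqToHom_refl, Category.comp_id,
      MonoidalLinear.smul_whiskerRight, MonoidalLinear.whiskerLeft_smul, Linear.smul_comp,
      Linear.comp_smul, smul_smul]
    rw [h2, smul_smul]
    congr 1
    linear_combination h1
  obtain ⟨v⟩ := (InClass.unit (C := C)).iso (F.inClass 1)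
  -- an isomorphism `v : 𝟙 ≅ L 1` is idempotent up to a factor `z`, so `z⁻¹ • v` is a unit
  have : IsIso ((v.hom ⊗ₘ v.hom) ≫ (m (one_mul (1 : H))).hom) := inferInstance
  obtain ⟨z, hz⟩ := ((InClass.unit (C := C)).tensor InClass.unit).exists_unit_smul
    ((v.hom ⊗ₘ v.hom) ≫ (m (one_mul (1 : H))).hom) ((λ_ (𝟙_ C)).hom ≫ v.hom)
  refine ⟨⟨m, assoc, smulIso z⁻¹ v, ?_⟩, fun g h => ?_⟩
  · simp only [smulIso_hom, smul_tensorHom, tensorHom_smul, Linear.smul_comp, hz,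
      Linear.comp_smul, smul_smul]
    simp
  · simp [m]

end Modular

end

section

open Limits

/-! ### Haploid algebras -/

/-- A subobject of `A` that is stable under multiplication from the left is a submodule: the axioms
of a module follow from those of `A`. -/
theorem IsHaploid.isIso_iff {C : Type u} [Category.{v} C] [MonoidalCategory C]
    [HasZeroMorphisms C] {A : C} [MonObj A] (hA : IsHaploid A) {M : C} (f : M ⟶ A) [Mono f]
    (s : A ⊗ M ⟶ M) (hs : s ≫ f = A ◁ f ≫ μ[A]) : IsIso f ↔ f ≠ 0 := by
  have h1 : η[A] ▷ M ≫ s = (λ_ M).hom := by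
    rw [← cancel_mono f, Category.assoc, hs, ← whisker_exchange_assoc, MonObj.one_mul,
      leftUnitor_naturality]
  have h2 : μ[A] ▷ M ≫ s = (α_ A A M).hom ≫ A ◁ s ≫ s := by
    rw [← cancel_mono f]
    simp only [Category.assoc, hs]
    rw [← whisker_exchange_assoc, MonObj.mul_assoc, ← whiskerLeft_comp_assoc, hs]
    simp
  let _ : ModObj A M := { smul := s, one_smul := h1, mul_smul := h2 }
  exact hA M f hs

theorem IsHaploid.id_ne_zero {C : Type u} [Category.{v} C] [MonoidalCategory C]
    [HasZeroMorphisms C] {A : C} [MonObj A] (hA : IsHaploid A) : 𝟙 A ≠ 0 :=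
  (hA.isIso_iff (𝟙 A) μ[A] (by simp)).1 inferInstance

section Haploid

variable {C : Type u} [Category.{v} C] [Abelian C] [Linear ℂ C] [MonoidalCategory C]
  [MonoidalPreadditive C] [MonoidalLinear ℂ C] [BraidedCategory C] [RightRigidCategory C]
  [RibbonTwist C] [IsModular C]

omit [Linear ℂ C] [MonoidalPreadditive C] [MonoidalLinear ℂ C] [RibbonTwist C] [IsModular C]
  [Abelian C] in
theorem epi_whiskerLeft (A : C) {X Y : C} (p : X ⟶ Y) [Epi p] : Epi (A ◁ p) := by
  let _ := BraidedCategory.exactPairing_swap A Aᘁ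
  have : (tensorLeft A).PreservesEpimorphisms :=
    Functor.preservesEpimorphisms_of_adjunction (tensorLeftAdjunction Aᘁ A)
  exact inferInstanceAs (Epi ((tensorLeft A).map p))

variable {A : C} [MonObj A] (hA : IsHaploid A)

include hA

omit [Linear ℂ C] [MonoidalLinear ℂ C] [BraidedCategory C] [RightRigidCategory C]
  [RibbonTwist C] [IsModular C] in
theorem IsHaploid.one_ne_zero : η[A] ≠ 0 := by
  intro h
  apply hA.id_ne_zero
  rw [← cancel_epi (λ_ A).hom, Category.comp_id, ← MonObj.one_mul A, h]
  simp

omit [Linear ℂ C] [MonoidalPreadditive C] [MonoidalLinear ℂ C] [RibbonTwist C] [IsModular C] in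
/-- The left ideal generated by a non-zero morphism `e` is the whole algebra. -/
theorem IsHaploid.epi_mul_right {X : C} {e : X ⟶ A} (he : e ≠ 0) : Epi (A ◁ e ≫ μ[A]) := by
  set φ : A ⊗ X ⟶ A := A ◁ e ≫ μ[A] with hφ
  have hφ0 : φ ≠ 0 := by
    intro h
    apply he
    have h1 : η[A] ▷ X ≫ φ = (λ_ X).hom ≫ e := by
      rw [hφ, ← whisker_exchange_assoc, MonObj.one_mul, leftUnitor_naturality]
    rw [h, comp_zero] at h1
    rw [← cancel_epi (λ_ X).hom, ← h1, comp_zero]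
  -- the image of `φ` is a submodule, by the lifting property of epimorphisms against monomorphisms
  have hw : A ◁ factorThruImage φ ≫ (A ◁ image.ι φ ≫ μ[A]) =
      ((α_ A A X).inv ≫ μ[A] ▷ X ≫ factorThruImage φ) ≫ image.ι φ := by
    simp only [Category.assoc, image.fac]
    rw [← whiskerLeft_comp_assoc, image.fac, hφ, ← whisker_exchange_assoc, MonObj.mul_assoc]
    simp
  have := epi_whiskerLeft A (factorThruImage φ)
  have : StrongEpi (A ◁ factorThruImage φ) := strongEpi_of_epi _
  have sq : CommSq ((α_ A A X).inv ≫ μ[A] ▷ X ≫ factorThruImage φ) (A ◁ factorThruImage φ)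
    (image.ι φ) (A ◁ image.ι φ ≫ μ[A]) := ⟨hw.symm⟩
  have h1 := (hA.isIso_iff (image.ι φ) sq.lift sq.fac_right).2 (by
    intro h
    apply hφ0
    rw [← image.fac φ, h, comp_zero])
  rw [← image.fac φ]
  infer_instance

omit [BraidedCategory C] [RightRigidCategory C] [RibbonTwist C] [IsModular C]
  [Linear ℂ C] [MonoidalLinear ℂ C] in
/-- The annihilator of a non-zero morphism from an invertible object vanishes. -/
theorem IsHaploid.mono_mul_right {X : C} {g : Pic C} (hX : InClass X g) {e : X ⟶ A}
    (h0 : A ◁ e ≫ μ[A] ≠ 0) : Mono (A ◁ e ≫ μ[A]) := by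
  set φ : A ⊗ X ⟶ A := A ◁ e ≫ μ[A] with hφ
  have hX' := inClass_rep g⁻¹
  set X' : C := rep g⁻¹
  obtain ⟨i⟩ := (hX.tensor hX').iso
    (show InClass (𝟙_ C) (g * g⁻¹) by rw [mul_inv_cancel]; exact InClass.unit)
  have := hX'.isEquivalence_tensorRight
  have hm : Mono (kernel.ι φ ▷ X') := inferInstanceAs (Mono ((tensorRight X').map (kernel.ι φ)))
  let c : (A ⊗ X) ⊗ X' ≅ A := α_ A X X' ≪≫ whiskerLeftIso A i ≪≫ ρ_ A
  let k : A ⊗ kernel φ ⟶ kernel φ := kernel.lift φ (A ◁ kernel.ι φ ≫ (α_ A A X).inv ≫ μ[A] ▷ X) (by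
    simp only [Category.assoc]
    rw [hφ, ← whisker_exchange_assoc, MonObj.mul_assoc]
    have h := congrArg (fun t => A ◁ t ≫ μ[A]) (kernel.condition φ)
    simpa [hφ] using h)
  have hk : k ≫ kernel.ι φ = A ◁ kernel.ι φ ≫ (α_ A A X).inv ≫ μ[A] ▷ X := kernel.lift_ι _ _ _
  -- `kernel φ ⊗ X'` is a submodule of `A ⊗ X ⊗ X' ≅ A`
  have hs : ((α_ A (kernel φ) X').inv ≫ k ▷ X') ≫ (kernel.ι φ ▷ X' ≫ c.hom) =
      A ◁ (kernel.ι φ ▷ X' ≫ c.hom) ≫ μ[A] := by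
    rw [Category.assoc, ← comp_whiskerRight_assoc, hk]
    simp only [c, Iso.trans_hom, whiskerLeftIso_hom, comp_whiskerRight, Category.assoc]
    rw [associator_naturality_left_assoc, ← whisker_exchange_assoc, rightUnitor_naturality]
    monoidal
  have h1 := hA.isIso_iff (kernel.ι φ ▷ X' ≫ c.hom) ((α_ A (kernel φ) X').inv ≫ k ▷ X') hs
  refine Preadditive.mono_of_kernel_zero ?_
  by_contra hne
  have h2 : kernel.ι φ ▷ X' ≫ c.hom ≠ 0 := by
    intro h
    rw [Preadditive.IsIso.comp_right_eq_zero] at h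
    exact hne ((tensorRight X').map_injective (by rw [Functor.map_zero]; exact h))
  have h3 := h1.2 h2
  rw [isIso_comp_right_iff] at h3
  have h3' : IsIso ((tensorRight X').map (kernel.ι φ)) := h3
  have h4 : IsIso (kernel.ι φ) := isIso_of_reflects_iso _ (tensorRight X')
  apply h0
  rw [← cancel_epi (kernel.ι φ), kernel.condition, comp_zero]

omit [RibbonTwist C] [IsModular C] [Linear ℂ C] [MonoidalLinear ℂ C] in
/-- Right multiplication by a non-zero morphism from an invertible object is invertible. -/
theorem IsHaploid.isIso_mul_right {X : C} {g : Pic C} (hX : InClass X g) {e : X ⟶ A}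
    (he : e ≠ 0) : IsIso (A ◁ e ≫ μ[A]) := by
  have h1 := hA.epi_mul_right he
  have h2 := hA.mono_mul_right hX (e := e) fun h => hA.id_ne_zero (by
    rw [← cancel_epi (A ◁ e ≫ μ[A]), h, zero_comp, zero_comp])
  exact isIso_of_mono_of_epi _

omit [RibbonTwist C] [IsModular C] [Linear ℂ C] [MonoidalLinear ℂ C] in
theorem IsHaploid.mul_ne_zero {X Y : C} {g : Pic C} (hX : InClass X g) {f : Y ⟶ A} {e : X ⟶ A}
    (hf : f ≠ 0) (he : e ≠ 0) : (f ⊗ₘ e) ≫ μ[A] ≠ 0 := by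
  intro h
  have := hA.isIso_mul_right hX he
  have := hX.isEquivalence_tensorRight
  rw [MonoidalCategory.tensorHom_def, Category.assoc, Preadditive.IsIso.comp_right_eq_zero] at h
  exact hf ((tensorRight X).map_injective (by rw [Functor.map_zero]; exact h))

/-- A haploid algebra contains the tensor unit only once: right multiplication by `e : 𝟙 ⟶ A` has
an eigenvalue `z` on the space of these morphisms, and `e - z • η` is not invertible. -/
theorem IsHaploid.exists_smul_one (e : 𝟙_ C ⟶ A) : ∃ z : ℂ, e = z • η[A] := by
  have : Nontrivial (𝟙_ C ⟶ A) := ⟨η[A], 0, hA.one_ne_zero⟩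
  let T : Module.End ℂ (𝟙_ C ⟶ A) :=
    { toFun := fun f => (λ_ (𝟙_ C)).inv ≫ (f ⊗ₘ e) ≫ μ[A]
      map_add' := fun f f' => by simp [MonoidalPreadditive.add_tensor]
      map_smul' := fun z f => by simp [smul_tensorHom] }
  obtain ⟨z, hz⟩ := Module.End.exists_eigenvalue T
  obtain ⟨f, hf, hf0⟩ := hz.exists_hasEigenvector
  rw [Module.End.mem_eigenspace_iff] at hf
  change (λ_ (𝟙_ C)).inv ≫ (f ⊗ₘ e) ≫ μ[A] = z • f at hf
  refine ⟨z, ?_⟩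
  by_contra hne
  refine hA.mul_ne_zero InClass.unit hf0 (sub_ne_zero.2 hne) ?_
  have h1 : (f ⊗ₘ η[A]) ≫ μ[A] = (ρ_ (𝟙_ C)).hom ≫ f := MonObj.mul_one_hom f
  rw [Iso.inv_comp_eq] at hf
  have h2 : f ⊗ₘ (e - z • η[A]) = (f ⊗ₘ e) - z • (f ⊗ₘ η[A]) := by
    rw [← tensorHom_smul, eq_sub_iff_add_eq, ← MonoidalPreadditive.tensor_add, sub_add_cancel]
  rw [h2, Preadditive.sub_comp, hf, Linear.smul_comp, h1, Linear.comp_smul, unitors_equal, sub_self]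

/-- A haploid algebra contains every invertible object at most once. -/
theorem IsHaploid.exists_smul {X : C} {g : Pic C} (hX : InClass X g) {e : X ⟶ A} (he : e ≠ 0)
    (e' : X ⟶ A) : ∃ z : ℂ, e' = z • e := by
  have := hA.isIso_mul_right hX he
  have := hX.isEquivalence_tensorRight
  obtain ⟨f, hf⟩ := (tensorRight X).map_surjective ((λ_ X).hom ≫ e' ≫ inv (A ◁ e ≫ μ[A]))
  obtain ⟨z, rfl⟩ := hA.exists_smul_one f
  refine ⟨z, ?_⟩
  change (z • η[A]) ▷ X = _ at hf
  rw [← Category.assoc, IsIso.eq_comp_inv, MonoidalLinear.smul_whiskerRight, Linear.smul_comp,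
    ← whisker_exchange_assoc, MonObj.one_mul, leftUnitor_naturality, ← Linear.comp_smul,
    cancel_epi] at hf
  exact hf.symm

end Haploid

end

section

open Limits

/-! ### The structure of Schellekens algebras -/

section Product

variable {C : Type u} [Category.{v} C] [Abelian C] [Linear ℂ C] [MonoidalCategory C]
  [MonoidalPreadditive C] [MonoidalLinear ℂ C] [BraidedCategory C] [RightRigidCategory C]
  [RibbonTwist C] [IsModular C]

/-- The structure constants of an associative product trivialize `ψ`. -/
theorem trivializes_of_product {F : PicFrame C} {H : Subgroup (Pic C)} {ω : H → H → ℂˣ} {A : C}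
    [MonObj A] (e : ∀ h : H, F.L h ⟶ A) (he : ∀ h, e h ≠ 0)
    (hω : ∀ g h : H, (e g ⊗ₘ e h) ≫ μ[A] = (ω g h : ℂ) • ((F.b g h).hom ≫ e (g * h))) :
    F.Trivializes H ω := by
  intro g h k
  have h1 : ((e g ⊗ₘ e h) ⊗ₘ e k) ≫ μ[A] ▷ A ≫ μ[A] = (ω g h * ω (g * h) k : ℂ) •
      ((F.b g h).hom ▷ F.L k ≫ (F.b (g * h : H) k).hom ≫ e (g * h * k)) := by
    rw [← MonoidalCategory.tensorHom_id, tensorHom_comp_tensorHom_assoc, hω, smul_tensorHom,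
      Linear.smul_comp, Category.comp_id, ← Category.id_comp (e k), ← tensorHom_comp_tensorHom,
      Category.assoc]
    erw [hω (g * h) k]
    rw [Linear.comp_smul, smul_smul, MonoidalCategory.tensorHom_id]
  have h2 : (e g ⊗ₘ (e h ⊗ₘ e k)) ≫ A ◁ μ[A] ≫ μ[A] = (ω h k * ω g (h * k) : ℂ) •
      (F.L g ◁ (F.b h k).hom ≫ (F.b g (h * k : H)).hom ≫ e (g * (h * k))) := by
    rw [← MonoidalCategory.id_tensorHom, tensorHom_comp_tensorHom_assoc, hω, tensorHom_smul,
      Linear.smul_comp, Category.comp_id, ← Category.id_comp (e g), ← tensorHom_comp_tensorHom,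
      Category.assoc]
    erw [hω g (h * k)]
    rw [Linear.comp_smul, smul_smul, MonoidalCategory.id_tensorHom]
  have h3 : (F.b g h).hom ▷ F.L k ≫ (F.b (g * h : H) k).hom ≫ e (g * h * k) =
      (F.psi g h k : ℂ) • ((α_ (F.L g) (F.L h) (F.L k)).hom ≫ F.L g ◁ (F.b h k).hom ≫
          (F.b g (h * k : H)).hom ≫ e (g * (h * k))) := by
    have h4 : (F.b g h).hom ▷ F.L k ≫ (F.b (g * h : H) k).hom =
        (F.psi g h k : ℂ) • ((α_ (F.L g) (F.L h) (F.L k)).hom ≫ F.L g ◁ (F.b h k).hom ≫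
          (F.b g (h * k : H)).hom ≫
            eqToHom (congrArg (fun x : H => F.L x) (mul_assoc g h k).symm)) :=
      F.psi_spec g h k
    have h5 : ∀ {x y : H} (exy : x = y),
        eqToHom (congrArg (fun x : H => F.L x) exy) ≫ e y = e x := by
      rintro x _ rfl; simp
    rw [reassoc_of% h4, Linear.smul_comp]
    simp only [Category.assoc]
    rw [h5 (mul_assoc g h k).symm]
  have h6 : (α_ (F.L g) (F.L h) (F.L k)).hom ≫ F.L g ◁ (F.b h k).hom ≫
      (F.b g (h * k : H)).hom ≫ e (g * (h * k)) ≠ 0 := by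
    rw [ne_eq, Preadditive.IsIso.comp_left_eq_zero, Preadditive.IsIso.comp_left_eq_zero,
      Preadditive.IsIso.comp_left_eq_zero]
    exact he _
  rw [MonObj.mul_assoc, associator_naturality_assoc, h2, h3, smul_smul, Linear.comp_smul] at h1
  have h7 := smul_hom_injective h6 h1
  have h8 : ω h k * ω g (h * k) = ω g h * ω (g * h) k * F.psi g h k := Units.ext h7
  rw [mul_right_comm (ω h k), h8, mul_inv_eq_iff_eq_mul, mul_inv_eq_iff_eq_mul]
  ac_rfl

end Product

namespace SchellekensAlgebra

variable {C : Type u} [Category.{v} C] [Abelian C] [Linear ℂ C] [MonoidalCategory C]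
  [MonoidalPreadditive C] [MonoidalLinear ℂ C] [BraidedCategory C] [RightRigidCategory C]
  [RibbonTwist C] [IsModular C] (A : SchellekensAlgebra C)

theorem mem_support_iff {X : C} {g : Pic C} (hX : InClass X g) :
    g ∈ A.support ↔ ∃ f : X ⟶ A.X, f ≠ 0 := by
  obtain ⟨r⟩ := hX.iso (inClass_rep g)
  have h1 : g ∈ A.support ↔ ∃ f : rep g ⟶ A.X, f ≠ 0 :=
    Module.finrank_pos_iff.trans (nontrivial_iff_exists_ne 0)
  rw [h1]
  constructor
  · rintro ⟨f, hf⟩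
    exact ⟨r.hom ≫ f, by rwa [ne_eq, Preadditive.IsIso.comp_left_eq_zero]⟩
  · rintro ⟨f, hf⟩
    exact ⟨r.inv ≫ f, by rwa [ne_eq, Preadditive.IsIso.comp_left_eq_zero]⟩

/-- The support of a Schellekens algebra as a subgroup. -/
def supportSubgroup : Subgroup (Pic C) :=
  let S : Submonoid (Pic C) :=
    { carrier := A.support
      one_mem' := (A.mem_support_iff InClass.unit).2 ⟨η[A.X], A.haploid.one_ne_zero⟩
      mul_mem' := by
        intro g h hg hh
        obtain ⟨e, he⟩ := (A.mem_support_iff (inClass_rep g)).1 hg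
        obtain ⟨e', he'⟩ := (A.mem_support_iff (inClass_rep h)).1 hh
        exact (A.mem_support_iff ((inClass_rep g).tensor (inClass_rep h))).2
          ⟨_, A.haploid.mul_ne_zero (inClass_rep h) he he'⟩ }
  { S with
    -- a submonoid of a finite group is closed under inverses
    inv_mem' := by
      intro g hg
      have h1 : Submonoid.powers g ≤ S := Submonoid.powers_le.2 hg
      exact h1 ((isOfFinOrder_of_finite g).mem_powers_iff_mem_zpowers.2
        (inv_mem (Subgroup.mem_zpowers g))) }

theorem coe_supportSubgroup : (A.supportSubgroup : Set (Pic C)) = A.support := rfl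

variable {A}

/-- A Schellekens algebra is the direct sum of the invertible objects in its support. -/
theorem nonempty_isColimit (F : PicFrame C) {H : Subgroup (Pic C)} (hH : A.support = H)
    (e : ∀ h : H, F.L h ⟶ A.X) (he : ∀ h, e h ≠ 0) :
    Nonempty (IsColimit (Cofan.mk A.X e)) := by
  have := Fintype.ofFinite H
  obtain ⟨n, S, j, hS, ⟨hj⟩⟩ := IsModular.semisimple A.X
  obtain ⟨q, hq1, hq2, hq3⟩ := exists_projections hj
  have hex : ∀ h : H, ∃ p : A.X ⟶ F.L h, e h ≫ p = 𝟙 _ := by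
    intro h
    obtain ⟨i, hi⟩ := exists_comp_projection_ne_zero hq3 (he h)
    have := (F.inClass h).simple
    have := hS i
    have := isIso_of_hom_simple hi
    exact ⟨q i ≫ inv (e h ≫ q i), by rw [← Category.assoc, IsIso.hom_inv_id]⟩
  choose p hp using hex
  have hp2 : ∀ g h : H, g ≠ h → e g ≫ p h = 0 := by
    intro g h hgh
    by_contra h0
    exact hgh (Subtype.ext ((F.inClass g).eq_of_ne_zero (F.inClass h) h0))
  refine nonempty_isColimit_of_projections p hp hp2 (Cofan.IsColimit.hom_ext hj _ _ fun i => ?_)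
  change j i ≫ ∑ h, p h ≫ e h = j i ≫ 𝟙 _
  have hsplit : IsSplitMono (j i) := ⟨⟨⟨q i, hq1 i⟩⟩⟩
  obtain ⟨g, hg⟩ := isInvertible_iff.1 (A.invertible_of_simple (S i) (j i) (hS i))
  have hji : j i ≠ 0 := by
    intro h0
    have h := hq1 i
    rw [h0, zero_comp] at h
    exact hg.id_ne_zero h.symm
  have hgH : g ∈ H := by
    rw [← SetLike.mem_coe, ← hH]
    exact (A.mem_support_iff hg).2 ⟨j i, hji⟩
  obtain ⟨r⟩ := hg.iso (F.inClass g)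
  obtain ⟨z, hz⟩ := A.haploid.exists_smul hg (e := r.hom ≫ e ⟨g, hgH⟩)
    (by rw [ne_eq, Preadditive.IsIso.comp_left_eq_zero]; exact he _) (j i)
  have h1 : e ⟨g, hgH⟩ ≫ ∑ h, p h ≫ e h = e ⟨g, hgH⟩ := by
    rw [Preadditive.comp_sum, Finset.sum_eq_single ⟨g, hgH⟩]
    · rw [reassoc_of% hp]
    · intro h _ hh
      rw [reassoc_of% hp2 _ _ hh.symm, zero_comp]
    · simp
  rw [hz, Linear.smul_comp, Category.assoc, h1, Category.comp_id]

/-- Every Schellekens algebra is given by its structure constants with respect to a choice of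
non-zero morphisms `L h ⟶ A`. -/
theorem exists_isGivenBy (F : PicFrame C) {H : Subgroup (Pic C)} (hH : A.support = H) :
    ∃ ω : H → H → ℂˣ, F.Trivializes H ω ∧ A.IsGivenBy F H ω := by
  have hex : ∀ h : H, ∃ e : F.L h ⟶ A.X, e ≠ 0 := fun h =>
    (A.mem_support_iff (F.inClass h)).1 (by rw [hH]; exact h.2)
  choose e he using hex
  have hω : ∀ g h : H, ∃ z : ℂˣ,
      (e g ⊗ₘ e h) ≫ μ[A.X] = (z : ℂ) • ((F.b g h).hom ≫ e (g * h)) := by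
    intro g h
    have h0 := A.haploid.mul_ne_zero (F.inClass h) (he g) (he h)
    obtain ⟨z, hz⟩ := A.haploid.exists_smul ((F.inClass g).tensor (F.inClass h))
      (e := (F.b g h).hom ≫ e (g * h))
      (by rw [ne_eq, Preadditive.IsIso.comp_left_eq_zero]; exact he _) ((e g ⊗ₘ e h) ≫ μ[A.X])
    have hz0 : z ≠ 0 := by
      rintro rfl
      exact h0 (by rw [hz, zero_smul])
    exact ⟨Units.mk0 z hz0, hz⟩
  choose ω hω using hω
  exact ⟨ω, trivializes_of_product e he hω, e, nonempty_isColimit F hH e he, hω⟩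

theorem IsGivenBy.exists_ne_zero {F : PicFrame C} {H : Subgroup (Pic C)} {ω : H → H → ℂˣ}
    (h : A.IsGivenBy F H ω) :
    ∃ e : ∀ h : H, F.L (h : Pic C) ⟶ A.X, (∀ h, e h ≠ 0) ∧
      Nonempty (IsColimit (Cofan.mk A.X e)) ∧
      ∀ g h : H, (e g ⊗ₘ e h) ≫ μ[A.X] = (ω g h : ℂ) • ((F.b g h).hom ≫ e (g * h)) := by
  have := Fintype.ofFinite H
  obtain ⟨e, ⟨he⟩, hω⟩ := h
  obtain ⟨p, hp, -, -⟩ := exists_projections he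
  refine ⟨e, fun h h0 => ?_, ⟨he⟩, hω⟩
  have h1 := hp h
  rw [h0, zero_comp] at h1
  exact (F.inClass h).id_ne_zero h1.symm

theorem IsGivenBy.support_eq {F : PicFrame C} {H : Subgroup (Pic C)} {ω : H → H → ℂˣ}
    (h : A.IsGivenBy F H ω) : A.support = H := by
  have := Fintype.ofFinite H
  obtain ⟨e, hne, ⟨he⟩, -⟩ := h.exists_ne_zero
  obtain ⟨p, -, -, hp3⟩ := exists_projections he
  ext g
  constructor
  · intro hg
    obtain ⟨f, hf⟩ := (A.mem_support_iff (F.inClass g)).1 hg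
    obtain ⟨h, hh⟩ := exists_comp_projection_ne_zero hp3 hf
    rw [(F.inClass g).eq_of_ne_zero (F.inClass h) hh]
    exact h.2
  · intro hg
    exact (A.mem_support_iff (F.inClass g)).2 ⟨e ⟨g, hg⟩, hne _⟩

end SchellekensAlgebra

/-- Every trivialization of `ψ` on a subgroup defines a Schellekens algebra. -/
theorem PicFrame.Trivializes.exists_isGivenBy {C : Type u} [Category.{v} C] [Abelian C]
    [Linear ℂ C] [MonoidalCategory C] [MonoidalPreadditive C] [MonoidalLinear ℂ C]
    [BraidedCategory C] [RightRigidCategory C] [RibbonTwist C] [IsModular C]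
    (hdim : ∀ X : C, IsInvertible X → qdim X = 𝟙 (𝟙_ C))
    {F : PicFrame C} {H : Subgroup (Pic C)} {ω : H → H → ℂˣ} (hω : F.Trivializes H ω) :
    ∃ A : SchellekensAlgebra C, A.IsGivenBy F H ω := by
  have : HasFiniteBiproducts C := Abelian.hasFiniteBiproducts
  obtain ⟨T, hT⟩ := hω.exists_twistedGroup
  refine ⟨T.algebra (φ := fun h : H => (h : Pic C)) (fun h => F.inClass h) Subtype.val_injective
    hdim, biproduct.ι _, ⟨(biproduct.isBilimit _).isColimit⟩, fun g h => ?_⟩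
  exact (T.ι_mul (rfl : g * h = g * h)).trans (by rw [hT, Linear.smul_comp]; rfl)

end

section

open Limits

/-! ### Isomorphisms of Frobenius algebras -/

section FrobeniusUnique

variable {C : Type u} [Category.{v} C] [MonoidalCategory C] {A B : C} [MonObj A] [ComonObj A]
  [MonObj B] [ComonObj B]

/-- The form `ε ∘ m` of a Frobenius algebra is non-degenerate, the copairing being `Δ ∘ η`. -/
theorem IsFrobenius.eq_of_form (hB : IsFrobenius B) {X : C} {t t' : X ⟶ B ⊗ B}
    (h : t ▷ B ≫ (α_ B B B).hom ≫ B ◁ (μ[B] ≫ ε[B]) =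
      t' ▷ B ≫ (α_ B B B).hom ≫ B ◁ (μ[B] ≫ ε[B])) :
    t = t' := by
  have zig : B ◁ (η[B] ≫ Δ[B]) ≫ (α_ B B B).inv ≫ (μ[B] ≫ ε[B]) ▷ B = (ρ_ B).hom ≫ (λ_ B).inv := by
    have h1 : B ◁ Δ[B] ≫ (α_ B B B).inv ≫ μ[B] ▷ B ≫ ε[B] ▷ B = μ[B] ≫ (λ_ B).inv := by
      rw [← reassoc_of% hB.left, ComonObj.counit_comul]
    rw [whiskerLeft_comp, comp_whiskerRight, Category.assoc, h1, MonObj.mul_one_assoc]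
  have key : ∀ s : X ⟶ B ⊗ B, s = 𝟙 _ ⊗≫ X ◁ (η[B] ≫ Δ[B]) ⊗≫
      (s ▷ B ≫ (α_ B B B).hom ≫ B ◁ (μ[B] ≫ ε[B])) ▷ B ⊗≫ 𝟙 _ := by
    intro s
    symm
    calc _ = 𝟙 _ ⊗≫ (X ◁ (η[B] ≫ Δ[B]) ≫ s ▷ (B ⊗ B)) ⊗≫ B ◁ ((μ[B] ≫ ε[B]) ▷ B) ⊗≫ 𝟙 _ := by
          monoidal
      _ = s ⊗≫ B ◁ (B ◁ (η[B] ≫ Δ[B]) ≫ (α_ B B B).inv ≫ (μ[B] ≫ ε[B]) ▷ B) ⊗≫ 𝟙 _ := by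
          rw [whisker_exchange]; monoidal
      _ = s := by rw [zig]; monoidal
  rw [key t, h, ← key t']

/-- An isomorphism of algebras between Frobenius algebras which preserves the counit preserves the
coproduct, because the coproduct is determined by the product and the form. -/
theorem IsFrobenius.isComonHom (hA : IsFrobenius A) (hB : IsFrobenius B) (f : A ≅ B)
    [IsMonHom f.hom] (hε : f.hom ≫ ε[B] = ε[A]) : IsComonHom f.hom where
  hom_counit := hε
  hom_comul := by
    refine hB.eq_of_form ?_
    have h1 : (f.hom ≫ Δ[B]) ▷ B ≫ (α_ B B B).hom ≫ B ◁ (μ[B] ≫ ε[B]) =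
        f.hom ▷ B ≫ μ[B] ≫ (ρ_ B).inv := by
      rw [comp_whiskerRight, whiskerLeft_comp, Category.assoc, ← reassoc_of% hB.right,
        ComonObj.comul_counit]
    have h2 : (f.hom ⊗ₘ f.hom) ≫ μ[B] ≫ ε[B] = μ[A] ≫ ε[A] := by
      rw [← IsMonHom.mul_hom_assoc, hε]
    rw [h1, ← cancel_epi (A ◁ f.hom), ← MonoidalCategory.tensorHom_def'_assoc,
      ← IsMonHom.mul_hom_assoc]
    calc _ = μ[A] ≫ (ρ_ A).inv ≫ f.hom ▷ 𝟙_ C := by rw [rightUnitor_inv_naturality]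
      _ = (Δ[A] ▷ A ≫ (α_ A A A).hom ≫ A ◁ μ[A] ≫ A ◁ ε[A]) ≫ f.hom ▷ 𝟙_ C := by
          rw [← ComonObj.comul_counit]
          simp only [Category.assoc]
          rw [reassoc_of% hA.right]
      _ = Δ[A] ▷ A ≫ (α_ A A A).hom ≫ (f.hom ⊗ₘ ((f.hom ⊗ₘ f.hom) ≫ μ[B] ≫ ε[B])) := by
          rw [h2, MonoidalCategory.tensorHom_def']; simp
      _ = A ◁ f.hom ≫ (Δ[A] ≫ (f.hom ⊗ₘ f.hom)) ▷ B ≫ (α_ B B B).hom ≫ B ◁ (μ[B] ≫ ε[B]) := by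
          rw [whisker_exchange_assoc, comp_whiskerRight_assoc,
            ← MonoidalCategory.tensorHom_def_assoc, associator_naturality_assoc,
            ← MonoidalCategory.id_tensorHom, tensorHom_comp_tensorHom, Category.comp_id]

end FrobeniusUnique

theorem tensor_hom_ext_of_sum {C : Type u} [Category.{v} C] [Preadditive C] [MonoidalCategory C]
    [MonoidalPreadditive C] {J : Type w} [Fintype J] {L : J → C} {X Z : C} {e : ∀ j, L j ⟶ X}
    {p : ∀ j, X ⟶ L j} (h3 : ∑ j, p j ≫ e j = 𝟙 X) {f f' : X ⊗ X ⟶ Z}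
    (h : ∀ i j, (e i ⊗ₘ e j) ≫ f = (e i ⊗ₘ e j) ≫ f') : f = f' := by
  have h1 : ∑ i, ∑ j, (p i ⊗ₘ p j) ≫ (e i ⊗ₘ e j) = 𝟙 (X ⊗ X) := by
    simp only [tensorHom_comp_tensorHom, ← tensor_sum, ← sum_tensor, h3]
    simp
  rw [← Category.id_comp f, ← Category.id_comp f', ← h1]
  simp only [Preadditive.sum_comp, Category.assoc, h]

namespace SchellekensAlgebra

variable {C : Type u} [Category.{v} C] [Abelian C] [Linear ℂ C] [MonoidalCategory C]
  [MonoidalPreadditive C] [MonoidalLinear ℂ C] [BraidedCategory C] [RightRigidCategory C]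
  [RibbonTwist C] [IsModular C] {A B : SchellekensAlgebra C}

/-- A Schellekens algebra is determined by its support and its structure constants. -/
theorem IsGivenBy.isomorphic {F : PicFrame C} {H : Subgroup (Pic C)} {ω : H → H → ℂˣ}
    (hA : A.IsGivenBy F H ω) (hB : B.IsGivenBy F H ω) : A.Isomorphic B := by
  have := Fintype.ofFinite H
  obtain ⟨e, ⟨he⟩, hω⟩ := hA
  obtain ⟨e', ⟨he'⟩, hω'⟩ := hB
  obtain ⟨p, hp1, hp2, hp3⟩ := exists_projections he
  obtain ⟨p', hp1', hp2', hp3'⟩ := exists_projections he'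
  have h1 : ∀ h, e h ≫ ∑ k, p k ≫ e' k = e' h := fun h => by
    rw [Preadditive.comp_sum, Finset.sum_eq_single h]
    · rw [reassoc_of% hp1]
    · intro k _ hk
      rw [reassoc_of% hp2 _ _ hk.symm, zero_comp]
    · simp
  have h2 : ∀ h, e' h ≫ ∑ k, p' k ≫ e k = e h := fun h => by
    rw [Preadditive.comp_sum, Finset.sum_eq_single h]
    · rw [reassoc_of% hp1']
    · intro k _ hk
      rw [reassoc_of% hp2' _ _ hk.symm, zero_comp]
    · simp
  let f : A.X ≅ B.X :=
    { hom := ∑ k, p k ≫ e' k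
      inv := ∑ k, p' k ≫ e k
      hom_inv_id := Cofan.IsColimit.hom_ext he _ _ fun h => by
        change e h ≫ _ ≫ _ = e h ≫ 𝟙 _
        rw [reassoc_of% h1, h2, Category.comp_id]
      inv_hom_id := Cofan.IsColimit.hom_ext he' _ _ fun h => by
        change e' h ≫ _ ≫ _ = e' h ≫ 𝟙 _
        rw [reassoc_of% h2, h1, Category.comp_id] }
  have hf : ∀ h, e h ≫ f.hom = e' h := h1
  have hmul : μ[A.X] ≫ f.hom = (f.hom ⊗ₘ f.hom) ≫ μ[B.X] := by
    refine tensor_hom_ext_of_sum hp3 fun g h => ?_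
    rw [reassoc_of% hω, Linear.smul_comp, Category.assoc, hf, tensorHom_comp_tensorHom_assoc, hf,
      hf, hω']
  -- `η ≫ f` is a unit for the product of `B`, and units are unique
  have hone : η[A.X] ≫ f.hom = η[B.X] := by
    have h3 : (η[A.X] ⊗ₘ (η[B.X] ≫ f.inv)) ≫ μ[A.X] ≫ f.hom =
        ((η[A.X] ≫ f.hom) ⊗ₘ η[B.X]) ≫ μ[B.X] := by
      rw [hmul, tensorHom_comp_tensorHom_assoc, Category.assoc, f.inv_hom_id, Category.comp_id]
    rw [MonObj.mul_one_hom, reassoc_of% MonObj.one_mul_hom (M := A.X), Category.assoc, f.inv_hom_id,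
      Category.comp_id, unitors_equal, cancel_epi] at h3
    exact h3.symm
  have hmon : IsMonHom f.hom := ⟨hone, hmul⟩
  have hdim : qdim A.X = qdim B.X := by
    rw [qdim, qdim, ← f.hom_inv_id, ctrace_comm, f.inv_hom_id]
  -- the counits agree on the unit component by `ε ∘ η = dim`, and vanish on the other ones
  have hcounit : f.hom ≫ ε[B.X] = ε[A.X] := by
    refine Cofan.IsColimit.hom_ext he _ _ fun h => ?_
    change e h ≫ _ = e h ≫ _
    rw [reassoc_of% hf]
    by_cases hh : (h : Pic C) = 1
    · obtain ⟨r⟩ := (F.inClass h).iso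
        (show InClass (𝟙_ C) (h : Pic C) by rw [hh]; exact InClass.unit)
      obtain ⟨z, hz⟩ := A.haploid.exists_smul (F.inClass h) (e := r.hom ≫ η[A.X])
        (by rw [ne_eq, Preadditive.IsIso.comp_left_eq_zero]; exact A.haploid.one_ne_zero) (e h)
      rw [← hf, hz]
      simp only [Linear.smul_comp, Category.assoc, reassoc_of% hone, A.special.one_counit,
        B.special.one_counit, hdim]
    · have h3 : ∀ t : F.L h ⟶ 𝟙_ C, t = 0 := fun t => by
        by_contra ht
        exact hh ((F.inClass h).eq_of_ne_zero InClass.unit ht)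
      rw [h3 (e' h ≫ _), h3 (e h ≫ _)]
  exact ⟨f, hmon, A.frobenius.isComonHom B.frobenius f hcounit⟩

end SchellekensAlgebra

end

section

open Limits

/-! ### The bihomomorphism of a Schellekens algebra -/

section Product

variable {C : Type u} [Category.{v} C] [MonoidalCategory C] {A : C} [MonObj A]

theorem tensorHom_mul_tensorHom_mul {X Y Z : C} (f : X ⟶ A) (g : Y ⟶ A) (h : Z ⟶ A) :
    (((f ⊗ₘ g) ≫ μ[A]) ⊗ₘ h) ≫ μ[A] =
      (α_ X Y Z).hom ≫ (f ⊗ₘ ((g ⊗ₘ h) ≫ μ[A])) ≫ μ[A] := by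
  have h1 : ((f ⊗ₘ g) ≫ μ[A]) ⊗ₘ h = ((f ⊗ₘ g) ⊗ₘ h) ≫ μ[A] ▷ A := by
    rw [← MonoidalCategory.tensorHom_id, tensorHom_comp_tensorHom, Category.comp_id]
  have h2 : f ⊗ₘ ((g ⊗ₘ h) ≫ μ[A]) = (f ⊗ₘ (g ⊗ₘ h)) ≫ A ◁ μ[A] := by
    rw [← MonoidalCategory.id_tensorHom, tensorHom_comp_tensorHom, Category.comp_id]
  rw [h1, h2, Category.assoc, MonObj.mul_assoc, associator_naturality_assoc, Category.assoc]

theorem whiskerLeft_tensorHom_mul {X Y Z : C} (f : X ⟶ A) (r : Y ⟶ Z) (g : Z ⟶ A) :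
    X ◁ r ≫ (f ⊗ₘ g) ≫ μ[A] = (f ⊗ₘ (r ≫ g)) ≫ μ[A] := by
  rw [← MonoidalCategory.id_tensorHom, tensorHom_comp_tensorHom_assoc, Category.id_comp]

theorem whiskerRight_tensorHom_mul {X Y Z : C} (f : X ⟶ A) (r : Y ⟶ Z) (g : Z ⟶ A) :
    r ▷ X ≫ (g ⊗ₘ f) ≫ μ[A] = ((r ≫ g) ⊗ₘ f) ≫ μ[A] := by
  rw [← MonoidalCategory.tensorHom_id, tensorHom_comp_tensorHom_assoc, Category.id_comp]

end Product

variable {C : Type u} [Category.{v} C] [Abelian C] [Linear ℂ C] [MonoidalCategory C]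
  [MonoidalPreadditive C] [MonoidalLinear ℂ C] [BraidedCategory C] [RightRigidCategory C]
  [RibbonTwist C] [IsModular C] {A B : SchellekensAlgebra C} {H : Subgroup (Pic C)}
  {Ξ : H → H → ℂˣ}

/-- The double braiding of invertible objects is the scalar `θ_{gh} / (θ_g θ_h)`. -/
theorem InClass.theta_smul_braiding_braiding {X Y : C} {g h : Pic C} (hX : InClass X g)
    (hY : InClass Y h) :
    (theta g * theta h : ℂ) • ((β_ X Y).hom ≫ (β_ Y X).hom) = (theta (g * h) : ℂ) • 𝟙 (X ⊗ Y) := by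
  rw [← twistHom_eq (hX.tensor hY), twistHom, RibbonTwist.twist_tensor]
  change _ = _ ≫ (twistHom Y ⊗ₘ twistHom X) ≫ _
  rw [twistHom_eq hX, twistHom_eq hY, smul_tensorHom, tensorHom_smul, smul_smul, id_tensorHom_id,
    Linear.smul_comp, Category.id_comp, Linear.comp_smul, mul_comm]

namespace SchellekensAlgebra

/-- It is enough to know `Ξ_A` on one non-zero morphism `L_h ⟶ A` for each `h`. -/
theorem hasSupportAndKSB_of_family (hH : A.support = H) {L : H → C}
    (hL : ∀ h, InClass (L h) (h : Pic C)) (e : ∀ h, L h ⟶ A.X) (he : ∀ h, e h ≠ 0)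
    (h : ∀ g h : H, (β_ (L h) (L g)).inv ≫ (e h ⊗ₘ e g) ≫ μ[A.X] =
      (Ξ h g : ℂ) • ((e g ⊗ₘ e h) ≫ μ[A.X])) : A.HasSupportAndKSB H Ξ := by
  refine ⟨hH, fun g k X Y hX hY f f' => ?_⟩
  obtain ⟨r⟩ := hX.iso (hL g)
  obtain ⟨s⟩ := hY.iso (hL k)
  obtain ⟨z, rfl⟩ := A.haploid.exists_smul hX (e := r.hom ≫ e g)
    (by rw [ne_eq, Preadditive.IsIso.comp_left_eq_zero]; exact he _) f
  obtain ⟨w, rfl⟩ := A.haploid.exists_smul hY (e := s.hom ≫ e k)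
    (by rw [ne_eq, Preadditive.IsIso.comp_left_eq_zero]; exact he _) f'
  have h1 : (β_ Y X).inv ≫ ((s.hom ≫ e k) ⊗ₘ (r.hom ≫ e g)) ≫ μ[A.X] =
      (Ξ k g : ℂ) • (((r.hom ≫ e g) ⊗ₘ (s.hom ≫ e k)) ≫ μ[A.X]) := by
    rw [← tensorHom_comp_tensorHom, ← tensorHom_comp_tensorHom, Category.assoc, Category.assoc,
      ← BraidedCategory.braiding_inv_naturality_assoc, h, Linear.comp_smul]
  simp only [smul_tensorHom, tensorHom_smul, Linear.smul_comp, Linear.comp_smul, h1]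
  rw [smul_comm w z, smul_comm (Ξ k g : ℂ) z, smul_comm (Ξ k g : ℂ) w]

/-- The bihomomorphism `Ξ_A` in terms of the structure constants of `A`. -/
theorem IsGivenBy.hasSupportAndKSB {F : PicFrame C} {ω : H → H → ℂˣ} (hA : A.IsGivenBy F H ω) :
    A.HasSupportAndKSB H fun h g => (F.omega h g)⁻¹ * ω h g * (ω g h)⁻¹ := by
  obtain ⟨e, he, -, hω⟩ := hA.exists_ne_zero
  refine hasSupportAndKSB_of_family hA.support_eq (fun h => F.inClass h) e he fun g h => ?_
  have h1 : (β_ (F.L h) (F.L g)).hom ≫ (F.b g h).hom = (F.omega h g : ℂ) •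
      ((F.b h g).hom ≫ eqToHom (congrArg (fun x : H => F.L x)
        (Subtype.ext (pic_mul_comm (h : Pic C) g) : h * g = g * h))) := F.omega_spec h g
  have h2 : ∀ {x y : H} (exy : x = y),
      eqToHom (congrArg (fun x : H => F.L x) exy) ≫ e y = e x := by
    rintro x _ rfl; simp
  have h3 : (β_ (F.L h) (F.L g)).hom ≫ (F.b g h).hom ≫ e (g * h) =
      (F.omega h g : ℂ) • ((F.b h g).hom ≫ e (h * g)) := by
    rw [reassoc_of% h1, Linear.smul_comp, Category.assoc,
      h2 (Subtype.ext (pic_mul_comm (h : Pic C) g) : h * g = g * h)]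
  rw [hω, hω, Iso.inv_comp_eq, Linear.comp_smul, Linear.comp_smul, h3, smul_smul, smul_smul]
  congr 1
  push_cast
  field_simp

theorem HasSupportAndKSB.exists_ne_zero (h : A.HasSupportAndKSB H Ξ) (g : H) :
    ∃ e : rep (g : Pic C) ⟶ A.X, e ≠ 0 :=
  (A.mem_support_iff (inClass_rep (g : Pic C))).1 (by rw [h.1]; exact g.2)

theorem HasSupportAndKSB.unique {H' : Subgroup (Pic C)} {Ξ' : H' → H' → ℂˣ}
    (h : A.HasSupportAndKSB H Ξ) (h' : A.HasSupportAndKSB H' Ξ') :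
    (⟨H, Ξ⟩ : (H : Subgroup (Pic C)) × (H → H → ℂˣ)) = ⟨H', Ξ'⟩ := by
  obtain rfl : H = H' := SetLike.coe_injective (h.1.symm.trans h'.1)
  congr 1
  funext k g
  obtain ⟨e, he⟩ := h.exists_ne_zero g
  obtain ⟨f, hf⟩ := h.exists_ne_zero k
  exact Units.ext (smul_hom_injective (A.haploid.mul_ne_zero (inClass_rep _) he hf)
    ((h.2 g k _ _ (inClass_rep _) (inClass_rep _) e f).symm.trans
      (h'.2 g k _ _ (inClass_rep _) (inClass_rep _) e f)))

/-- The function `Ξ_A` is a Kreuzer–Schellekens bihomomorphism: it is multiplicative by the hexagon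
axioms, and its symmetrization is given by the double braiding. -/
theorem HasSupportAndKSB.isKSB (hA : A.HasSupportAndKSB H Ξ) : IsKSB H Ξ := by
  choose e he using hA.exists_ne_zero
  have hL : ∀ g : H, InClass (rep (g : Pic C)) (g : Pic C) := fun g => inClass_rep _
  have key := fun g h : H => hA.2 g h _ _ (hL g) (hL h) (e g) (e h)
  refine ⟨fun g g' h => ?_, fun g h h' => ?_, fun g h => ?_⟩
  · have h1 := hA.2 h (g * g') _ _ (hL h) ((hL g).tensor (hL g')) (e h) ((e g ⊗ₘ e g') ≫ μ[A.X])
    have h0 := A.haploid.mul_ne_zero ((hL g).tensor (hL g')) (he h)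
      (A.haploid.mul_ne_zero (hL g') (he g) (he g'))
    refine Units.ext (smul_hom_injective h0 (h1.symm.trans ?_))
    rw [BraidedCategory.braiding_tensor_left_inv]
    simp only [Category.assoc]
    rw [tensorHom_mul_tensorHom_mul, Iso.inv_hom_id_assoc, whiskerLeft_tensorHom_mul, key,
      tensorHom_smul, Linear.smul_comp, Linear.comp_smul, Linear.comp_smul, Linear.comp_smul,
      ← tensorHom_mul_tensorHom_mul, whiskerRight_tensorHom_mul, key, smul_tensorHom,
      Linear.smul_comp, Linear.comp_smul, tensorHom_mul_tensorHom_mul, Iso.inv_hom_id_assoc,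
      smul_smul, Units.val_mul, mul_comm]
  · have h1 := hA.2 (h * h') g _ _ ((hL h).tensor (hL h')) (hL g) ((e h ⊗ₘ e h') ≫ μ[A.X]) (e g)
    have h0 := A.haploid.mul_ne_zero (hL g)
      (A.haploid.mul_ne_zero (hL h') (he h) (he h')) (he g)
    refine Units.ext (smul_hom_injective h0 (h1.symm.trans ?_))
    rw [BraidedCategory.braiding_tensor_right_inv]
    simp only [Category.assoc]
    rw [← tensorHom_mul_tensorHom_mul, whiskerRight_tensorHom_mul, key,
      smul_tensorHom, Linear.smul_comp, Linear.comp_smul, Linear.comp_smul, Linear.comp_smul,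
      tensorHom_mul_tensorHom_mul, Iso.inv_hom_id_assoc, whiskerLeft_tensorHom_mul, key,
      tensorHom_smul, Linear.smul_comp, Linear.comp_smul, ← tensorHom_mul_tensorHom_mul,
      smul_smul, Units.val_mul]
  · have h0 := A.haploid.mul_ne_zero (hL g) (he h) (he g)
    have h1 : (e h ⊗ₘ e g) ≫ μ[A.X] = (Ξ h g * Ξ g h : ℂ) •
        ((β_ (rep (h : Pic C)) (rep (g : Pic C))).hom ≫
          (β_ (rep (g : Pic C)) (rep (h : Pic C))).hom ≫ (e h ⊗ₘ e g) ≫ μ[A.X]) := by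
      have h2 := key g h
      have h3 := key h g
      rw [Iso.inv_comp_eq, Linear.comp_smul] at h2 h3
      refine h2.trans ?_
      rw [h3, Linear.comp_smul, smul_smul]
    have h4 := (hL h).theta_smul_braiding_braiding (hL g)
    have h5 := congrArg (fun t => t ≫ (e h ⊗ₘ e g) ≫ μ[A.X]) h4
    simp only [Linear.smul_comp, Category.assoc, Category.id_comp] at h5
    have h6 : theta (h : Pic C) * theta (g : Pic C) = Ξ h g * Ξ g h * theta (h * g : Pic C) := by
      refine Units.ext (smul_hom_injective h0 ?_)
      push_cast
      rw [mul_smul _ (theta (h * g : Pic C) : ℂ), ← h5, smul_comm, ← h1]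
    rw [eq_div_iff_mul_eq', pic_mul_comm (g : Pic C), mul_comm (theta (g : Pic C)), h6]
    ac_rfl

/-- The diagonal of `Ξ_A` is the inverse of the self-braiding of the objects in the support. -/
theorem HasSupportAndKSB.diagonal (hdim : ∀ X : C, IsInvertible X → qdim X = 𝟙 (𝟙_ C))
    (hA : A.HasSupportAndKSB H Ξ) (h : H) : Ξ h h = (theta (h : Pic C))⁻¹ := by
  obtain ⟨e, he⟩ := hA.exists_ne_zero h
  have h0 := A.haploid.mul_ne_zero (inClass_rep _) he he
  have h1 := hA.2 h h _ _ (inClass_rep _) (inClass_rep _) e e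
  rw [Iso.inv_comp_eq, (inClass_rep (h : Pic C)).selfBraiding hdim, Linear.smul_comp,
    Category.id_comp, smul_smul] at h1
  rw [eq_inv_iff_mul_eq_one, mul_comm]
  exact Units.ext (smul_hom_injective h0 (h1.symm.trans (one_smul _ _).symm))

theorem HasSupportAndKSB.of_isomorphic (hA : A.HasSupportAndKSB H Ξ) (h : A.Isomorphic B) :
    B.HasSupportAndKSB H Ξ := by
  obtain ⟨f, hf, -⟩ := h
  have hsupp : B.support = A.support := by
    ext g
    rw [B.mem_support_iff (inClass_rep g), A.mem_support_iff (inClass_rep g)]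
    constructor
    · rintro ⟨e, he⟩
      exact ⟨e ≫ f.inv, by rwa [ne_eq, Preadditive.IsIso.comp_right_eq_zero]⟩
    · rintro ⟨e, he⟩
      exact ⟨e ≫ f.hom, by rwa [ne_eq, Preadditive.IsIso.comp_right_eq_zero]⟩
  have hmul : ∀ {X Y : C} (e : X ⟶ B.X) (e' : Y ⟶ B.X), (e ⊗ₘ e') ≫ μ[B.X] =
      (((e ≫ f.inv) ⊗ₘ (e' ≫ f.inv)) ≫ μ[A.X]) ≫ f.hom := fun e e' => by
    rw [Category.assoc, IsMonHom.mul_hom, tensorHom_comp_tensorHom_assoc, Category.assoc,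
      Category.assoc, f.inv_hom_id, Category.comp_id, Category.comp_id]
  refine ⟨hsupp.trans hA.1, fun g h X Y hX hY e e' => ?_⟩
  rw [hmul, hmul, ← Category.assoc, hA.2 g h X Y hX hY, Linear.smul_comp]

end SchellekensAlgebra

end

section

/-! ### Cochains on finite abelian groups -/

section Group

variable {G : Type u} [CommGroup G]

/-- Every finite abelian group is obtained from the trivial group by successively adding
independent cyclic subgroups. -/
theorem subgroup_top_induction [Finite G] {p : Subgroup G → Prop} (bot : p ⊥)
    (sup : ∀ K g, Disjoint K (Subgroup.zpowers g) → p K → p (K ⊔ Subgroup.zpowers g)) : p ⊤ := by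
  classical
  -- `K s` consists of the elements whose components outside of `s` are trivial
  obtain ⟨J, _, n, -, ⟨e⟩⟩ := CommGroup.equiv_prod_multiplicative_zmod_of_finite G
  let K : Finset J → Subgroup G := fun s =>
    { carrier := {g | ∀ i ∉ s, e g i = 1}
      one_mem' := fun i _ => by simp
      mul_mem' := fun {a b} ha hb i hi => by simp [ha i hi, hb i hi]
      inv_mem' := fun {a} ha i hi => by simp [ha i hi] }
  let h : J → G := fun i => e.symm (Pi.mulSingle i (Multiplicative.ofAdd 1))
  have hne : ∀ i j, j ≠ i → ∀ k : ℤ, e (h i ^ k) j = 1 := fun i j hij k => by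
    simp [h, hij]
  have hK : ∀ s, p (K s) := by
    intro s
    induction s using Finset.induction_on with
    | empty =>
      convert bot
      rw [eq_bot_iff]
      intro g hg
      exact e.injective (funext fun i => by simpa using hg i (by simp))
    | insert i s hi ih =>
      have h1 : K (insert i s) = K s ⊔ Subgroup.zpowers (h i) := by
        refine le_antisymm (fun g hg => ?_) (sup_le (fun g hg j hj => ?_) ?_)
        · obtain ⟨k, hk⟩ := ZMod.intCast_surjective (e g i).toAdd
          rw [← mul_inv_cancel_right g (h i ^ k)⁻¹, inv_inv]
          refine Subgroup.mul_mem_sup (fun j hj => ?_) (Subgroup.zpow_mem_zpowers _ _)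
          by_cases hij : j = i
          · subst hij
            have h2 : e (h j ^ k) j = e g j := by
              apply Multiplicative.toAdd.injective
              simp [h, hk]
            rw [map_mul, map_inv, Pi.mul_apply, Pi.inv_apply, h2, mul_inv_cancel]
          · rw [map_mul, map_inv, Pi.mul_apply, Pi.inv_apply, hne i j hij, inv_one, mul_one]
            exact hg j (by simp [hij, hj])
        · exact hg j fun h => hj (Finset.mem_insert_of_mem h)
        · rw [Subgroup.zpowers_le]
          intro j hj
          rw [← zpow_one (h i)]
          exact hne i j (fun h => hj (h ▸ Finset.mem_insert_self i s)) 1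
      rw [h1]
      refine sup _ _ (Subgroup.disjoint_def.2 fun {x} hx hx' => ?_) ih
      obtain ⟨k, rfl⟩ := hx'
      refine e.injective (funext fun j => ?_)
      rw [map_one]
      by_cases hij : j = i
      · subst hij
        exact hx j hi
      · exact hne i j hij k
  convert hK Finset.univ
  symm
  rw [eq_top_iff]
  intro g _ i hi
  exact absurd (Finset.mem_univ i) hi

theorem subgroup_induction {H : Subgroup G} [Finite H] {p : Subgroup G → Prop} (bot : p ⊥)
    (sup : ∀ K, ∀ g ∈ H, Disjoint K (Subgroup.zpowers g) → p K → p (K ⊔ Subgroup.zpowers g)) :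
    p H := by
  have h := subgroup_top_induction (G := H) (p := fun K => p (K.map H.subtype))
    (by rwa [Subgroup.map_bot]) fun K g hK hp => by
      have hd := Subgroup.disjoint_map H.subtype_injective hK
      rw [MonoidHom.map_zpowers] at hd
      have h1 := sup _ g g.2 hd hp
      rw [Subgroup.map_sup, MonoidHom.map_zpowers]
      exact h1
  rwa [← MonoidHom.range_eq_map, Subgroup.range_subtype] at h

/-- The elements of the join of two independent subgroups have unique components, which are
multiplicative. -/
theorem exists_components {K M : Subgroup G} (hd : Disjoint K M) :
    ∃ (p : ↥(K ⊔ M) →* K) (q : ↥(K ⊔ M) →* M), ∀ x : ↥(K ⊔ M), (x : G) = p x * q x := by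
  have h : ∀ x : ↥(K ⊔ M), ∃ y : K × M, (x : G) = y.1 * y.2 := fun x => by
    obtain ⟨y, z, h⟩ := Subgroup.mem_sup'.1 x.2
    exact ⟨(y, z), h.symm⟩
  choose r hr using h
  have hinj := Subgroup.mul_injective_of_disjoint hd
  have hmul : ∀ x y, r (x * y) = r x * r y := fun x y => hinj (by
    change ((r (x * y)).1 : G) * (r (x * y)).2 = ((r x).1 * (r y).1 : G) * ((r x).2 * (r y).2)
    rw [← hr, Subgroup.coe_mul, hr x, hr y, mul_mul_mul_comm])
  exact ⟨MonoidHom.mk' (fun x => (r x).1) fun x y => by rw [hmul]; rfl,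
    MonoidHom.mk' (fun x => (r x).2) fun x y => by rw [hmul]; rfl, hr⟩

/-- An alternating bihomomorphism on a finite abelian group is the antisymmetrization of a
bihomomorphism. -/
theorem exists_bihom_of_alternating [Finite G] {A : Type w} [CommGroup A] (χ : G →* G →* A)
    (hχ : ∀ g, χ g g = 1) : ∃ ν : G →* G →* A, ∀ g h, χ g h = ν g h * (ν h g)⁻¹ := by
  have hanti : ∀ g h, χ g h = (χ h g)⁻¹ := fun g h => by
    have h1 := hχ (g * h)
    simp only [map_mul, MonoidHom.mul_apply, hχ, one_mul, mul_one] at h1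
    rw [eq_inv_iff_mul_eq_one, mul_comm]
    exact h1
  have h : ∃ ν : (⊤ : Subgroup G) →* (⊤ : Subgroup G) →* A,
      ∀ g h : (⊤ : Subgroup G), χ (g : G) (h : G) = ν g h * (ν h g)⁻¹ := by
    refine subgroup_top_induction
      (p := fun K : Subgroup G => ∃ ν : K →* K →* A, ∀ g h : K,
        χ (g : G) (h : G) = ν g h * (ν h g)⁻¹) ?_ ?_
    · refine ⟨1, fun g h => ?_⟩
      rw [(Subgroup.mem_bot.1 g.2 : (g : G) = 1)]
      simp
    · rintro K g hd ⟨ν, hν⟩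
      obtain ⟨p, q, hpq⟩ := exists_components hd
      have hq : ∀ x y, χ (q x) (q y) = 1 := fun x y => by
        obtain ⟨i, hi⟩ := (q x).2
        obtain ⟨j, hj⟩ := (q y).2
        rw [← hi, ← hj]
        simp [hχ]
      -- on pairs `(k, c)`, `(k', c')` with `c, c'` in the cyclic factor take `ν(k, k') χ(k, c')`;
      -- the contribution of `c, c'` vanishes as `χ` is alternating on a cyclic group
      refine ⟨MonoidHom.mk' (fun x => (ν (p x)).comp p *
        (χ (p x)).comp ((Subgroup.zpowers g).subtype.comp q)) fun x y => ?_, fun x y => ?_⟩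
      · ext z
        simp only [map_mul, MonoidHom.mul_apply, MonoidHom.comp_apply, Subgroup.coe_mul]
        rw [mul_mul_mul_comm]
      · simp only [MonoidHom.mk'_apply, MonoidHom.mul_apply, MonoidHom.comp_apply,
          Subgroup.coe_subtype]
        rw [hpq x, hpq y]
        simp only [map_mul, MonoidHom.mul_apply, hq, hν (p x) (p y), hanti (q x) (p y), mul_one,
          mul_inv]
        ac_rfl
  obtain ⟨ν, hν⟩ := h
  let t : G →* (⊤ : Subgroup G) := (Subgroup.topEquiv (G := G)).symm.toMonoidHom
  refine ⟨MonoidHom.mk' (fun g => (ν (t g)).comp t) fun x y => ?_, fun g h => hν (t g) (t h)⟩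
  ext z
  simp

/-- The set underlying the extension of a group by the non-zero complex numbers that is defined by
a two-cocycle. -/
@[ext]
structure CocycleExtension (G : Type u) where
  base : G
  scalar : ℂˣ

/-- The extension defined by a symmetric two-cocycle `f`, with the group law
`(g, z) + (h, w) = (g h, z w f(g, h))`, which is commutative. The cocycle need not be normalized. -/
abbrev CocycleExtension.addCommGroup (f : G → G → ℂˣ) (hf : ∀ g h, f g h = f h g)
    (hc : ∀ g h k, f g h * f (g * h) k = f h k * f g (h * k)) :
    AddCommGroup (CocycleExtension G) :=
  have h1 : ∀ g, f 1 g = f 1 1 := fun g => by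
    have h := hc 1 1 g
    rw [mul_one, one_mul] at h
    exact (mul_right_cancel h).symm
  let _ : Add (CocycleExtension G) :=
    ⟨fun x y => ⟨x.base * y.base, x.scalar * y.scalar * f x.base y.base⟩⟩
  let _ : Zero (CocycleExtension G) := ⟨⟨1, (f 1 1)⁻¹⟩⟩
  let _ : Neg (CocycleExtension G) :=
    ⟨fun x => ⟨x.base⁻¹, x.scalar⁻¹ * (f x.base⁻¹ x.base)⁻¹ * (f 1 1)⁻¹⟩⟩
  { AddGroup.ofLeftAxioms
      (fun x y z => CocycleExtension.ext (mul_assoc _ _ _) (by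
        change x.scalar * y.scalar * f x.base y.base * z.scalar * f (x.base * y.base) z.base =
          x.scalar * (y.scalar * z.scalar * f y.base z.base) * f x.base (y.base * z.base)
        calc _ = x.scalar * y.scalar * z.scalar *
              (f x.base y.base * f (x.base * y.base) z.base) := by ac_rfl
          _ = _ := by rw [hc]; ac_rfl))
      (fun x => CocycleExtension.ext (one_mul _) (by
        change (f 1 1)⁻¹ * x.scalar * f 1 x.base = x.scalar
        rw [h1 x.base, inv_mul_cancel_comm]))
      (fun x => CocycleExtension.ext (inv_mul_cancel _) (by
        change x.scalar⁻¹ * (f x.base⁻¹ x.base)⁻¹ * (f 1 1)⁻¹ * x.scalar * f x.base⁻¹ x.base =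
          (f 1 1)⁻¹
        calc _ = (x.scalar⁻¹ * x.scalar) * ((f x.base⁻¹ x.base)⁻¹ * f x.base⁻¹ x.base) *
              (f 1 1)⁻¹ := by ac_rfl
          _ = _ := by simp)) with
    add_comm := fun x y => CocycleExtension.ext (mul_comm _ _) (by
      change x.scalar * y.scalar * f x.base y.base = y.scalar * x.scalar * f y.base x.base
      rw [mul_comm x.scalar, hf]) }

/-- A symmetric two-cocycle on an abelian group with values in the non-zero complex numbers is a
coboundary, because the extension it defines is abelian and splits, `ℂˣ` being divisible. -/
theorem exists_coboundary_of_symmetric (f : G → G → ℂˣ) (hf : ∀ g h, f g h = f h g)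
    (hc : ∀ g h k, f g h * f (g * h) k = f h k * f g (h * k)) :
    ∃ φ : G → ℂˣ, ∀ g h, f g h * φ (g * h) = φ g * φ h := by
  let _ := CocycleExtension.addCommGroup f hf hc
  have h1 : ∀ g, f 1 g = f 1 1 := fun g => by
    have h := hc 1 1 g
    rw [mul_one, one_mul] at h
    exact (mul_right_cancel h).symm
  let i : Additive ℂˣ →+ CocycleExtension G := AddMonoidHom.mk'
    (fun z => ⟨1, z.toMul * (f 1 1)⁻¹⟩) fun z w => CocycleExtension.ext (mul_one _).symm (by
      change z.toMul * w.toMul * (f 1 1)⁻¹ =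
        (z.toMul * (f 1 1)⁻¹) * (w.toMul * (f 1 1)⁻¹) * f 1 1
      rw [← mul_assoc, inv_mul_cancel_right, mul_right_comm])
  have hi : Function.Injective i := fun z w h =>
    mul_right_cancel (G := ℂˣ) (congrArg CocycleExtension.scalar h)
  have hdiv : DivisibleBy (Additive ℂˣ) ℤ := by
    have : DivisibleBy (Additive ℂˣ) ℕ := divisibleByOfSMulRightSurj _ _ fun {n} hn z => by
      obtain ⟨w, hw⟩ := IsAlgClosed.exists_pow_nat_eq (z.toMul : ℂ) (Nat.pos_of_ne_zero hn)
      have hw0 : w ≠ 0 := by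
        rintro rfl
        exact z.toMul.ne_zero (by rw [← hw, zero_pow hn])
      exact ⟨Additive.ofMul (Units.mk0 w hw0), Units.ext hw⟩
    exact AddGroup.divisibleByIntOfDivisibleByNat _
  obtain ⟨r, hr⟩ := (Module.Baer.of_divisible (Additive ℂˣ)).extension_property_addMonoidHom i hi
    (AddMonoidHom.id _)
  refine ⟨fun g => (r ⟨g, 1⟩).toMul, fun g h => ?_⟩
  have h2 : i (Additive.ofMul (f g h)) + ⟨g * h, 1⟩ = (⟨g, 1⟩ : CocycleExtension G) + ⟨h, 1⟩ :=
    CocycleExtension.ext (one_mul _) (by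
      change f g h * (f 1 1)⁻¹ * 1 * f 1 (g * h) = 1 * 1 * f g h
      rw [h1 (g * h), mul_one, inv_mul_cancel_right, one_mul, one_mul])
  have h3 := congrArg r h2
  rw [map_add, map_add, show r (i _) = _ from DFunLike.congr_fun hr _] at h3
  exact congrArg Additive.toMul h3

end Group

end

section

open Limits

/-! ### Existence and classification of trivializations -/

variable {C : Type u} [Category.{v} C] [Abelian C] [Linear ℂ C] [MonoidalCategory C]
  [MonoidalPreadditive C] [MonoidalLinear ℂ C] [BraidedCategory C] [RightRigidCategory C]
  [RibbonTwist C] [IsModular C] {F : PicFrame C} {H : Subgroup (Pic C)}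

namespace PicFrame

/-- If `ψ` is trivial on two independent subgroups then it is trivial on their join: the tensor
product of the two algebras is an algebra, whose structure constants are a trivialization. -/
theorem Trivializes.exists_sup (hdim : ∀ X : C, IsInvertible X → qdim X = 𝟙 (𝟙_ C))
    {K M : Subgroup (Pic C)} (hd : Disjoint K M) {ω : K → K → ℂˣ} {ω' : M → M → ℂˣ}
    (hω : F.Trivializes K ω) (hω' : F.Trivializes M ω') :
    ∃ ω'' : ↥(K ⊔ M) → ↥(K ⊔ M) → ℂˣ, F.Trivializes (K ⊔ M) ω'' := by
  have := Fintype.ofFinite K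
  have := Fintype.ofFinite M
  obtain ⟨A, e, ⟨he⟩, hA⟩ := hω.exists_isGivenBy hdim
  obtain ⟨B, f, ⟨hf⟩, hB⟩ := hω'.exists_isGivenBy hdim
  obtain ⟨p, hp, -, -⟩ := exists_projections he
  obtain ⟨q, hq, -, -⟩ := exists_projections hf
  obtain ⟨s, t, hst⟩ := exists_components hd
  have hL : ∀ k : K, ∀ m : M, InClass (F.L k ⊗ F.L m) (k * m : Pic C) := fun k m =>
    (F.inClass k).tensor (F.inClass m)
  have hne : ∀ k : K, ∀ m : M, (e k ⊗ₘ f m) ≠ 0 := fun k m h0 => (hL k m).id_ne_zero (by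
    rw [← id_tensorHom_id, ← hp, ← hq, ← tensorHom_comp_tensorHom, h0, zero_comp])
  have hr : ∀ x : ↥(K ⊔ M), Nonempty (F.L x ≅ F.L (s x) ⊗ F.L (t x)) := fun x =>
    (F.inClass x).iso (by rw [hst x]; exact hL _ _)
  let r := fun x => (hr x).some
  -- the product of two components is again a component, up to a factor that collects `ω`, `ω'`
  -- and the braiding in the product of `A ⊗ B`; the latter need not be computed
  have key : ∀ x y : ↥(K ⊔ M), ∃ z : ℂˣ,
      ((r x).hom ≫ (e (s x) ⊗ₘ f (t x)) ⊗ₘ ((r y).hom ≫ (e (s y) ⊗ₘ f (t y)))) ≫ μ[A.X ⊗ B.X] =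
        (z : ℂ) • ((F.b x y).hom ≫ (r (x * y)).hom ≫ (e (s (x * y)) ⊗ₘ f (t (x * y)))) := by
    intro x y
    let i : F.L x ⊗ F.L y ≅ F.L (s x * s y : K) ⊗ F.L (t x * t y : M) :=
      ((r x) ⊗ᵢ (r y)) ≪≫ ⟨tensorμ _ _ _ _, tensorδ _ _ _ _, tensorμ_tensorδ _ _ _ _,
        tensorδ_tensorμ _ _ _ _⟩ ≪≫ (F.b (s x) (s y) ⊗ᵢ F.b (t x) (t y))
    have h1 : ((r x).hom ≫ (e (s x) ⊗ₘ f (t x)) ⊗ₘ ((r y).hom ≫ (e (s y) ⊗ₘ f (t y)))) ≫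
        μ[A.X ⊗ B.X] =
        (ω (s x) (s y) * ω' (t x) (t y) : ℂ) • (i.hom ≫ (e (s x * s y) ⊗ₘ f (t x * t y))) := by
      rw [MonObj.tensorObj.mul_def, ← tensorHom_comp_tensorHom, Category.assoc,
        tensorμ_natural_assoc, tensorHom_comp_tensorHom, hA, hB, smul_tensorHom, tensorHom_smul,
        smul_smul, Linear.comp_smul, Linear.comp_smul, ← tensorHom_comp_tensorHom]
      simp [i]
    have h2 : ∃ j : F.L x ⊗ F.L y ≅ F.L (s (x * y)) ⊗ F.L (t (x * y)),
        i.hom ≫ (e (s x * s y) ⊗ₘ f (t x * t y)) =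
          j.hom ≫ (e (s (x * y)) ⊗ₘ f (t (x * y))) := by
      rw [map_mul, map_mul]
      exact ⟨i, rfl⟩
    obtain ⟨j, hj⟩ := h2
    obtain ⟨z, hz⟩ := ((F.inClass x).tensor (F.inClass y)).exists_unit_smul j.hom
      ((F.b x y) ≪≫ r (x * y)).hom
    refine ⟨ω (s x) (s y) * ω' (t x) (t y) * z, ?_⟩
    rw [h1, hj, hz, Linear.smul_comp, smul_smul]
    simp
  choose ω'' hω'' using key
  refine ⟨ω'', trivializes_of_product (fun x => (r x).hom ≫ (e (s x) ⊗ₘ f (t x))) (fun x => ?_)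
    hω''⟩
  rw [ne_eq, Preadditive.IsIso.comp_left_eq_zero]
  exact hne _ _

/-- If `θ_h ^ N_h = 1` for all `h` in `H` then `ψ` is trivial on `H`. -/
theorem exists_trivializes (hdim : ∀ X : C, IsInvertible X → qdim X = 𝟙 (𝟙_ C))
    (hθ : ∀ h ∈ H, theta h ^ orderOf h = 1) : ∃ ω : H → H → ℂˣ, F.Trivializes H ω := by
  refine subgroup_induction (p := fun K : Subgroup (Pic C) => ∃ ω : K → K → ℂˣ, F.Trivializes K ω)
    ?_ fun K g hg hd ⟨ω, hω⟩ => ?_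
  · rw [← Subgroup.zpowers_one_eq_bot]
    exact F.exists_trivializes_zpowers hdim 1 (hθ 1 H.one_mem)
  · obtain ⟨ω', hω'⟩ := F.exists_trivializes_zpowers hdim g (hθ g hg)
    exact hω.exists_sup hdim hd hω'

/-- Two trivializations of `ψ` differ by a two-cocycle. -/
theorem Trivializes.div_cocycle {ω ω' : H → H → ℂˣ} (hω : F.Trivializes H ω)
    (hω' : F.Trivializes H ω') (g h k : H) :
    ω g h / ω' g h * (ω (g * h) k / ω' (g * h) k) =
      ω h k / ω' h k * (ω g (h * k) / ω' g (h * k)) := by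
  have h1 := (hω g h k).trans (hω' g h k).symm
  rw [← div_eq_one] at h1 ⊢
  rw [← inv_eq_one, ← h1]
  apply Units.ext
  push_cast
  field_simp

/-- A bihomomorphism is a two-cocycle. -/
theorem Trivializes.mul_bihom {ω : H → H → ℂˣ} (hω : F.Trivializes H ω) (ν : H →* H →* ℂˣ) :
    F.Trivializes H fun g h => ω g h * ν g h := by
  intro g h k
  rw [← hω g h k]
  simp only [map_mul, MonoidHom.mul_apply]
  apply Units.ext
  push_cast
  field_simp

end PicFrame

/-- The condition on the diagonal gives `θ_h ^ (-N) = Ξ(h, h) ^ N = Ξ(h ^ N, h) = 1`. -/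
theorem IsKSB.theta_pow_orderOf {Ξ : H → H → ℂˣ} (hΞ : IsKSB H Ξ)
    (hd : ∀ h : H, Ξ h h = (theta (h : Pic C))⁻¹) {h : Pic C} (hh : h ∈ H) :
    theta h ^ orderOf h = 1 := by
  let χ : H →* ℂˣ := MonoidHom.mk' (fun g => Ξ g ⟨h, hh⟩) fun g g' => hΞ.mul_left g g' _
  have h1 : χ ⟨h, hh⟩ = (theta h)⁻¹ := hd ⟨h, hh⟩
  have h2 := map_pow χ ⟨h, hh⟩ (orderOf h)
  rw [← Subgroup.orderOf_mk h hh, pow_orderOf_eq_one, map_one, h1, Subgroup.orderOf_mk, inv_pow]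
    at h2
  exact inv_eq_one.1 h2.symm

namespace SchellekensAlgebra

variable {A B : SchellekensAlgebra C} {Ξ : H → H → ℂˣ}

/-- Rescaling the inclusions of the components by `φ` changes `ω` by the coboundary of `φ`. -/
theorem IsGivenBy.rescale {ω ω' : H → H → ℂˣ} (hA : A.IsGivenBy F H ω) (φ : H → ℂˣ)
    (hφ : ∀ g h, ω' g h * φ (g * h) = ω g h * (φ g * φ h)) : A.IsGivenBy F H ω' := by
  obtain ⟨e, he, -, hω⟩ := hA.exists_ne_zero
  refine ⟨fun h => (φ h : ℂ) • e h, nonempty_isColimit F hA.support_eq _ fun h => ?_,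
    fun g h => ?_⟩
  · exact smul_ne_zero (φ h).ne_zero (he h)
  · have h1 := congrArg Units.val (hφ g h)
    push_cast at h1
    rw [smul_tensorHom, tensorHom_smul, Linear.smul_comp, Linear.smul_comp, hω, Linear.comp_smul,
      smul_smul, smul_smul, smul_smul, h1]
    ring_nf

/-- Schellekens algebras with the same support and the same bihomomorphism are isomorphic: their
structure constants differ by a symmetric two-cocycle, which is a coboundary. -/
theorem HasSupportAndKSB.isomorphic (F : PicFrame C) (hA : A.HasSupportAndKSB H Ξ)
    (hB : B.HasSupportAndKSB H Ξ) : A.Isomorphic B := by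
  obtain ⟨ω, hω, hAω⟩ := exists_isGivenBy F hA.1
  obtain ⟨ω', hω', hBω⟩ := exists_isGivenBy F hB.1
  have h1 := (Sigma.mk.inj ((hAω.hasSupportAndKSB.unique hA).trans
    (hB.unique hBω.hasSupportAndKSB))).2
  have hsymm : ∀ g h, ω' g h / ω g h = ω' h g / ω h g := fun g h => by
    have h2 := congrFun (congrFun (eq_of_heq h1) g) h
    rw [mul_assoc, mul_assoc, mul_right_inj, ← div_eq_mul_inv, ← div_eq_mul_inv] at h2
    rw [div_eq_div_iff_mul_eq_mul] at h2 ⊢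
    rw [mul_comm (ω' h g), h2, mul_comm]
  obtain ⟨φ, hφ⟩ := exists_coboundary_of_symmetric _ hsymm (hω'.div_cocycle hω)
  refine (hAω.rescale φ fun g h => ?_).isomorphic hBω
  rw [← hφ, ← mul_assoc, mul_div_cancel]

/-- Every Kreuzer–Schellekens bihomomorphism with diagonal `θ⁻¹` occurs: any algebra with support
`H` can be modified by a bihomomorphism whose antisymmetrization is the given discrepancy. -/
theorem exists_hasSupportAndKSB (F : PicFrame C)
    (hdim : ∀ X : C, IsInvertible X → qdim X = 𝟙 (𝟙_ C)) (hΞ : IsKSB H Ξ)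
    (hd : ∀ h : H, Ξ h h = (theta (h : Pic C))⁻¹) :
    ∃ A : SchellekensAlgebra C, A.HasSupportAndKSB H Ξ := by
  obtain ⟨ω, hω⟩ := F.exists_trivializes hdim fun h hh => hΞ.theta_pow_orderOf hd hh
  obtain ⟨A, hA⟩ := hω.exists_isGivenBy hdim
  have hA' := hA.hasSupportAndKSB
  have hK := hA'.isKSB
  set Ξ' : H → H → ℂˣ := fun h g => (F.omega h g)⁻¹ * ω h g * (ω g h)⁻¹ with hΞ'
  let χ : H →* H →* ℂˣ := MonoidHom.mk'
    (fun g => MonoidHom.mk' (fun h => Ξ g h / Ξ' g h) fun h h' => by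
      rw [hΞ.mul_right, hK.mul_right, mul_div_mul_comm]) fun g g' => by
        ext h : 1
        exact (congrArg₂ _ (hΞ.mul_left g g' h) (hK.mul_left g g' h)).trans
          (mul_div_mul_comm _ _ _ _)
  obtain ⟨ν, hν⟩ := exists_bihom_of_alternating χ fun g =>
    div_eq_one.2 ((hd g).trans (hA'.diagonal hdim g).symm)
  obtain ⟨B, hB⟩ := (hω.mul_bihom ν).exists_isGivenBy hdim
  refine ⟨B, ?_⟩
  convert hB.hasSupportAndKSB using 1
  funext h g
  have h1 : Ξ h g / Ξ' h g = ν h g * (ν g h)⁻¹ := hν h g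
  rw [div_eq_iff_eq_mul] at h1
  rw [h1, hΞ', mul_inv]
  apply Units.ext
  push_cast
  ring

end SchellekensAlgebra

end

end

end Schellekens

theorem mainTheorem2 {C : Type*} [Category* C] [Abelian C] [Linear ℂ C] [MonoidalCategory C]
    [MonoidalPreadditive C] [MonoidalLinear ℂ C] [BraidedCategory C] [RightRigidCategory C]
    [RibbonTwist C] [IsModular C]
    (hdim : ∀ X : C, IsInvertible X → qdim X = 𝟙 (𝟙_ C)) (F : PicFrame C) :
    -- every Schellekens algebra is given by its support `H` and a cochain `ω` with `dω = ψ|_H`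
    (∀ A : SchellekensAlgebra C, ∃ (H : Subgroup (Pic C)) (ω : H → H → ℂˣ),
      A.support = (H : Set (Pic C)) ∧ F.Trivializes H ω ∧ A.IsGivenBy F H ω) ∧
    -- every such pair gives a Schellekens algebra, which is unique up to isomorphism
    (∀ (H : Subgroup (Pic C)) (ω : H → H → ℂˣ), F.Trivializes H ω →
      ∃ A : SchellekensAlgebra C, A.support = (H : Set (Pic C)) ∧ A.IsGivenBy F H ω ∧
        ∀ B : SchellekensAlgebra C, B.IsGivenBy F H ω → A.Isomorphic B) ∧
    -- the support and the bihomomorphism of a Schellekens algebra are well defined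
    (∀ A : SchellekensAlgebra C,
      ∃! p : (H : Subgroup (Pic C)) × (H → H → ℂˣ), A.HasSupportAndKSB p.1 p.2) ∧
    (∀ (A : SchellekensAlgebra C) (H : Subgroup (Pic C)) (Ξ : H → H → ℂˣ),
      A.HasSupportAndKSB H Ξ → IsKSB H Ξ ∧ ∀ h : H, Ξ h h = (theta (h : Pic C))⁻¹) ∧
    -- they determine the algebra up to isomorphism
    (∀ (A B : SchellekensAlgebra C) (H : Subgroup (Pic C)) (Ξ : H → H → ℂˣ),
      A.HasSupportAndKSB H Ξ → (A.Isomorphic B ↔ B.HasSupportAndKSB H Ξ)) ∧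
    -- every bihomomorphism with the appropriate diagonal occurs
    (∀ (H : Subgroup (Pic C)) (Ξ : H → H → ℂˣ),
      IsKSB H Ξ → (∀ h : H, Ξ h h = (theta (h : Pic C))⁻¹) →
        ∃ A : SchellekensAlgebra C, A.HasSupportAndKSB H Ξ) ∧
    -- the existence criterion
    (∀ H : Subgroup (Pic C),
      ((∃ A : SchellekensAlgebra C, A.support = (H : Set (Pic C))) ↔
        ∀ h ∈ H, theta h ^ orderOf h = 1) ∧
      ((∃ ω : H → H → ℂˣ, F.Trivializes H ω) ↔
        ∀ h ∈ H, theta h ^ orderOf h = 1)) := by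
  have hθ : ∀ {H : Subgroup (Pic C)} {A : SchellekensAlgebra C}, A.support = H →
      ∀ h ∈ H, theta h ^ orderOf h = 1 := fun {H A} hH h hh => by
    obtain ⟨ω, -, hA⟩ := SchellekensAlgebra.exists_isGivenBy F hH
    exact hA.hasSupportAndKSB.isKSB.theta_pow_orderOf (hA.hasSupportAndKSB.diagonal hdim) hh
  refine ⟨fun A => ⟨A.supportSubgroup, ?_⟩, fun H ω hω => ?_, fun A => ?_,
    fun A H Ξ hA => ⟨hA.isKSB, hA.diagonal hdim⟩,
    fun A B H Ξ hA => ⟨hA.of_isomorphic, hA.isomorphic F⟩,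
    fun H Ξ hΞ hd => SchellekensAlgebra.exists_hasSupportAndKSB F hdim hΞ hd,
    fun H => ⟨⟨fun ⟨A, hA⟩ => hθ hA, fun h => ?_⟩, ⟨fun ⟨ω, hω⟩ => ?_, F.exists_trivializes hdim⟩⟩⟩
  · obtain ⟨ω, hω, hA⟩ := SchellekensAlgebra.exists_isGivenBy F A.coe_supportSubgroup.symm
    exact ⟨ω, A.coe_supportSubgroup.symm, hω, hA⟩
  · obtain ⟨A, hA⟩ := hω.exists_isGivenBy hdim
    exact ⟨A, hA.support_eq, hA, fun B hB => hA.isomorphic hB⟩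
  · obtain ⟨ω, hω, hA⟩ := SchellekensAlgebra.exists_isGivenBy F A.coe_supportSubgroup.symm
    exact ⟨⟨_, _⟩, hA.hasSupportAndKSB, fun ⟨H, Ξ⟩ hp => hp.unique hA.hasSupportAndKSB⟩
  · obtain ⟨ω, hω⟩ := F.exists_trivializes hdim h
    obtain ⟨A, hA⟩ := hω.exists_isGivenBy hdim
    exact ⟨A, hA.support_eq⟩
  · obtain ⟨A, hA⟩ := hω.exists_isGivenBy hdim
    exact hθ hA.support_eq
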